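/- Let $n\ge 2$, let $\overline\Omega=\{x\in\mathbb R^n:|x|\le 1\}$ with interior $\Omega$, put $\rho(x)=1-|x|^2$ on $\overline\Omega$ and $\sigma(s)=1-s^2$ on $[-1,1]$. For $v$ on $(-1,1)\times S^{n-1}$ and $x\in\Omega$ put $R^*v(x)=\int_{S^{n-1}}v(x\cdot\theta,\theta)\,d\theta$, where $d\theta$ is the surface measure. *Index sets.* An index set is a set $E\subset\mathbb C\times\mathbb N_0$ such that $\{(\gamma,k)\in E:\operatorname{Re}\gamma<t\}$ is finite for every $t\in\mathbb R$, and such that $(\gamma,\ell)\in E$ implies $(\gamma,k)\in E$ for $0\le k\le\ell$ and $(\gamma+m,\ell)\in E$ for $m\in\mathbb N_0$. For finite $I\subset\mathbb C\times\mathbb N_0$, $\overline I=\bigcup_{(\gamma,\ell)\in I}(\gamma+\mathbb N_0)\times\{0,\dots,\ell\}$ is the smallest index set containing $I$. *Polyhomogeneity.* A $b$-vector field is a smooth vector field on $\overline\Omega$ that is tangent to $\partial\Omega=S^{n-1}$. For open $U\subset\Omega$ and $t\in\mathbb R$, let $\mathcal A^t(U)$ be the set of $w\in C^\infty(U)$ such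 that for all $k\ge0$ and all $b$-vector fields $V_1,\dots,V_k$ the function $V_1\cdots V_kw$ is $O(\rho^t)$ uniformly on $U$. An index set $E$ is an index set for $w:\Omega\to\mathbb C$ (and $w$ is then polyhomogeneous on $\overline\Omega$) if $w\in\mathcal A^{t_0}(\Omega)$ for some $t_0\in\mathbb R$ and there are $w_{\gamma,k}\in C^\infty(S^{n-1})$, $(\gamma,k)\in E$, and $\varepsilon\in(0,1)$ such that for every $t\in\mathbb R$ $$w-\sum_{(\gamma,k)\in E,\ \operatorname{Re}\gamma\le t}w_{\gamma,k}\Big(\frac{x}{|x|}\Big)\,\rho^\gamma\log(\rho)^k\in\mathcal A^t(\{0<\rho<\varepsilon\}).$$ **Theorem.** Let $a\in C^\infty(S^{n-1})$ be nonzero (complex-valued), $(\gamma,\ell)\in\mathbb C\times\mathbb N_0$, and let $\chi\in C_c^\infty([0,1))$, extended by $0$ to $[0,\infty)$, satisfy $\chi\equiv1$ near $0$. For either choice of the sign let $$u(s,\theta)=a(\theta)\,\sigma^\gamma\log(\sigma)^\ell\,\chi(1\pm s),\qquad (s,\theta)\in(-1,1)\times S^{n-1}.$$ Define $F_{(\gamma,\ell)}$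 as follows. * Case a (pole cancellation): if $n$ is even and $\gamma\in\mathbb N_0$, then $F_{(\gamma,\ell)}=\overline{\{(\frac{n-1}2+\gamma,\ell-1),(0,0)\}}$ for $\ell\ge1$, and $F_{(\gamma,0)}=\overline{\{(0,0)\}}$. * Case b: if $n$ is even and $\gamma\in\frac12+\mathbb Z$, or case c (pole creation): if $n$ is odd and $\gamma\in\{-1,-2,\dots\}$, then $F_{(\gamma,\ell)}=\overline{\{(\frac{n-1}2+\gamma,\ell),(0,0),(\eta,\ell+1)\}}$ with $\eta=\max(0,\frac{n-1}2+\gamma)$. * Case d: for all other $n\ge2$ and $(\gamma,\ell)$, $F_{(\gamma,\ell)}=\overline{\{(\frac{n-1}2+\gamma,\ell),(0,0)\}}$. Then $F_{(\gamma,\ell)}$ is an index set for $R^*u$; in particular $R^*u$ is polyhomogeneous on $\overline\Omega$. -/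

import Mathlib

open scoped ContDiff Manifold

noncomputable section

namespace Backprojection

/-- Euclidean space `ℝⁿ`. -/
abbrev Space (n : ℕ) : Type := EuclideanSpace ℝ (Fin n)

/-- The unit sphere `S^{n-1}` in `ℝⁿ`; it is also the boundary of the closed unit ball. -/
abbrev Sphere (n : ℕ) : Type := Metric.sphere (0 : Space n) 1

/-- For `n ≥ 2`, the dimension of `ℝⁿ` in the form that Mathlib uses to give the sphere its
structure of a smooth manifold of dimension `n - 1`. -/
instance factFinrank (n : ℕ) [n.AtLeastTwo] :
    Fact (Module.finrank ℝ (Space n) = (n - 1) + 1) :=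
  ⟨by
    have h : 2 ≤ n := Nat.AtLeastTwo.prop
    rw [finrank_euclideanSpace_fin]
    omega⟩

/-- `a ∈ C^∞(S^{n-1})`, for complex-valued functions. -/
def SmoothOnSphere (n : ℕ) [n.AtLeastTwo] (a : Sphere n → ℂ) : Prop :=
  ContMDiff (𝓡 (n - 1)) 𝓘(ℝ, ℂ) ∞ a

/-- The backprojection `R^* v (x) = ∫_{S^{n-1}} v(x · θ, θ) dθ`, where `dθ` is the (unnormalized)
surface measure of the unit sphere. -/
def backprojection (n : ℕ) (v : ℝ → Sphere n → ℂ) (x : Space n) : ℂ :=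
  ∫ θ : Sphere n, v (inner ℝ x (θ : Space n)) θ
    ∂(MeasureTheory.volume : MeasureTheory.Measure (Space n)).toSphere

/-- A cutoff `χ ∈ C^∞_c[0,1)` with `χ = 1` near `0`, extended by zero to `[1, ∞)`. Only the values
on `[0, ∞)` matter. -/
structure IsCutoff (χ : ℝ → ℂ) : Prop where
  smooth : ContDiffOn ℝ ∞ χ (Set.Ici 0)
  eq_one_near_zero : ∃ δ > 0, ∀ t, 0 ≤ t → t ≤ δ → χ t = 1
  eq_zero : ∃ b < 1, ∀ t, b ≤ t → χ t = 0

/-- The polyhomogeneous component `u(s,θ) = a(θ) σ^γ (log σ)^ℓ χ(1 + κ s)`, with `σ = 1 - s²`,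
on `(-1,1) × S^{n-1}`; the sign `κ = ±1` selects one of the two boundary components. -/
def phgComponent {n : ℕ} (a : Sphere n → ℂ) (γ : ℂ) (ℓ : ℕ) (χ : ℝ → ℂ) (κ : ℝ)
    (s : ℝ) (θ : Sphere n) : ℂ :=
  a θ * ((1 - s ^ 2 : ℝ) : ℂ) ^ γ * ((Real.log (1 - s ^ 2) : ℝ) : ℂ) ^ ℓ * χ (1 + κ * s)

/-- Index sets `E ⊆ ℂ × ℕ₀` (smooth index sets). -/
structure IsIndexSet (E : Set (ℂ × ℕ)) : Prop where
  finite_lt : ∀ t : ℝ, {p ∈ E | p.1.re < t}.Finite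
  log_closed : ∀ p ∈ E, ∀ k ≤ p.2, (p.1, k) ∈ E
  shift_closed : ∀ p ∈ E, ∀ m : ℕ, (p.1 + m, p.2) ∈ E

/-- The index set generated by `I`: all `(γ + m, k)` with `(γ, ℓ) ∈ I`, `m ∈ ℕ₀`, `0 ≤ k ≤ ℓ`. -/
def generated (I : Set (ℂ × ℕ)) : Set (ℂ × ℕ) :=
  {p | ∃ q ∈ I, (∃ m : ℕ, p.1 = q.1 + m) ∧ p.2 ≤ q.2}

/-- `generated I` is the smallest index set that contains the finite set `I`. -/
theorem isLeast_generated {I : Set (ℂ × ℕ)} (hI : I.Finite) :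
    IsLeast {E | IsIndexSet E ∧ I ⊆ E} (generated I) := by
  refine ⟨⟨⟨?_, ?_, ?_⟩, ?_⟩, ?_⟩
  · intro t
    have hfin : (⋃ q ∈ I, (fun mk : ℕ × ℕ => ((q.1 + mk.1, mk.2) : ℂ × ℕ)) ''
        (Set.Iic (Nat.ceil (t - q.1.re)) ×ˢ Set.Iic q.2)).Finite :=
      hI.biUnion fun q _ => ((Set.finite_Iic _).prod (Set.finite_Iic _)).image _
    refine hfin.subset ?_
    rintro ⟨z, k⟩ ⟨⟨q, hq, ⟨m, hm⟩, hk⟩, ht⟩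
    simp only at hm hk ht
    subst hm
    refine Set.mem_biUnion hq ⟨(m, k), ⟨?_, hk⟩, rfl⟩
    have h1 : (m : ℝ) ≤ t - q.1.re := by
      simp only [Complex.add_re, Complex.natCast_re] at ht
      linarith
    have h2 : (m : ℝ) ≤ (Nat.ceil (t - q.1.re) : ℝ) := h1.trans (Nat.le_ceil _)
    simpa using (by exact_mod_cast h2 : m ≤ Nat.ceil (t - q.1.re))
  · rintro p ⟨q, hq, hm, hk⟩ k hkp
    exact ⟨q, hq, hm, hkp.trans hk⟩
  · rintro p ⟨q, hq, ⟨m, hm⟩, hk⟩ m'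
    exact ⟨q, hq, ⟨m + m', by simp [hm, add_assoc]⟩, hk⟩
  · intro q hq
    exact ⟨q, hq, ⟨0, by simp⟩, le_rfl⟩
  · rintro E ⟨hE, hIE⟩ ⟨z, k⟩ ⟨q, hq, ⟨m, hm⟩, hk⟩
    simp only at hm hk
    subst hm
    exact hE.log_closed _ (hE.shift_closed q (hIE hq) m) k hk

open Classical in
/-- The index set `F_{(γ,ℓ)}`. The four branches are, in this order: pole cancellation
(`n` even, `γ ∈ ℕ₀`; nothing but `(0,0)` generates when `ℓ = 0`); `n` even with `γ ∈ 1/2 + ℤ`, or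
pole creation (`n` odd, `γ ∈ {-1, -2, …}`); all the other cases. In the middle branch `γ` is
real, so that `γ.re` is `γ`. -/
def indexSetF (n : ℕ) (γ : ℂ) (ℓ : ℕ) : Set (ℂ × ℕ) :=
  if Even n ∧ ∃ m : ℕ, γ = m then
    if ℓ = 0 then generated {(0, 0)}
    else generated {(((n : ℂ) - 1) / 2 + γ, ℓ - 1), (0, 0)}
  else if (Even n ∧ ∃ k : ℤ, γ = 1 / 2 + (k : ℂ)) ∨ (Odd n ∧ ∃ k : ℕ, 1 ≤ k ∧ γ = -(k : ℂ)) then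
    generated {(((n : ℂ) - 1) / 2 + γ, ℓ), (0, 0),
      (((max 0 (((n : ℝ) - 1) / 2 + γ.re) : ℝ) : ℂ), ℓ + 1)}
  else
    generated {(((n : ℂ) - 1) / 2 + γ, ℓ), (0, 0)}

/-- The boundary-defining function `ρ(x) = 1 - |x|²` of the closed unit ball. -/
def bdf {n : ℕ} (x : Space n) : ℝ := 1 - ‖x‖ ^ 2

/-- The radial extension `ã(x) = a(x / |x|)` (with the value `0` at the origin). -/
def radialExt {n : ℕ} (a : Sphere n → ℂ) (x : Space n) : ℂ :=
  if h : x = 0 then 0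
  else a ⟨‖x‖⁻¹ • x, by
    rw [mem_sphere_zero_iff_norm, norm_smul, norm_inv, norm_norm,
      inv_mul_cancel₀ (norm_ne_zero_iff.mpr h)]⟩

/-- The `b`-vector fields of the closed unit ball: smooth vector fields that are tangent to the
unit sphere. (A smooth vector field on the closed ball is the restriction of one on `ℝⁿ`.) -/
structure IsBField {n : ℕ} (V : Space n → Space n) : Prop where
  smooth : ContDiff ℝ ∞ V
  tangent : ∀ x : Space n, ‖x‖ = 1 → inner ℝ x (V x) = 0

/-- The iterated derivation `V₁ V₂ ⋯ V_k u`. -/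
def iterDerivation {n : ℕ} : List (Space n → Space n) → (Space n → ℂ) → Space n → ℂ
  | [], u => u
  | V :: Vs, u => fun x => fderiv ℝ (iterDerivation Vs u) x (V x)

/-- Conormality of weight `t` on the open part `U` of the open ball: `u` is smooth on `U`, and
every `V₁ ⋯ V_k u` with `b`-vector fields `V_i` is `O(ρ^t)`, uniformly on `U`. With `U` the whole
open ball this is `𝒜^t` of the closed ball (which is compact, so that locally uniform bounds
are uniform). -/
def IsConormalOn {n : ℕ} (U : Set (Space n)) (t : ℝ) (u : Space n → ℂ) : Prop :=
  ContDiffOn ℝ ∞ u U ∧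
    ∀ Vs : List (Space n → Space n), (∀ V ∈ Vs, IsBField V) →
      ∃ C : ℝ, ∀ x ∈ U, ‖iterDerivation Vs u x‖ ≤ C * bdf x ^ t

/-- The collar `{0 < ρ < ε}` of the boundary sphere in the open ball. -/
def collar (n : ℕ) (ε : ℝ) : Set (Space n) := {x | 0 < bdf x ∧ bdf x < ε}

/-- `E` is an index set for `u`: the function `u` is polyhomogeneous conormal on the closed unit
ball, with an expansion `u ∼ ∑_{(γ,k) ∈ E} u_{γ,k}(x/|x|) ρ^γ (log ρ)^k` at the boundary. For
every real `t`, the difference of `u` and the finitely many terms with `Re γ ≤ t` is conormal of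
weight `t` near the boundary. -/
structure IsPolyhomogeneous (n : ℕ) [n.AtLeastTwo] (E : Set (ℂ × ℕ)) (u : Space n → ℂ) :
    Prop where
  indexSet : IsIndexSet E
  conormal : ∃ t : ℝ, IsConormalOn (Metric.ball 0 1) t u
  expansion : ∃ c : ℂ × ℕ → Sphere n → ℂ, (∀ p ∈ E, SmoothOnSphere n (c p)) ∧
    ∃ ε : ℝ, 0 < ε ∧ ε < 1 ∧ ∀ t : ℝ, ∃ S : Finset (ℂ × ℕ),
      (∀ p, p ∈ S ↔ p ∈ E ∧ p.1.re ≤ t) ∧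
      IsConormalOn (collar n ε) t (fun x => u x -
        ∑ p ∈ S, radialExt (c p) x * ((bdf x : ℝ) : ℂ) ^ p.1 *
          ((Real.log (bdf x) : ℝ) : ℂ) ^ p.2)

end Backprojection

end

open scoped ContDiff Manifold

noncomputable section

namespace Backprojection

variable {n : ℕ}

/-! ### Smooth functions on a collar of the boundary -/

/-! The backprojection superposes plane waves with profile `f = ψ σ^γ log(σ)^k`, where `ψ` is a
smooth cutoff that is constant near `±1`. Differentiating `σ f' = -2s(γ f + k h)`, with `h = σ^γ
log(σ)^(k-1)`, gives a second order equation for `f` modulo an error supported where `ψ' ≠ 0`, hence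
smooth on the whole line (`profile_ode`, `contDiff_odeError`).

Let `D = ρ ∂_ρ` and let `L` be the rotation derivatives. On a plane wave, `D`, `D²` and the
spherical Laplacian produce only the integrals of `a s f'`, `a s² f''` and `a f''`. The profile
equation therefore becomes, with `z = (n-1)/2 + γ`, `D (D - z) w = k D w' + ρ u`
(`opD_opDsub_ridge`). Here `w'` belongs to the profile with one logarithm fewer, and `u` is built
from `w`, `w'` and a smooth function by `D`, `L`, `ρ` and scalars. The indicial roots are `0` and
`z`.

Since `(D - z - 1) ρ = ρ (D - z)`, iterating the equation shows that the product over `j < N` of `(D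
- j)(D - z - j)^e` raises the weight of `w` from `τ` to `τ + N` (`mem_indSpace_of_eq`). Each
logarithm in the profile raises `e` by one. The root `0` stays simple because `w'` enters only
through `D w'`. In general `e = ℓ + 1`. If `γ ∈ ℕ₀`, the profile without logarithm is already smooth
and `e = ℓ`: this is the pole cancellation.

Such operators force an expansion (`exists_expansion`). A factor `D - z` is an ordinary differential
operator along rays, and inverting it produces a term `c ρ^z` whose coefficient is a boundary value,
smooth because `D` commutes with `L`. Repeated roots produce logarithms, so the admissible `(y, k)`
are those with `k` less than the multiplicity of `y` as a root. Counting multiplicities gives the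
index sets (`mem_indexSetF_of_lt_count`): an extra logarithm arises exactly when the families `j`
and `z + j` meet, that is, when `z` is an integer.

Conormality is handled algebraically: the conormal functions of weight `t` form the largest space of
`O(ρ^t)` functions stable under `D` and `L`, so it suffices to exhibit families whose span is stable
(`mem_conormal_of_stable`). -/

/-- The collar `{0 < ρ < 1/2}`. -/
abbrev collarHalf (n : ℕ) : Set (Space n) := collar n (1 / 2)

theorem contDiff_bdf : ContDiff ℝ ∞ (bdf : Space n → ℝ) :=
  contDiff_const.sub (contDiff_norm_sq ℝ)

theorem isOpen_collar (ε : ℝ) : IsOpen (collar n ε) :=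
  (isOpen_lt continuous_const contDiff_bdf.continuous).inter
    (isOpen_lt contDiff_bdf.continuous continuous_const)

theorem bdf_pos {x : Space n} (hx : x ∈ collarHalf n) : 0 < bdf x := hx.1

theorem bdf_lt_half {x : Space n} (hx : x ∈ collarHalf n) : bdf x < 1 / 2 := hx.2

theorem normSq_eq (x : Space n) : ‖x‖ ^ 2 = 1 - bdf x := by simp [bdf]

theorem ne_zero_of_mem_collarHalf {x : Space n} (hx : x ∈ collarHalf n) : x ≠ 0 := by
  rintro rfl
  have := bdf_lt_half hx
  norm_num [bdf] at this

/-- The space of smooth functions on the collar, extended by zero. -/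
def smoothSubmodule (n : ℕ) : Submodule ℂ (Space n → ℂ) where
  carrier := {w | ContDiffOn ℝ ∞ w (collarHalf n) ∧ ∀ x ∉ collarHalf n, w x = 0}
  add_mem' hv hw := ⟨hv.1.add hw.1, fun x hx => by simp [hv.2 x hx, hw.2 x hx]⟩
  zero_mem' := ⟨contDiffOn_const, fun _ _ => rfl⟩
  smul_mem' c _ hw := ⟨contDiffOn_const.smul hw.1, fun x hx => by simp [hw.2 x hx]⟩

/-- The type of smooth functions on the collar, extended by zero. -/
def SmoothFn (n : ℕ) : Type := ↥(smoothSubmodule n)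

instance : AddCommGroup (SmoothFn n) := inferInstanceAs (AddCommGroup (smoothSubmodule n))
instance : Module ℂ (SmoothFn n) := inferInstanceAs (Module ℂ (smoothSubmodule n))
instance : CoeFun (SmoothFn n) (fun _ => Space n → ℂ) := ⟨fun w => w.1⟩

namespace SmoothFn

theorem contDiffOn (w : SmoothFn n) : ContDiffOn ℝ ∞ w (collarHalf n) := w.2.1

theorem contDiffAt (w : SmoothFn n) {x : Space n} (hx : x ∈ collarHalf n) :
    ContDiffAt ℝ ∞ w x :=
  w.contDiffOn.contDiffAt ((isOpen_collar _).mem_nhds hx)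

theorem differentiableAt (w : SmoothFn n) {x : Space n} (hx : x ∈ collarHalf n) :
    DifferentiableAt ℝ w x := (w.contDiffAt hx).differentiableAt (by simp)

@[ext] theorem ext {v w : SmoothFn n} (h : ∀ x ∈ collarHalf n, v x = w x) : v = w := by
  refine Subtype.ext (funext fun x => ?_)
  by_cases hx : x ∈ collarHalf n
  · exact h x hx
  · rw [v.2.2 x hx, w.2.2 x hx]

/-- Restriction of a function to the collar. -/
def ofFun (w : Space n → ℂ) (hw : ContDiffOn ℝ ∞ w (collarHalf n)) : SmoothFn n :=
  ⟨(collarHalf n).indicator w,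
    hw.congr fun _ hx => Set.indicator_of_mem hx _,
    fun _ hx => Set.indicator_of_notMem hx _⟩

theorem ofFun_apply {w : Space n → ℂ} (hw : ContDiffOn ℝ ∞ w (collarHalf n)) {x : Space n}
    (hx : x ∈ collarHalf n) : ofFun w hw x = w x := Set.indicator_of_mem hx _

theorem fderiv_ofFun {w : Space n → ℂ} (hw : ContDiffOn ℝ ∞ w (collarHalf n)) {x : Space n}
    (hx : x ∈ collarHalf n) : fderiv ℝ (ofFun w hw) x = fderiv ℝ w x :=
  Filter.EventuallyEq.fderiv_eq <| Filter.eventuallyEq_of_mem ((isOpen_collar _).mem_nhds hx)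
    fun _ hy => ofFun_apply hw hy

@[simp] theorem add_apply (v w : SmoothFn n) (x : Space n) : (v + w) x = v x + w x := rfl
@[simp] theorem sub_apply (v w : SmoothFn n) (x : Space n) : (v - w) x = v x - w x := rfl
@[simp] theorem smul_apply (c : ℂ) (w : SmoothFn n) (x : Space n) : (c • w) x = c * w x := rfl
@[simp] theorem zero_apply (x : Space n) : (0 : SmoothFn n) x = 0 := rfl

theorem sum_apply {ι : Type*} (s : Finset ι) (w : ι → SmoothFn n) (x : Space n) :
    (∑ i ∈ s, w i) x = ∑ i ∈ s, w i x := by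
  classical
  induction s using Finset.induction_on with
  | empty => simp
  | insert a s ha ih => simp [Finset.sum_insert ha, ih]

theorem contDiffOn_fderiv (w : SmoothFn n) :
    ContDiffOn ℝ ∞ (fderiv ℝ w) (collarHalf n) :=
  ((contDiffOn_infty_iff_fderiv_of_isOpen (isOpen_collar _)).1 w.contDiffOn).2

/-- The derivative along a vector field. -/
def vder (V : Space n → Space n) (hV : ContDiffOn ℝ ∞ V (collarHalf n)) :
    Module.End ℂ (SmoothFn n) where
  toFun w := ofFun (fun x => fderiv ℝ w x (V x)) (w.contDiffOn_fderiv.clm_apply hV)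
  map_add' v w := by
    ext x hx
    rw [ofFun_apply _ hx, add_apply, ofFun_apply _ hx, ofFun_apply _ hx]
    have : fderiv ℝ ((v + w : SmoothFn n) : Space n → ℂ) x = fderiv ℝ v x + fderiv ℝ w x :=
      fderiv_add (v.differentiableAt hx) (w.differentiableAt hx)
    rw [this]; rfl
  map_smul' c w := by
    ext x hx
    rw [ofFun_apply _ hx, RingHom.id_apply, smul_apply, ofFun_apply _ hx]
    have : fderiv ℝ ((c • w : SmoothFn n) : Space n → ℂ) x = c • fderiv ℝ w x :=
      fderiv_const_smul (w.differentiableAt hx) c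
    rw [this]; rfl

theorem vder_apply {V : Space n → Space n} (hV : ContDiffOn ℝ ∞ V (collarHalf n))
    (w : SmoothFn n) {x : Space n} (hx : x ∈ collarHalf n) :
    vder V hV w x = fderiv ℝ w x (V x) :=
  ofFun_apply (w.contDiffOn_fderiv.clm_apply hV) hx

theorem vder_vder_apply {V W : Space n → Space n} (hV : ContDiffOn ℝ ∞ V (collarHalf n))
    (hW : ContDiffOn ℝ ∞ W (collarHalf n))
    (w : SmoothFn n) {x : Space n} (hx : x ∈ collarHalf n) :
    vder V hV (vder W hW w) x =
      fderiv ℝ (fderiv ℝ w) x (V x) (W x) + fderiv ℝ w x (fderiv ℝ W x (V x)) := by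
  have hn := (isOpen_collar (n := n) (1 / 2)).mem_nhds hx
  have h1 : DifferentiableAt ℝ (fderiv ℝ w) x :=
    (w.contDiffOn_fderiv.contDiffAt hn).differentiableAt (by simp)
  have h2 : DifferentiableAt ℝ W x := (hW.contDiffAt hn).differentiableAt (by simp)
  rw [vder_apply hV _ hx]
  have : fderiv ℝ (vder W hW w) x = fderiv ℝ (fun y => fderiv ℝ w y (W y)) x :=
    fderiv_ofFun (w.contDiffOn_fderiv.clm_apply hW) hx
  rw [this, fderiv_clm_apply h1 h2]
  simp [add_comm]

/-- By symmetry of the second derivative, the commutator is the derivative along the Lie bracket of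
the two fields, which `h` makes zero. -/
theorem commute_vder {V W : Space n → Space n} (hV : ContDiffOn ℝ ∞ V (collarHalf n))
    (hW : ContDiffOn ℝ ∞ W (collarHalf n))
    (h : ∀ x ∈ collarHalf n, fderiv ℝ W x (V x) = fderiv ℝ V x (W x)) :
    Commute (vder V hV) (vder W hW) := by
  refine LinearMap.ext fun w => ?_
  ext x hx
  change vder V hV (vder W hW w) x = vder W hW (vder V hV w) x
  have hs : IsSymmSndFDerivAt ℝ w x :=
    (w.contDiffAt hx).isSymmSndFDerivAt 
      (by simpa using WithTop.coe_le_coe.2 (le_top : (2 : ℕ∞) ≤ ⊤))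
  rw [vder_vder_apply hV hW w hx, vder_vder_apply hW hV w hx, h x hx, hs.eq]

/-- The pointwise product. -/
def pmul (v w : SmoothFn n) : SmoothFn n :=
  ⟨fun x => v x * w x, v.contDiffOn.mul w.contDiffOn, fun x hx => by simp [v.2.2 x hx]⟩

@[simp] theorem pmul_apply (v w : SmoothFn n) (x : Space n) : pmul v w x = v x * w x := rfl

theorem pmul_comm (v w : SmoothFn n) : pmul v w = pmul w v := by
  ext x hx; simp [mul_comm]

theorem pmul_add (u v w : SmoothFn n) : pmul u (v + w) = pmul u v + pmul u w := by
  ext x hx; simp [mul_add]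

theorem smul_pmul (c : ℂ) (v w : SmoothFn n) : pmul (c • v) w = c • pmul v w := by
  ext x hx; simp [mul_assoc]

theorem pmul_smul (c : ℂ) (v w : SmoothFn n) : pmul v (c • w) = c • pmul v w := by
  ext x hx; simp [mul_left_comm]

theorem pmul_assoc (u v w : SmoothFn n) : pmul (pmul u v) w = pmul u (pmul v w) := by
  ext x hx; simp [mul_assoc]

theorem vder_pmul {V : Space n → Space n} (hV : ContDiffOn ℝ ∞ V (collarHalf n))
    (v w : SmoothFn n) :
    vder V hV (pmul v w) = pmul (vder V hV v) w + pmul v (vder V hV w) := by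
  ext x hx
  rw [vder_apply hV _ hx, add_apply, pmul_apply, pmul_apply, vder_apply hV _ hx,
    vder_apply hV _ hx]
  have : fderiv ℝ (pmul v w) x = v x • fderiv ℝ w x + w x • fderiv ℝ v x :=
    fderiv_mul (v.differentiableAt hx) (w.differentiableAt hx)
  rw [this]
  simp; ring

end SmoothFn

open SmoothFn

/-! ### Generators of the `b`-vector fields on the collar: the radial field and the rotations. -/

/-- The radial field `ρ ∂_ρ`. -/
def radialField (x : Space n) : Space n := (-(bdf x / (2 * ‖x‖ ^ 2))) • x

/-- The generator of the rotations in the plane of the coordinates `i`, `j`. -/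
def rotField (i j : Fin n) : Space n →L[ℝ] Space n :=
  (EuclideanSpace.proj i).smulRight (EuclideanSpace.single j (1 : ℝ)) -
    (EuclideanSpace.proj j).smulRight (EuclideanSpace.single i (1 : ℝ))

theorem rotField_apply (i j : Fin n) (x : Space n) :
    rotField i j x = x i • EuclideanSpace.single j (1 : ℝ) - x j • EuclideanSpace.single i 1 :=
  rfl

theorem inner_rotField (i j : Fin n) (x y : Space n) :
    inner ℝ (rotField i j x) y = x i * y j - x j * y i := by
  simp [rotField_apply, inner_sub_left, inner_smul_left, EuclideanSpace.inner_single_left]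

theorem inner_rotField_self (i j : Fin n) (x : Space n) : inner ℝ x (rotField i j x) = 0 := by
  rw [real_inner_comm, inner_rotField]; ring

theorem contDiffOn_radialField : ContDiffOn ℝ ∞ (radialField : Space n → Space n) {0}ᶜ := by
  refine ContDiffOn.smul (ContDiffOn.neg (ContDiffOn.div contDiff_bdf.contDiffOn
    (contDiffOn_const.mul (contDiff_norm_sq ℝ).contDiffOn) ?_)) contDiffOn_id
  intro x hx
  have : ‖x‖ ≠ 0 := norm_ne_zero_iff.2 hx
  positivity

theorem collarHalf_subset : collarHalf n ⊆ {0}ᶜ := fun _ hx => ne_zero_of_mem_collarHalf hx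

/-- Labels of the fields that generate the `b`-vector fields over the collar. -/
abbrev Gen (n : ℕ) : Type := Option (Fin n × Fin n)

/-- The generating fields: the radial field and the rotations. -/
def genField : Gen n → Space n → Space n
  | none => radialField
  | some p => rotField p.1 p.2

theorem contDiffOn_genField (g : Gen n) : ContDiffOn ℝ ∞ (genField g) ({0}ᶜ : Set (Space n)) := by
  cases g with
  | none => exact contDiffOn_radialField
  | some p => exact (rotField p.1 p.2).contDiff.contDiffOn

/-- The derivations given by the generating fields. -/
def op (g : Gen n) : Module.End ℂ (SmoothFn n) :=
  vder (genField g) ((contDiffOn_genField g).mono collarHalf_subset)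

/-- The operator `ρ ∂_ρ`. -/
abbrev opD (n : ℕ) : Module.End ℂ (SmoothFn n) := op none

/-- The angular derivative `x_i ∂_j - x_j ∂_i`. -/
abbrev opL (i j : Fin n) : Module.End ℂ (SmoothFn n) := op (some (i, j))

theorem op_apply (g : Gen n) (w : SmoothFn n) {x : Space n} (hx : x ∈ collarHalf n) :
    op g w x = fderiv ℝ w x (genField g x) := vder_apply _ w hx

theorem op_pmul (g : Gen n) (v w : SmoothFn n) :
    op g (pmul v w) = pmul (op g v) w + pmul v (op g w) := vder_pmul _ v w

theorem hasFDerivAt_bdf (x : Space n) : HasFDerivAt bdf (-(2 • innerSL ℝ x)) x := by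
  have := (hasStrictFDerivAt_norm_sq x).hasFDerivAt
  exact this.const_sub 1

/-- The scalar coefficient of the radial field depends on `‖x‖` only and is constant along
rotations, so only the factor `x` is differentiated. -/
theorem fderiv_radialField_rotField {x : Space n} (hx : x ≠ 0) (i j : Fin n) :
    fderiv ℝ radialField x (rotField i j x) = (-(bdf x / (2 * ‖x‖ ^ 2))) • rotField i j x := by
  have hn : ‖x‖ ≠ 0 := norm_ne_zero_iff.2 hx
  have h1 : HasFDerivAt (fun y : Space n => ‖y‖ ^ 2) (2 • innerSL ℝ x) x :=
    (hasStrictFDerivAt_norm_sq x).hasFDerivAt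
  have h2 := ((hasFDerivAt_bdf x).mul ((hasDerivAt_inv (by positivity : 2 * ‖x‖ ^ 2 ≠ 0)
    ).comp_hasFDerivAt x (h1.const_mul 2))).neg
  have h3 := h2.smul (hasFDerivAt_id x)
  have h4 : HasFDerivAt radialField _ x := h3
  rw [h4.fderiv]
  simp [inner_rotField_self, div_eq_mul_inv]

/-- This commutation lets every statement about `D - z` on `O(ρ^t)` functions pass to conormal
functions, and it makes the boundary values smooth. -/
theorem commute_opD_opL (i j : Fin n) : Commute (opD n) (opL i j) := by
  refine commute_vder _ _ fun x hx => ?_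
  have h0 := ne_zero_of_mem_collarHalf hx
  change fderiv ℝ (rotField i j) x (radialField x) = fderiv ℝ radialField x (rotField i j x)
  rw [fderiv_radialField_rotField h0, (rotField i j).fderiv, radialField, map_smul]

/-- The boundary-defining function as a smooth function on the collar. -/
def rho (n : ℕ) : SmoothFn n :=
  ofFun (fun x => (bdf x : ℂ)) (Complex.ofRealCLM.contDiff.comp contDiff_bdf).contDiffOn

theorem rho_apply {x : Space n} (hx : x ∈ collarHalf n) : rho n x = bdf x := ofFun_apply _ hx

theorem fderiv_bdf_genField_none {x : Space n} (hx : x ≠ 0) :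
    fderiv ℝ bdf x (genField none x) = bdf x := by
  have hn : ‖x‖ ≠ 0 := norm_ne_zero_iff.2 hx
  rw [(hasFDerivAt_bdf x).fderiv]
  simp only [genField, radialField, map_smul]
  simp
  field_simp

theorem fderiv_bdf_genField_some (p : Fin n × Fin n) (x : Space n) :
    fderiv ℝ bdf x (genField (some p) x) = 0 := by
  rw [(hasFDerivAt_bdf x).fderiv]
  simp [genField, inner_rotField_self]

/-! ### Conormal functions on the collar -/

/-- The functions on the collar that are `O(ρ^t)`. -/
def bounded (n : ℕ) (t : ℝ) : Submodule ℂ (SmoothFn n) where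
  carrier := {w | ∃ C : ℝ, ∀ x ∈ collarHalf n, ‖w x‖ ≤ C * bdf x ^ t}
  add_mem' := by
    rintro v w ⟨C, hC⟩ ⟨C', hC'⟩
    refine ⟨C + C', fun x hx => (norm_add_le _ _).trans ?_⟩
    rw [add_mul]
    exact add_le_add (hC x hx) (hC' x hx)
  zero_mem' := ⟨0, fun x hx => by simp⟩
  smul_mem' := by
    rintro c w ⟨C, hC⟩
    refine ⟨‖c‖ * C, fun x hx => ?_⟩
    rw [smul_apply, norm_mul, mul_assoc]
    exact mul_le_mul_of_nonneg_left (hC x hx) (norm_nonneg _)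

theorem bounded_anti {s t : ℝ} (h : s ≤ t) : bounded n t ≤ bounded n s := by
  rintro w ⟨C, hC⟩
  refine ⟨|C|, fun x hx => (hC x hx).trans ?_⟩
  have hp := bdf_pos hx
  have h1 : bdf x ^ t ≤ bdf x ^ s :=
    Real.rpow_le_rpow_of_exponent_ge hp (by linarith [bdf_lt_half hx]) h
  exact mul_le_mul (le_abs_self C) h1 (by positivity) (abs_nonneg C)

theorem pmul_mem_bounded {s t : ℝ} {v w : SmoothFn n} (hv : v ∈ bounded n s)
    (hw : w ∈ bounded n t) : pmul v w ∈ bounded n (s + t) := by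
  obtain ⟨C, hC⟩ := hv
  obtain ⟨C', hC'⟩ := hw
  refine ⟨C * C', fun x hx => ?_⟩
  rw [pmul_apply, norm_mul, Real.rpow_add (bdf_pos hx), mul_mul_mul_comm]
  exact mul_le_mul (hC x hx) (hC' x hx) (norm_nonneg _) ((norm_nonneg _).trans (hC x hx))

/-- The iterated derivation along a word in the generating fields. -/
def word (gs : List (Gen n)) : Module.End ℂ (SmoothFn n) := (gs.map op).prod

@[simp] theorem word_nil : word ([] : List (Gen n)) = 1 := rfl

theorem word_cons (g : Gen n) (gs : List (Gen n)) : word (g :: gs) = op g * word gs := by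
  simp [word]

theorem word_append (gs hs : List (Gen n)) : word (gs ++ hs) = word gs * word hs := by
  simp [word]

/-- The conormal functions of weight `t` on the collar. -/
def conormal (n : ℕ) (t : ℝ) : Submodule ℂ (SmoothFn n) :=
  ⨅ gs : List (Gen n), (bounded n t).comap (word gs)

theorem mem_conormal {t : ℝ} {w : SmoothFn n} :
    w ∈ conormal n t ↔ ∀ gs : List (Gen n), word gs w ∈ bounded n t := by
  simp [conormal, Submodule.mem_iInf]

theorem conormal_le_bounded (t : ℝ) : conormal n t ≤ bounded n t :=
  fun _ hw => mem_conormal.1 hw []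

theorem conormal_anti {s t : ℝ} (h : s ≤ t) : conormal n t ≤ conormal n s :=
  fun _ hw => mem_conormal.2 fun gs => bounded_anti h (mem_conormal.1 hw gs)

theorem word_mem_conormal {t : ℝ} {w : SmoothFn n} (hw : w ∈ conormal n t) (gs : List (Gen n)) :
    word gs w ∈ conormal n t := by
  refine mem_conormal.2 fun hs => ?_
  rw [← Module.End.mul_apply, ← word_append]
  exact mem_conormal.1 hw _

theorem op_mem_conormal {t : ℝ} {w : SmoothFn n} (hw : w ∈ conormal n t) (g : Gen n) :
    op g w ∈ conormal n t := by
  simpa [word_cons] using word_mem_conormal hw [g]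

/-- `conormal n t` is the largest space of `O(ρ^t)` functions that is stable under the generating
derivations. -/
theorem le_conormal {t : ℝ} {G : Submodule ℂ (SmoothFn n)} (hb : G ≤ bounded n t)
    (hs : ∀ w ∈ G, ∀ g, op g w ∈ G) : G ≤ conormal n t := by
  intro w hw
  refine mem_conormal.2 fun gs => hb ?_
  induction gs with
  | nil => simpa using hw
  | cons g gs ih => rw [word_cons]; exact hs _ ih g

/-- The conormality test used throughout: a bound is needed only on a generating family, provided
that derivatives of its members are linear combinations of members. Iterated derivatives are then
never estimated directly. -/
theorem span_le_conormal {t : ℝ} {S : Set (SmoothFn n)} (hb : ∀ w ∈ S, w ∈ bounded n t)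
    (hs : ∀ w ∈ S, ∀ g, op g w ∈ Submodule.span ℂ S) : Submodule.span ℂ S ≤ conormal n t := by
  refine le_conormal (Submodule.span_le.2 hb) fun w hw g => ?_
  induction hw using Submodule.span_induction with
  | mem w hw => exact hs w hw g
  | zero => simp
  | add v w _ _ hv hw => rw [map_add]; exact add_mem hv hw
  | smul c w _ hw => rw [map_smul]; exact Submodule.smul_mem _ _ hw

theorem mem_conormal_of_stable {t : ℝ} {S : Set (SmoothFn n)} (hb : ∀ w ∈ S, w ∈ bounded n t)
    (hs : ∀ w ∈ S, ∀ g, op g w ∈ Submodule.span ℂ S) {w : SmoothFn n} (hw : w ∈ S) :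
    w ∈ conormal n t := span_le_conormal hb hs (Submodule.subset_span hw)

theorem pmul_mem_conormal {s t : ℝ} {v w : SmoothFn n} (hv : v ∈ conormal n s)
    (hw : w ∈ conormal n t) : pmul v w ∈ conormal n (s + t) := by
  refine mem_conormal_of_stable
    (S := {u | ∃ v ∈ conormal n s, ∃ w ∈ conormal n t, u = pmul v w}) ?_ ?_ ⟨v, hv, w, hw, rfl⟩
  · rintro _ ⟨v, hv, w, hw, rfl⟩
    exact pmul_mem_bounded (conormal_le_bounded _ hv) (conormal_le_bounded _ hw)
  · rintro _ ⟨v, hv, w, hw, rfl⟩ g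
    rw [op_pmul]
    exact add_mem (Submodule.subset_span ⟨_, op_mem_conormal hv g, _, hw, rfl⟩)
      (Submodule.subset_span ⟨_, hv, _, op_mem_conormal hw g, rfl⟩)

/-! ### Functions that are smooth up to the boundary -/

/-- The functions on the collar that are restrictions of smooth functions on `ℝⁿ ∖ 0`. -/
def ofSmooth (φ : Space n → ℂ) (hφ : ContDiffOn ℝ ∞ φ {0}ᶜ) : SmoothFn n :=
  ofFun φ (hφ.mono collarHalf_subset)

theorem ofSmooth_apply {φ : Space n → ℂ} (hφ : ContDiffOn ℝ ∞ φ {0}ᶜ) {x : Space n}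
    (hx : x ∈ collarHalf n) : ofSmooth φ hφ x = φ x := ofFun_apply _ hx

theorem isOpen_compl_zero : IsOpen ({0}ᶜ : Set (Space n)) := isOpen_compl_singleton

theorem contDiffOn_fderiv_apply {φ : Space n → ℂ} (hφ : ContDiffOn ℝ ∞ φ {0}ᶜ)
    {V : Space n → Space n} (hV : ContDiffOn ℝ ∞ V {0}ᶜ) :
    ContDiffOn ℝ ∞ (fun x => fderiv ℝ φ x (V x)) {0}ᶜ :=
  ((contDiffOn_infty_iff_fderiv_of_isOpen isOpen_compl_zero).1 hφ).2.clm_apply hV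

theorem op_ofSmooth (g : Gen n) {φ : Space n → ℂ} (hφ : ContDiffOn ℝ ∞ φ {0}ᶜ) :
    op g (ofSmooth φ hφ) = ofSmooth (fun x => fderiv ℝ φ x (genField g x))
      (contDiffOn_fderiv_apply hφ (contDiffOn_genField g)) := by
  ext x hx
  rw [op_apply g _ hx, ofSmooth_apply _ hx, ofSmooth, fderiv_ofFun _ hx]

/-- A compact annulus that contains the collar. -/
def annulus (n : ℕ) : Set (Space n) := {x | 1 / 2 ≤ ‖x‖ ∧ ‖x‖ ≤ 1}

theorem isCompact_annulus : IsCompact (annulus n) := by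
  refine (isCompact_closedBall (0 : Space n) 1).of_isClosed_subset
    ((isClosed_le continuous_const continuous_norm).inter
      (isClosed_le continuous_norm continuous_const)) fun x hx => ?_
  simpa using hx.2

theorem annulus_subset : annulus n ⊆ {0}ᶜ := by
  rintro x hx rfl
  have := hx.1
  norm_num at this

theorem collarHalf_subset_annulus : collarHalf n ⊆ annulus n := by
  intro x hx
  have h1 := bdf_pos hx
  have h2 := bdf_lt_half hx
  rw [bdf] at h1 h2
  constructor <;> nlinarith [norm_nonneg x]

theorem ofSmooth_mem_bounded {φ : Space n → ℂ} (hφ : ContDiffOn ℝ ∞ φ {0}ᶜ) :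
    ofSmooth φ hφ ∈ bounded n 0 := by
  obtain ⟨C, hC⟩ := isCompact_annulus.exists_bound_of_continuousOn
    (hφ.continuousOn.mono annulus_subset)
  exact ⟨C, fun x hx => by
    simpa [ofSmooth_apply hφ hx] using hC x (collarHalf_subset_annulus hx)⟩

theorem ofSmooth_mem_conormal {φ : Space n → ℂ} (hφ : ContDiffOn ℝ ∞ φ {0}ᶜ) :
    ofSmooth φ hφ ∈ conormal n 0 := by
  refine mem_conormal_of_stable (S := {w | ∃ φ hφ, w = ofSmooth φ hφ}) ?_ ?_ ⟨φ, hφ, rfl⟩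
  · rintro _ ⟨φ, hφ, rfl⟩
    exact ofSmooth_mem_bounded hφ
  · rintro _ ⟨φ, hφ, rfl⟩ g
    rw [op_ofSmooth]
    exact Submodule.subset_span ⟨_, _, rfl⟩

/-! ### Rotations in a coordinate plane -/

/-- The rotation by the angle `t` in the plane of the coordinates `i`, `j` (for `i ≠ j`). -/
def rot (i j : Fin n) (t : ℝ) (x : Space n) : Space n :=
  x + (Real.cos t - 1) • (x i • EuclideanSpace.single i (1 : ℝ) + x j • EuclideanSpace.single j 1)
    + Real.sin t • rotField i j x

theorem norm_rot {i j : Fin n} (hij : i ≠ j) (t : ℝ) (x : Space n) : ‖rot i j t x‖ = ‖x‖ := by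
  have h : ‖rot i j t x‖ ^ 2 = ‖x‖ ^ 2 := by
    rw [← real_inner_self_eq_norm_sq, ← real_inner_self_eq_norm_sq, rot, rotField_apply]
    simp only [inner_add_left, inner_add_right, inner_sub_left, inner_sub_right,
      real_inner_smul_left, real_inner_smul_right, EuclideanSpace.inner_single_left,
      EuclideanSpace.inner_single_right]
    simp [hij, hij.symm]
    linear_combination (x i ^ 2 + x j ^ 2) * Real.sin_sq_add_cos_sq t
  have := congrArg Real.sqrt h
  simpa [Real.sqrt_sq] using this

/-- The velocity of the rotation. -/
def rotVel (i j : Fin n) (t : ℝ) (x : Space n) : Space n :=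
  (-Real.sin t) • (x i • EuclideanSpace.single i (1 : ℝ) + x j • EuclideanSpace.single j 1)
    + Real.cos t • rotField i j x

theorem hasDerivAt_rot (i j : Fin n) (t : ℝ) (x : Space n) :
    HasDerivAt (fun t => rot i j t x) (rotVel i j t x) t :=
  ((((Real.hasDerivAt_cos t).sub_const 1).smul_const
    (x i • EuclideanSpace.single i (1 : ℝ) + x j • EuclideanSpace.single j 1)).const_add x).add
    ((Real.hasDerivAt_sin t).smul_const (rotField i j x))

theorem rotVel_zero (i j : Fin n) (x : Space n) : rotVel i j 0 x = rotField i j x := by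
  simp [rotVel]

theorem hasDerivAt_rot_zero (i j : Fin n) (x : Space n) :
    HasDerivAt (fun t => rot i j t x) (rotField i j x) 0 :=
  rotVel_zero i j x ▸ hasDerivAt_rot i j 0 x

theorem rot_zero (i j : Fin n) (x : Space n) : rot i j 0 x = x := by simp [rot]

theorem rotField_self (i : Fin n) (x : Space n) : rotField i i x = 0 := by simp [rotField_apply]

/-- The radial field vanishes on the unit sphere, and a rotation field is the velocity of a curve
that stays in the sphere, along which `φ` is zero. -/
theorem fderiv_genField_eq_zero_of_sphere {φ : Space n → ℂ} (hφ : ContDiffOn ℝ ∞ φ {0}ᶜ)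
    (h0 : ∀ x, ‖x‖ = 1 → φ x = 0) (g : Gen n) {x : Space n} (hx : ‖x‖ = 1) :
    fderiv ℝ φ x (genField g x) = 0 := by
  match g with
  | none => simp [genField, radialField, bdf, hx]
  | some (i, j) =>
    rcases eq_or_ne i j with rfl | hij
    · simp [genField, rotField_self]
    have hx0 : x ≠ 0 := by rintro rfl; simp at hx
    have hd : HasFDerivAt φ (fderiv ℝ φ x) (rot i j 0 x) := by
      rw [rot_zero]
      exact ((hφ.contDiffAt (isOpen_compl_zero.mem_nhds hx0)).differentiableAt
        (by simp)).hasFDerivAt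
    have h1 := hd.comp_hasDerivAt (0 : ℝ) (hasDerivAt_rot_zero i j x)
    have h2 : (φ ∘ fun t => rot i j t x) = fun _ => 0 := by
      funext t
      exact h0 _ (by rw [norm_rot hij, hx])
    rw [h2] at h1
    exact h1.unique (hasDerivAt_const _ _)

/-- Mean value inequality on the segment from `x` to `x/|x|`, whose length satisfies `1 - |x| ≤ 1 -
|x|² = ρ`. -/
theorem ofSmooth_mem_bounded_one {φ : Space n → ℂ} (hφ : ContDiffOn ℝ ∞ φ {0}ᶜ)
    (h0 : ∀ x, ‖x‖ = 1 → φ x = 0) : ofSmooth φ hφ ∈ bounded n 1 := by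
  obtain ⟨C, hC⟩ := isCompact_annulus.exists_bound_of_continuousOn
    ((((contDiffOn_infty_iff_fderiv_of_isOpen isOpen_compl_zero).1 hφ).2).continuousOn.mono
      annulus_subset)
  refine ⟨C, fun x hx => ?_⟩
  have hxa := collarHalf_subset_annulus hx
  have hn : 0 < ‖x‖ := by linarith [hxa.1]
  have hseg : ∀ y ∈ segment ℝ x (‖x‖⁻¹ • x), y ∈ annulus n := by
    rintro y ⟨a, b, ha, hb, hab, rfl⟩
    have : ‖a • x + b • ‖x‖⁻¹ • x‖ = a * ‖x‖ + b := by
      rw [smul_smul, ← add_smul, norm_smul, Real.norm_of_nonneg (by positivity)]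
      field_simp
    constructor
    · rw [this]; nlinarith [hxa.1, hxa.2]
    · rw [this]; nlinarith [hxa.1, hxa.2]
  have h1 := (convex_segment x (‖x‖⁻¹ • x)).norm_image_sub_le_of_norm_fderiv_le (𝕜 := ℝ)
    (f := φ) (C := C)
    (fun y hy => (hφ.contDiffAt (isOpen_compl_zero.mem_nhds
      (annulus_subset (hseg y hy)))).differentiableAt (by simp))
    (fun y hy => hC y (hseg y hy)) (right_mem_segment ℝ _ _) (left_mem_segment ℝ _ _)
  rw [h0 (‖x‖⁻¹ • x) (by rw [norm_smul, norm_inv, norm_norm, inv_mul_cancel₀ hn.ne']),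
    sub_zero] at h1
  have hC0 : 0 ≤ C := (norm_nonneg _).trans (hC x hxa)
  rw [ofSmooth_apply hφ hx, Real.rpow_one]
  refine h1.trans (mul_le_mul_of_nonneg_left ?_ hC0)
  have : x - ‖x‖⁻¹ • x = (1 - ‖x‖⁻¹) • x := by rw [sub_smul, one_smul]
  have h2 : ‖x - ‖x‖⁻¹ • x‖ = |(1 - ‖x‖⁻¹) * ‖x‖| := by
    rw [this, norm_smul, abs_mul, abs_of_pos hn, Real.norm_eq_abs]
  rw [h2, sub_mul, inv_mul_cancel₀ hn.ne', abs_of_nonpos (by linarith [hxa.2]), bdf]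
  nlinarith [hxa.2]

/-- Together with the factor `ρ⁻¹` of weight `-1`, this replaces the smooth division by `ρ` of a
function that vanishes on the boundary. -/
theorem ofSmooth_mem_conormal_one {φ : Space n → ℂ} (hφ : ContDiffOn ℝ ∞ φ {0}ᶜ)
    (h0 : ∀ x, ‖x‖ = 1 → φ x = 0) : ofSmooth φ hφ ∈ conormal n 1 := by
  refine mem_conormal_of_stable
    (S := {w | ∃ φ hφ, (∀ x, ‖x‖ = 1 → φ x = 0) ∧ w = ofSmooth φ hφ}) ?_ ?_ ⟨φ, hφ, h0, rfl⟩
  · rintro _ ⟨φ, hφ, h0, rfl⟩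
    exact ofSmooth_mem_bounded_one hφ h0
  · rintro _ ⟨φ, hφ, h0, rfl⟩ g
    rw [op_ofSmooth]
    exact Submodule.subset_span
      ⟨_, _, fun x hx => fderiv_genField_eq_zero_of_sphere hφ h0 g hx, rfl⟩

/-! ### The functions `ρ^z log(ρ)^k` -/

theorem ofReal_cpow_eq_exp {r : ℝ} (hr : 0 < r) (z : ℂ) :
    (r : ℂ) ^ z = Complex.exp (z * (Real.log r : ℝ)) := by
  rw [Complex.cpow_def_of_ne_zero (by exact_mod_cast hr.ne'), Complex.ofReal_log hr.le, mul_comm]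

theorem norm_ofReal_cpow {r : ℝ} (hr : 0 < r) (z : ℂ) : ‖(r : ℂ) ^ z‖ = r ^ z.re :=
  Complex.norm_cpow_eq_rpow_re_of_pos hr z

theorem hasDerivAt_ofReal_cpow {r : ℝ} (hr : 0 < r) (z : ℂ) :
    HasDerivAt (fun s : ℝ => (s : ℂ) ^ z) (z * (r : ℂ) ^ z / r) r := by
  have h1 : HasDerivAt (fun s : ℝ => Complex.exp (z * (Real.log s : ℝ)))
      (Complex.exp (z * (Real.log r : ℝ)) * (z * ((r⁻¹ : ℝ) : ℂ))) r :=
    (((Real.hasDerivAt_log hr.ne').ofReal_comp).const_mul z).cexp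
  have h2 := h1.congr_of_eventuallyEq (f₁ := fun s : ℝ => (s : ℂ) ^ z)
    (Filter.eventuallyEq_of_mem (Ioi_mem_nhds hr) fun s hs => ofReal_cpow_eq_exp hs z)
  refine h2.congr_deriv ?_
  rw [ofReal_cpow_eq_exp hr]
  push_cast
  ring

theorem contDiffOn_ofReal_cpow (z : ℂ) :
    ContDiffOn ℝ ∞ (fun s : ℝ => (s : ℂ) ^ z) (Set.Ioi 0) := by
  have h : ContDiffOn ℝ ∞ (fun s : ℝ => Complex.exp (z * (Real.log s : ℝ))) (Set.Ioi 0) :=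
    (contDiffOn_const.mul (Complex.ofRealCLM.contDiff.comp_contDiffOn
      (contDiffOn_id.log fun _ hs => (Set.mem_Ioi.1 hs).ne'))).cexp
  exact h.congr fun s hs => ofReal_cpow_eq_exp hs z

theorem contDiffOn_ofReal_log :
    ContDiffOn ℝ ∞ (fun s : ℝ => ((Real.log s : ℝ) : ℂ)) (Set.Ioi 0) :=
  Complex.ofRealCLM.contDiff.comp_contDiffOn
      (contDiffOn_id.log fun _ hs => (Set.mem_Ioi.1 hs).ne')

/-- The function `ρ^z log(ρ)^k` on the collar. -/
def powLog (n : ℕ) (z : ℂ) (k : ℕ) : SmoothFn n :=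
  ofFun (fun x => ((bdf x : ℝ) : ℂ) ^ z * ((Real.log (bdf x) : ℝ) : ℂ) ^ k)
    (((contDiffOn_ofReal_cpow z).mul (contDiffOn_ofReal_log.pow k)).comp
      contDiff_bdf.contDiffOn fun _ hx => bdf_pos hx)

theorem powLog_apply (z : ℂ) (k : ℕ) {x : Space n} (hx : x ∈ collarHalf n) :
    powLog n z k x = ((bdf x : ℝ) : ℂ) ^ z * ((Real.log (bdf x) : ℝ) : ℂ) ^ k := ofFun_apply _ hx

/-- For `k = 0` the truncated index `k - 1` is harmless, since its term carries the factor `k`. The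
same convention recurs for all logarithmic terms below. -/
theorem op_powLog (g : Gen n) (z : ℂ) (k : ℕ) {x : Space n} (hx : x ∈ collarHalf n) :
    op g (powLog n z k) x = (fderiv ℝ bdf x (genField g x) : ℝ) * (bdf x : ℂ)⁻¹ *
      (z * powLog n z k x + k * powLog n z (k - 1) x) := by
  have hp := bdf_pos hx
  rw [op_apply g _ hx, powLog_apply z _ hx, powLog_apply z _ hx, powLog, fderiv_ofFun _ hx]
  have h1 := (hasDerivAt_ofReal_cpow hp z).mul (((Real.hasDerivAt_log hp.ne').ofReal_comp).pow k)
  have h2 := h1.hasFDerivAt.comp x (hasFDerivAt_bdf x)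
  have h3 : fderiv ℝ (fun x : Space n => ((bdf x : ℝ) : ℂ) ^ z *
      ((Real.log (bdf x) : ℝ) : ℂ) ^ k) x = _ := h2.fderiv
  rw [h3, (hasFDerivAt_bdf x).fderiv]
  simp
  ring

theorem opD_powLog (z : ℂ) (k : ℕ) :
    opD n (powLog n z k) = z • powLog n z k + (k : ℂ) • powLog n z (k - 1) := by
  ext x hx
  have hp : (bdf x : ℂ) ≠ 0 := by exact_mod_cast (bdf_pos hx).ne'
  rw [op_powLog none z k hx, fderiv_bdf_genField_none (ne_zero_of_mem_collarHalf hx),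
    mul_inv_cancel₀ hp, one_mul]
  rfl

theorem opL_powLog (p : Fin n × Fin n) (z : ℂ) (k : ℕ) : op (some p) (powLog n z k) = 0 := by
  ext x hx
  rw [op_powLog _ z k hx, fderiv_bdf_genField_some]
  simp

theorem exists_rpow_mul_abs_log_pow_le {s t : ℝ} (h : t < s) (k : ℕ) :
    ∃ C : ℝ, 0 ≤ C ∧ ∀ r : ℝ, 0 < r → r ≤ 1 → r ^ s * |Real.log r| ^ k ≤ C * r ^ t := by
  -- The gap `s - t` is cut into `k + 1` equal parts, `k` of which absorb one logarithm each; the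
  -- spare part keeps the denominator nonzero for `k = 0`.
  obtain ⟨τ, hτ⟩ : ∃ τ, τ = (s - t) / (k + 1) := ⟨_, rfl⟩
  have hτp : 0 < τ := by rw [hτ]; exact div_pos (by linarith) (by positivity)
  refine ⟨(1 / τ) ^ k, by positivity, fun r hp hr => ?_⟩
  have h1 : |Real.log r| * r ^ τ ≤ 1 / τ := by
    have := (Real.abs_log_mul_self_rpow_lt r τ hp hr hτp).le
    rwa [abs_mul, abs_of_pos (Real.rpow_pos_of_pos hp τ)] at this
  have h2 : r ^ s ≤ r ^ t * (r ^ τ) ^ k := by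
    rw [← Real.rpow_natCast, ← Real.rpow_mul hp.le, ← Real.rpow_add hp]
    refine Real.rpow_le_rpow_of_exponent_ge hp hr ?_
    have : τ * (k + 1) = s - t := by rw [hτ]; field_simp
    linarith
  calc r ^ s * |Real.log r| ^ k ≤ r ^ t * (r ^ τ) ^ k * |Real.log r| ^ k := by gcongr
    _ = (|Real.log r| * r ^ τ) ^ k * r ^ t := by ring
    _ ≤ (1 / τ) ^ k * r ^ t := by gcongr

theorem norm_cpow_mul_log_pow {r : ℝ} (hr : 0 < r) (z : ℂ) (k : ℕ) :
    ‖(r : ℂ) ^ z * ((Real.log r : ℝ) : ℂ) ^ k‖ = r ^ z.re * |Real.log r| ^ k := by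
  rw [norm_mul, norm_pow, norm_ofReal_cpow hr, Complex.norm_real, Real.norm_eq_abs]

theorem powLog_mem_bounded {z : ℂ} {t : ℝ} (ht : t < z.re) (k : ℕ) :
    powLog n z k ∈ bounded n t := by
  obtain ⟨C, -, hC⟩ := exists_rpow_mul_abs_log_pow_le ht k
  refine ⟨C, fun x hx => ?_⟩
  rw [powLog_apply z k hx, norm_cpow_mul_log_pow (bdf_pos hx)]
  exact hC _ (bdf_pos hx) (by linarith [bdf_lt_half hx])

theorem powLog_zero_mem_bounded (z : ℂ) : powLog n z 0 ∈ bounded n z.re :=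
  ⟨1, fun x hx => by
    rw [powLog_apply z 0 hx, pow_zero, mul_one, norm_ofReal_cpow (bdf_pos hx), one_mul]⟩

theorem op_powLog_mem_span (z : ℂ) (g : Gen n) (k : ℕ) :
    op g (powLog n z k) ∈ Submodule.span ℂ (Set.range fun k => powLog n z k) := by
  match g with
  | none =>
    change opD n _ ∈ _
    rw [opD_powLog]
    exact add_mem (Submodule.smul_mem _ _ (Submodule.subset_span ⟨_, rfl⟩))
      (Submodule.smul_mem _ _ (Submodule.subset_span ⟨_, rfl⟩))
  | some p => rw [opL_powLog]; exact zero_mem _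

theorem powLog_mem_conormal {z : ℂ} {t : ℝ} (ht : t < z.re) (k : ℕ) :
    powLog n z k ∈ conormal n t := by
  refine mem_conormal_of_stable (S := Set.range fun k => powLog n z k) ?_ ?_ ⟨k, rfl⟩
  · rintro _ ⟨k, rfl⟩
    exact powLog_mem_bounded ht k
  · rintro _ ⟨k, rfl⟩ g
    exact op_powLog_mem_span z g k

/-- Without a logarithm there is no loss of weight. The sharp weight matters when multiplying by `ρ`
or `ρ⁻¹`. -/
theorem powLog_zero_mem_conormal (z : ℂ) : powLog n z 0 ∈ conormal n z.re := by
  refine mem_conormal_of_stable (S := {powLog n z 0}) ?_ ?_ rfl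
  · rintro _ rfl
    exact powLog_zero_mem_bounded z
  · rintro _ rfl g
    match g with
    | none =>
      change opD n _ ∈ _
      rw [opD_powLog]
      simpa using Submodule.smul_mem _ _ (Submodule.mem_span_singleton_self _)
    | some p => rw [opL_powLog]; exact zero_mem _

/-! ### Conormality with respect to all `b`-fields -/

/-- Contracting `x_i v_j` with `x_i e_j - x_j e_i` gives `|x|² v - ⟨x, v⟩ x`: the tangential part of
a vector is a combination of rotation fields. -/
theorem normSq_smul_eq_sum (x v : Space n) :
    (‖x‖ ^ 2) • v = (inner ℝ x v : ℝ) • x + ∑ i, ∑ j, (x i * v j) • rotField i j x := by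
  ext k
  have h1 : ‖x‖ ^ 2 = ∑ i, x i ^ 2 := by
    rw [EuclideanSpace.norm_sq_eq]; simp
  have h2 : (inner ℝ x v : ℝ) = ∑ j, x j * v j := by
    simp [PiLp.inner_apply, mul_comm]
  simp only [rotField_apply, h1, h2, PiLp.add_apply, PiLp.smul_apply, smul_eq_mul,
    WithLp.ofLp_sum, Finset.sum_apply, PiLp.sub_apply, PiLp.single_apply, mul_sub,
    Finset.sum_sub_distrib]
  simp only [mul_ite, mul_one, mul_zero, Finset.sum_ite_eq, Finset.mem_univ, if_true,
    Finset.sum_mul]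
  have : ∀ i : Fin n, ∑ j, (if k = i then x i * v j * x j else 0) =
      if k = i then ∑ j, x i * v j * x j else 0 := fun i => by split_ifs <;> simp
  simp only [this, Finset.sum_ite_eq, Finset.mem_univ, if_true]
  have e1 : ∑ j, x k * v j * x j = ∑ j, x j * v j * x k := Finset.sum_congr rfl fun _ _ => by ring
  have e2 : ∑ i, x i * v k * x i = ∑ i, x i ^ 2 * v k := Finset.sum_congr rfl fun _ _ => by ring
  rw [e1, e2]; ring

/-- The tangential part of `V` has smooth coefficients in the rotation fields. The radial part has
the coefficient `ρ⁻¹ ⟨x, V⟩` in the radial field, up to a constant; it is conormal of weight `0`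
because tangency makes `⟨x, V⟩` vanish on the sphere. -/
theorem exists_vder_eq {V : Space n → Space n} (hV : IsBField V) {t : ℝ} {w : SmoothFn n}
    (hw : w ∈ conormal n t) :
    ∃ w' ∈ conormal n t, ∀ x ∈ collarHalf n, fderiv ℝ w x (V x) = w' x := by
  have hc : ∀ i : Fin n, ContDiff ℝ ∞ (fun x : Space n => x i) := fun i =>
    (EuclideanSpace.proj (𝕜 := ℝ) i : Space n →L[ℝ] ℝ).contDiff
  have hVc : ∀ i : Fin n, ContDiff ℝ ∞ (fun x : Space n => V x i) := fun i =>
    (hc i).comp hV.smooth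
  have h0 : ContDiffOn ℝ ∞ (fun x : Space n => ((inner ℝ x (V x) : ℝ) : ℂ)) {0}ᶜ :=
    (Complex.ofRealCLM.contDiff.comp (contDiff_id.inner ℝ hV.smooth)).contDiffOn
  have h1 : ∀ i j : Fin n, ContDiffOn ℝ ∞
      (fun x : Space n => ((x i * V x j / ‖x‖ ^ 2 : ℝ) : ℂ)) {0}ᶜ := fun i j =>
    Complex.ofRealCLM.contDiff.comp_contDiffOn (((hc i).mul (hVc j)).contDiffOn.div
      (contDiff_norm_sq ℝ).contDiffOn fun x hx => by
        have : ‖x‖ ≠ 0 := norm_ne_zero_iff.2 hx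
        positivity)
  refine ⟨(-2 : ℂ) • pmul (pmul (powLog n (-1) 0) (ofSmooth _ h0)) (opD n w) +
    ∑ i, ∑ j, pmul (ofSmooth _ (h1 i j)) (opL i j w), ?_, fun x hx => ?_⟩
  · refine add_mem (Submodule.smul_mem _ _ ?_) (sum_mem fun i _ => sum_mem fun j _ => ?_)
    · have := pmul_mem_conormal (pmul_mem_conormal (powLog_zero_mem_conormal (n := n) (-1))
        (ofSmooth_mem_conormal_one h0 fun x hx => by simp [hV.tangent x hx]))
        (op_mem_conormal hw none)
      simpa using this
    · simpa using pmul_mem_conormal (ofSmooth_mem_conormal (h1 i j)) (op_mem_conormal hw _)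
  · have hx0 := ne_zero_of_mem_collarHalf hx
    have hn : ‖x‖ ≠ 0 := norm_ne_zero_iff.2 hx0
    have hp := (bdf_pos hx).ne'
    -- The factor `-2` inverts the relation `radialField x = -(ρ / (2|x|²)) x`.
    have key : V x = (-2 * ((bdf x)⁻¹ * inner ℝ x (V x))) • radialField x +
        ∑ i, ∑ j, (x i * V x j / ‖x‖ ^ 2) • rotField i j x := by
      have h := normSq_smul_eq_sum x (V x)
      have hr : ‖x‖ ^ 2 ≠ 0 := by positivity
      refine smul_right_injective _ hr ?_
      change ‖x‖ ^ 2 • V x = ‖x‖ ^ 2 • (_ + _)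
      rw [h, smul_add, radialField, smul_smul, smul_smul]
      congr 1
      · congr 1
        field_simp
      · simp only [Finset.smul_sum, smul_smul]
        refine Finset.sum_congr rfl fun i _ => Finset.sum_congr rfl fun j _ => ?_
        congr 1
        field_simp
    have hsum : (∑ i, ∑ j, pmul (ofSmooth _ (h1 i j)) (opL i j w)) x =
        ∑ i, ∑ j, ((x i * V x j / ‖x‖ ^ 2 : ℝ) : ℂ) * fderiv ℝ w x (rotField i j x) := by
      rw [SmoothFn.sum_apply]
      refine Finset.sum_congr rfl fun i _ => ?_
      rw [SmoothFn.sum_apply]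
      refine Finset.sum_congr rfl fun j _ => ?_
      rw [pmul_apply, ofSmooth_apply _ hx, op_apply _ _ hx]
      rfl
    rw [SmoothFn.add_apply, hsum, SmoothFn.smul_apply, pmul_apply, pmul_apply, powLog_apply _ _ hx,
      ofSmooth_apply _ hx, op_apply _ _ hx, Complex.cpow_neg_one, pow_zero, mul_one]
    conv_lhs => rw [key]
    simp only [map_add, map_smul, map_sum, Complex.real_smul, genField]
    push_cast
    ring

theorem isConormalOn_of_mem_conormal {t : ℝ} {w : SmoothFn n} (hw : w ∈ conormal n t)
    {u : Space n → ℂ} (hu : ∀ x ∈ collarHalf n, u x = w x) :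
    IsConormalOn (collar n (1 / 2)) t u := by
  refine ⟨w.contDiffOn.congr hu, fun Vs hVs => ?_⟩
  suffices h : ∃ w' ∈ conormal n t, ∀ x ∈ collarHalf n, iterDerivation Vs u x = w' x by
    obtain ⟨w', hw', he⟩ := h
    obtain ⟨C, hC⟩ := conormal_le_bounded t hw'
    exact ⟨C, fun x hx => by rw [he x hx]; exact hC x hx⟩
  induction Vs with
  | nil => exact ⟨w, hw, hu⟩
  | cons V Vs ih =>
    obtain ⟨w₁, hw₁, he₁⟩ := ih fun V hV => hVs V (by simp [hV])
    obtain ⟨w₂, hw₂, he₂⟩ := exists_vder_eq (hVs V (by simp)) hw₁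
    refine ⟨w₂, hw₂, fun x hx => ?_⟩
    rw [← he₂ x hx]
    have : fderiv ℝ (iterDerivation Vs u) x = fderiv ℝ w₁ x :=
      Filter.EventuallyEq.fderiv_eq <|
        Filter.eventuallyEq_of_mem ((isOpen_collar _).mem_nhds hx) he₁
    simp [iterDerivation, this]

/-! ### The equation `(ρ ∂_ρ - z) w = g` along the rays -/

/-- The point of the ray through `x` at which `ρ` equals `r`. -/
def rayPoint (r : ℝ) (x : Space n) : Space n := (√(1 - r) / ‖x‖) • x

theorem norm_rayPoint {r : ℝ} {x : Space n} (hx : x ≠ 0) : ‖rayPoint r x‖ = √(1 - r) := by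
  have : ‖x‖ ≠ 0 := norm_ne_zero_iff.2 hx
  rw [rayPoint, norm_smul, norm_div, norm_norm, Real.norm_of_nonneg (Real.sqrt_nonneg _)]
  field_simp

theorem bdf_rayPoint {r : ℝ} (hr : r ≤ 1) {x : Space n} (hx : x ≠ 0) :
    bdf (rayPoint r x) = r := by
  rw [bdf, norm_rayPoint hx, Real.sq_sqrt (by linarith)]; ring

theorem rayPoint_mem {r : ℝ} (h0 : 0 < r) (h1 : r < 1 / 2) {x : Space n} (hx : x ≠ 0) :
    rayPoint r x ∈ collarHalf n := by
  have := bdf_rayPoint (by linarith : r ≤ 1) hx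
  exact ⟨by rw [this]; exact h0, by rw [this]; exact h1⟩

theorem rayPoint_bdf {x : Space n} (hx : x ≠ 0) : rayPoint (bdf x) x = x := by
  have : ‖x‖ ≠ 0 := norm_ne_zero_iff.2 hx
  rw [rayPoint, bdf, sub_sub_cancel, Real.sqrt_sq (norm_nonneg _), div_self this, one_smul]

theorem rayPoint_smul {r c : ℝ} (hc : 0 < c) (x : Space n) : rayPoint r (c • x) = rayPoint r x := by
  rcases eq_or_ne x 0 with rfl | hx
  · simp [rayPoint]
  have : ‖x‖ ≠ 0 := norm_ne_zero_iff.2 hx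
  rw [rayPoint, rayPoint, smul_smul, norm_smul, Real.norm_of_nonneg hc.le]
  congr 1
  field_simp

theorem hasDerivAt_rayPoint {r : ℝ} (h0 : 0 < r) (h1 : r < 1 / 2) {x : Space n} (hx : x ≠ 0) :
    HasDerivAt (fun r => rayPoint r x) (r⁻¹ • radialField (rayPoint r x)) r := by
  have hn : ‖x‖ ≠ 0 := norm_ne_zero_iff.2 hx
  have h2 : (0 : ℝ) < 1 - r := by linarith
  have hd : HasDerivAt (fun r : ℝ => √(1 - r)) (-1 / (2 * √(1 - r))) r :=
    ((hasDerivAt_id r).const_sub 1).sqrt h2.ne'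
  have := (hd.div_const ‖x‖).smul_const x
  refine this.congr_deriv ?_
  have hs : √(1 - r) ≠ 0 := (Real.sqrt_pos.2 h2).ne'
  rw [radialField, bdf_rayPoint (by linarith) hx, norm_rayPoint hx, rayPoint, smul_smul, smul_smul]
  congr 1
  field_simp

/-- The function `r ↦ r^{-z} w` along the ray through `x`. -/
def rayFn (z : ℂ) (w : SmoothFn n) (r : ℝ) (x : Space n) : ℂ := (r : ℂ) ^ (-z) * w (rayPoint r x)

/-- The operator `ρ ∂_ρ - z`. -/
abbrev opDsub (n : ℕ) (z : ℂ) : Module.End ℂ (SmoothFn n) :=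
  opD n - algebraMap ℂ (Module.End ℂ (SmoothFn n)) z

theorem opDsub_apply (z : ℂ) (w : SmoothFn n) : opDsub n z w = opD n w - z • w := rfl

/-- The factor `r^{-z}` is the integrating factor for the operator `r d/dr - z` along the ray. -/
theorem hasDerivAt_rayFn (z : ℂ) (w : SmoothFn n) {r : ℝ} (h0 : 0 < r) (h1 : r < 1 / 2)
    {x : Space n} (hx : x ≠ 0) :
    HasDerivAt (fun r => rayFn z w r x)
      ((r : ℂ) ^ (-z) * (r : ℂ)⁻¹ * opDsub n z w (rayPoint r x)) r := by
  have hm := rayPoint_mem h0 h1 hx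
  have hd := (w.differentiableAt hm).hasFDerivAt.comp_hasDerivAt r (hasDerivAt_rayPoint h0 h1 hx)
  refine ((hasDerivAt_ofReal_cpow h0 (-z)).mul hd).congr_deriv ?_
  have hr : (r : ℂ) ≠ 0 := by exact_mod_cast h0.ne'
  rw [opDsub_apply, SmoothFn.sub_apply, SmoothFn.smul_apply, op_apply none w hm, map_smul,
    Complex.real_smul]
  push_cast
  simp only [Function.comp, genField]
  field_simp
  ring

/-- Comparison with the primitive `C r^τ / τ`. The excluded value `τ = 0` would give a logarithm. -/
theorem norm_sub_le_of_deriv_rpow {Y : ℝ → ℂ} {Y' : ℝ → ℂ} {C τ : ℝ} (hτ : τ ≠ 0)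
    (hd : ∀ r, 0 < r → r < 1 / 2 → HasDerivAt Y (Y' r) r)
    (hb : ∀ r, 0 < r → r < 1 / 2 → ‖Y' r‖ ≤ C * r ^ (τ - 1))
    {a b : ℝ} (ha : 0 < a) (hb' : 0 < b) (ha2 : a < 1 / 2) (hb2 : b < 1 / 2) :
    ‖Y b - Y a‖ ≤ C / |τ| * |b ^ τ - a ^ τ| := by
  wlog hab : a ≤ b generalizing a b
  · rw [norm_sub_rev, abs_sub_comm]
    exact this hb' ha hb2 ha2 (le_of_not_ge hab)
  have hB : ∀ r, 0 < r → HasDerivAt (fun r : ℝ => C / τ * (r ^ τ - a ^ τ)) (C * r ^ (τ - 1)) r := by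
    intro r hr
    refine (((Real.hasDerivAt_rpow_const (Or.inl hr.ne')).sub_const _).const_mul _).congr_deriv ?_
    field_simp
  have h := image_norm_le_of_norm_deriv_right_le_deriv_boundary'
    (f := fun r => Y r - Y a) (f' := Y') (B := fun r => C / τ * (r ^ τ - a ^ τ))
    (B' := fun r => C * r ^ (τ - 1)) (a := a) (b := b)
    (fun r hr => ((hd r (ha.trans_le hr.1) (hr.2.trans_lt hb2)).continuousAt.sub
      continuousAt_const).continuousWithinAt)
    (fun r hr => ((hd r (ha.trans_le hr.1) (hr.2.trans hb2)).sub_const _).hasDerivWithinAt)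
    (by simp)
    (fun r hr => (hB r (ha.trans_le hr.1)).continuousAt.continuousWithinAt)
    (fun r hr => (hB r (ha.trans_le hr.1)).hasDerivWithinAt)
    (fun r hr => hb r (ha.trans_le hr.1) (hr.2.trans hb2)) (Set.right_mem_Icc.2 hab)
  refine h.trans (le_of_eq ?_)
  rcases lt_or_gt_of_ne hτ with h0 | h0
  · rw [abs_of_neg h0, abs_of_nonpos
      (sub_nonpos.2 (Real.rpow_le_rpow_of_nonpos ha hab h0.le))]
    field_simp
  · rw [abs_of_pos h0, abs_of_nonneg
      (sub_nonneg.2 (Real.rpow_le_rpow ha.le hab h0.le))]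

theorem exists_norm_rayFn_sub_le {z : ℂ} {t : ℝ} (ht : t ≠ z.re) {w : SmoothFn n}
    (hw : opDsub n z w ∈ bounded n t) :
    ∃ K, 0 ≤ K ∧ ∀ x : Space n, x ≠ 0 → ∀ a b : ℝ, 0 < a → 0 < b → a < 1 / 2 → b < 1 / 2 →
      ‖rayFn z w b x - rayFn z w a x‖ ≤ K * |b ^ (t - z.re) - a ^ (t - z.re)| := by
  obtain ⟨C, hC⟩ := hw
  have hτ : t - z.re ≠ 0 := sub_ne_zero.2 ht
  refine ⟨|C| / |t - z.re|, by positivity, fun x hx a b ha hb ha2 hb2 => ?_⟩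
  refine norm_sub_le_of_deriv_rpow hτ (fun r h0 h1 => hasDerivAt_rayFn z w h0 h1 hx) ?_ ha hb ha2
    hb2
  intro r h0 h1
  have h2 := hC _ (rayPoint_mem h0 h1 hx)
  rw [bdf_rayPoint (by linarith) hx] at h2
  rw [norm_mul, norm_mul, norm_ofReal_cpow h0, norm_inv, Complex.norm_real,
    Real.norm_of_nonneg h0.le, Complex.neg_re]
  have h3 : r ^ (t - z.re - 1) = r ^ (-z.re) * r⁻¹ * r ^ t := by
    rw [← Real.rpow_neg_one, ← Real.rpow_add h0, ← Real.rpow_add h0]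
    congr 1; ring
  rw [h3]
  calc r ^ (-z.re) * r⁻¹ * ‖opDsub n z w (rayPoint r x)‖
      ≤ r ^ (-z.re) * r⁻¹ * (|C| * r ^ t) := by
        gcongr
        exact h2.trans (by gcongr; exact le_abs_self C)
    _ = _ := by ring

theorem apply_eq_rayFn (z : ℂ) (w : SmoothFn n) {x : Space n} (hx : x ∈ collarHalf n) :
    w x = (bdf x : ℂ) ^ z * rayFn z w (bdf x) x := by
  have hp : (bdf x : ℂ) ≠ 0 := by exact_mod_cast (bdf_pos hx).ne'
  rw [rayFn, rayPoint_bdf (ne_zero_of_mem_collarHalf hx), ← mul_assoc, ← Complex.cpow_add _ _ hp,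
    add_neg_cancel, Complex.cpow_zero, one_mul]

theorem norm_rayFn (z : ℂ) (w : SmoothFn n) {r : ℝ} (hr : 0 < r) (x : Space n) :
    ‖rayFn z w r x‖ = r ^ (-z.re) * ‖w (rayPoint r x)‖ := by
  rw [rayFn, norm_mul, norm_ofReal_cpow hr, Complex.neg_re]

/-- Integrate from the interior radius `1/4` towards the boundary. The exponent `τ = t - Re z` is
negative, so both the initial value and the integral are `O(r^τ)`. The weight `s` serves only to
bound the initial value uniformly in the direction. -/
theorem mem_bounded_of_opDsub {z : ℂ} {s t : ℝ} (ht : t < z.re) {w : SmoothFn n}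
    (hs : w ∈ bounded n s) (hw : opDsub n z w ∈ bounded n t) : w ∈ bounded n t := by
  obtain ⟨K, hK0, hK⟩ := exists_norm_rayFn_sub_le ht.ne hw
  obtain ⟨C, hC⟩ := hs
  set τ := t - z.re with hτ
  have hτn : τ < 0 := by rw [hτ]; linarith
  set A : ℝ := (1 / 4 : ℝ) ^ (-z.re) * (|C| * (1 / 4 : ℝ) ^ s)
  refine ⟨A + K * (1 + (1 / 4 : ℝ) ^ τ), fun x hx => ?_⟩
  have hx0 := ne_zero_of_mem_collarHalf hx
  have hp := bdf_pos hx
  have h1 := hK x hx0 (1 / 4) (bdf x) (by norm_num) hp (by norm_num) (bdf_lt_half hx)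
  have h2 : ‖rayFn z w (1 / 4) x‖ ≤ A := by
    rw [norm_rayFn z w (by norm_num)]
    have h3 := hC _ (rayPoint_mem (r := 1 / 4) (by norm_num) (by norm_num) hx0)
    rw [bdf_rayPoint (by norm_num) hx0] at h3
    refine mul_le_mul_of_nonneg_left (h3.trans ?_) (by positivity)
    gcongr
    exact le_abs_self C
  have h4 : 1 ≤ bdf x ^ τ :=
    Real.one_le_rpow_of_pos_of_le_one_of_nonpos hp (by linarith [bdf_lt_half hx]) hτn.le
  have h5 : (0 : ℝ) < (1 / 4 : ℝ) ^ τ := by positivity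
  have h6 : |bdf x ^ τ - (1 / 4 : ℝ) ^ τ| ≤ bdf x ^ τ + (1 / 4 : ℝ) ^ τ := by
    rw [abs_le]; constructor <;> linarith
  have h7 : ‖rayFn z w (bdf x) x‖ ≤ (A + K * (1 + (1 / 4 : ℝ) ^ τ)) * bdf x ^ τ := by
    have hA : 0 ≤ A := (norm_nonneg _).trans h2
    calc ‖rayFn z w (bdf x) x‖
        ≤ ‖rayFn z w (1 / 4) x‖ + ‖rayFn z w (bdf x) x - rayFn z w (1 / 4) x‖ :=
          norm_le_norm_add_norm_sub' _ _
      _ ≤ A + K * (bdf x ^ τ + (1 / 4 : ℝ) ^ τ) :=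
          add_le_add h2 (h1.trans (mul_le_mul_of_nonneg_left h6 hK0))
      _ ≤ A * bdf x ^ τ + K * (bdf x ^ τ + (1 / 4 : ℝ) ^ τ * bdf x ^ τ) := by
          gcongr
          · exact le_mul_of_one_le_right hA h4
          · exact le_mul_of_one_le_right h5.le h4
      _ = _ := by ring
  rw [apply_eq_rayFn z w hx, norm_mul, norm_ofReal_cpow hp]
  calc bdf x ^ z.re * ‖rayFn z w (bdf x) x‖
      ≤ bdf x ^ z.re * ((A + K * (1 + (1 / 4 : ℝ) ^ τ)) * bdf x ^ τ) := by gcongr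
    _ = (A + K * (1 + (1 / 4 : ℝ) ^ τ)) * (bdf x ^ z.re * bdf x ^ τ) := by ring
    _ = _ := by rw [← Real.rpow_add hp, hτ, add_sub_cancel]

theorem commute_opD_op (g : Gen n) : Commute (opD n) (op g) := by
  match g with
  | none => exact Commute.refl _
  | some (i, j) => exact commute_opD_opL i j

theorem commute_opD_word (gs : List (Gen n)) : Commute (opD n) (word gs) := by
  induction gs with
  | nil => exact Commute.one_right _
  | cons g gs ih => rw [word_cons]; exact (commute_opD_op g).mul_right ih

theorem opDsub_op (z : ℂ) (g : Gen n) (w : SmoothFn n) :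
    opDsub n z (op g w) = op g (opDsub n z w) := by
  rw [opDsub_apply, opDsub_apply, map_sub, map_smul, ← Module.End.mul_apply,
    (commute_opD_op g).eq, Module.End.mul_apply]

theorem opDsub_word (z : ℂ) (gs : List (Gen n)) (w : SmoothFn n) :
    opDsub n z (word gs w) = word gs (opDsub n z w) := by
  rw [opDsub_apply, opDsub_apply, map_sub, map_smul, ← Module.End.mul_apply,
    (commute_opD_word gs).eq, Module.End.mul_apply]

theorem opDsub_mem_conormal {z : ℂ} {t : ℝ} {w : SmoothFn n} (hw : w ∈ conormal n t) :
    opDsub n z w ∈ conormal n t :=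
  sub_mem (op_mem_conormal hw none) (Submodule.smul_mem _ _ hw)

theorem mem_conormal_of_opDsub {z : ℂ} {s t : ℝ} (ht : t < z.re) {w : SmoothFn n}
    (hs : w ∈ conormal n s) (hw : opDsub n z w ∈ conormal n t) : w ∈ conormal n t := by
  refine mem_conormal.2 fun gs => mem_bounded_of_opDsub ht (mem_conormal.1 hs gs) ?_
  rw [opDsub_word]
  exact mem_conormal.1 hw gs

/-! ### Boundary values -/

/-- A sequence of radii that tends to zero. -/
def radius (k : ℕ) : ℝ := (1 / 4) * (1 / 2) ^ k

theorem radius_pos (k : ℕ) : 0 < radius k := by unfold radius; positivity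

theorem radius_lt (k : ℕ) : radius k < 1 / 2 := by
  have : ((1 : ℝ) / 2) ^ k ≤ 1 := pow_le_one₀ (by norm_num) (by norm_num)
  unfold radius; linarith

theorem tendsto_radius : Filter.Tendsto radius Filter.atTop (nhds 0) := by
  have := (tendsto_pow_atTop_nhds_zero_of_lt_one (r := (1 / 2 : ℝ)) (by norm_num)
    (by norm_num)).const_mul (1 / 4)
  rw [mul_zero] at this
  exact this

theorem tendsto_radius_rpow {τ : ℝ} (hτ : 0 < τ) :
    Filter.Tendsto (fun k => radius k ^ τ) Filter.atTop (nhds 0) := by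
  have := tendsto_radius.rpow_const (p := τ) (Or.inr hτ.le)
  rwa [Real.zero_rpow hτ.ne'] at this

/-- The boundary value `lim_{r → 0} r^{-z} w` along the ray through `x`. -/
def boundaryValue (z : ℂ) (w : SmoothFn n) (x : Space n) : ℂ :=
  Filter.limUnder Filter.atTop fun k => rayFn z w (radius k) x

theorem boundaryValue_smul (z : ℂ) (w : SmoothFn n) {c : ℝ} (hc : 0 < c) (x : Space n) :
    boundaryValue z w (c • x) = boundaryValue z w x := by
  simp only [boundaryValue, rayFn, rayPoint_smul hc]

/-- Here `r^{t - Re z}` tends to zero, so the difference estimate along the ray is a Cauchy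
condition. The constant does not depend on the ray, which gives the uniform convergence needed for
differentiation. -/
theorem exists_tendsto_boundaryValue {z : ℂ} {t : ℝ} (ht : z.re < t) {w : SmoothFn n}
    (hw : opDsub n z w ∈ bounded n t) :
    ∃ K, 0 ≤ K ∧ ∀ x : Space n, x ≠ 0 →
      Filter.Tendsto (fun k => rayFn z w (radius k) x) Filter.atTop (nhds (boundaryValue z w x)) ∧
      ∀ r, 0 < r → r < 1 / 2 → ‖rayFn z w r x - boundaryValue z w x‖ ≤ K * r ^ (t - z.re) := by
  obtain ⟨K, hK0, hK⟩ := exists_norm_rayFn_sub_le ht.ne' hw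
  have hτ : 0 < t - z.re := by linarith
  refine ⟨K, hK0, fun x hx => ?_⟩
  have hlim := (tendsto_radius_rpow hτ).const_mul K
  have hc : CauchySeq fun k => rayFn z w (radius k) x := by
    rw [Metric.cauchySeq_iff]
    intro ε hε
    obtain ⟨N, hN⟩ := Metric.cauchySeq_iff.1 hlim.cauchySeq ε hε
    refine ⟨N, fun a ha b hb => ?_⟩
    have h1 := hK x hx _ _ (radius_pos b) (radius_pos a) (radius_lt b) (radius_lt a)
    rw [dist_eq_norm]
    refine h1.trans_lt ?_
    have h2 := hN a ha b hb
    rwa [Real.dist_eq, ← mul_sub, abs_mul, abs_of_nonneg hK0] at h2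
  have ht' := hc.tendsto_limUnder
  refine ⟨ht', fun r h0 h1 => ?_⟩
  have h3 : Filter.Tendsto (fun k => ‖rayFn z w r x - rayFn z w (radius k) x‖) Filter.atTop
      (nhds ‖rayFn z w r x - boundaryValue z w x‖) := (tendsto_const_nhds.sub ht').norm
  have h4 : Filter.Tendsto (fun k => K * |r ^ (t - z.re) - radius k ^ (t - z.re)|) Filter.atTop
      (nhds (K * |r ^ (t - z.re) - 0|)) :=
    ((tendsto_const_nhds.sub (tendsto_radius_rpow hτ)).abs).const_mul K
  have h5 := le_of_tendsto_of_tendsto' h3 h4 fun k =>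
    hK x hx _ _ (radius_pos k) h0 (radius_lt k) h1
  rwa [sub_zero, abs_of_nonneg (by positivity)] at h5

/-- The map depends only on the direction of `x`, so its derivative kills the radial part of `v`.
Writing the rest with rotation fields at the image point makes derivatives of `rayFn` expressible by
the functions `opL i j w`. -/
theorem hasFDerivAt_rayPoint (r : ℝ) {x : Space n} (hx : x ≠ 0) :
    ∃ T : Space n →L[ℝ] Space n, HasFDerivAt (rayPoint r) T x ∧
      ∀ v, T v = ∑ i, ∑ j, (x i * v j / ‖x‖ ^ 2) • rotField i j (rayPoint r x) := by
  have hn : ‖x‖ ≠ 0 := norm_ne_zero_iff.2 hx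
  have h0 : HasFDerivAt (fun y : Space n => ‖y‖ ^ 2) (2 • innerSL ℝ x) x :=
    (hasStrictFDerivAt_norm_sq x).hasFDerivAt
  have h1 := h0.sqrt (by positivity)
  simp only [Real.sqrt_sq (norm_nonneg _)] at h1
  have h2 := (((hasDerivAt_inv hn).comp_hasFDerivAt x h1).const_mul (√(1 - r))).smul
    (hasFDerivAt_id x)
  refine ⟨_, h2, fun v => ?_⟩
  have h3 := normSq_smul_eq_sum x v
  have hr : ‖x‖ ^ 2 ≠ 0 := by positivity
  have h4 : v = (‖x‖ ^ 2)⁻¹ • ((inner ℝ x v : ℝ) • x) +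
      ∑ i, ∑ j, (x i * v j / ‖x‖ ^ 2) • rotField i j x := by
    refine smul_right_injective _ hr ?_
    change ‖x‖ ^ 2 • v = ‖x‖ ^ 2 • (_ + _)
    rw [h3, smul_add, smul_smul, mul_inv_cancel₀ hr, one_smul]
    congr 1
    simp only [Finset.smul_sum, smul_smul]
    refine Finset.sum_congr rfl fun i _ => Finset.sum_congr rfl fun j _ => ?_
    congr 1
    field_simp
  have h5 : ∑ i, ∑ j, (x i * v j / ‖x‖ ^ 2) • rotField i j (rayPoint r x) =
      (√(1 - r) / ‖x‖) • ∑ i, ∑ j, (x i * v j / ‖x‖ ^ 2) • rotField i j x := by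
    simp only [Finset.smul_sum, rayPoint, map_smul]
    exact Finset.sum_congr rfl fun i _ => Finset.sum_congr rfl fun j _ => smul_comm _ _ _
  have h6 : ∑ i, ∑ j, (x i * v j / ‖x‖ ^ 2) • rotField i j x =
      v - (‖x‖ ^ 2)⁻¹ • ((inner ℝ x v : ℝ) • x) := eq_sub_of_add_eq' h4.symm
  rw [h5, h6]
  simp [smul_sub, smul_smul]
  rw [sub_eq_add_neg, ← neg_smul, div_eq_mul_inv]
  field_simp
  simp only [neg_smul, sub_eq_add_neg]

theorem exists_hasFDerivAt_rayFn (z : ℂ) (w : SmoothFn n) {r : ℝ} (h0 : 0 < r) (h1 : r < 1 / 2)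
    {x : Space n} (hx : x ≠ 0) :
    ∃ T : Space n →L[ℝ] ℂ, HasFDerivAt (rayFn z w r) T x ∧
      ∀ v, T v = ∑ i, ∑ j, ((x i * v j / ‖x‖ ^ 2 : ℝ) : ℂ) * rayFn z (opL i j w) r x := by
  obtain ⟨T, hT, hTv⟩ := hasFDerivAt_rayPoint r hx
  have hm := rayPoint_mem h0 h1 hx
  have h2 := ((w.differentiableAt hm).hasFDerivAt.comp x hT).const_mul ((r : ℂ) ^ (-z))
  refine ⟨_, h2, fun v => ?_⟩
  simp only [_root_.smul_apply, ContinuousLinearMap.comp_apply, hTv, map_sum,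
    map_smul, smul_eq_mul, Finset.mul_sum, rayFn]
  refine Finset.sum_congr rfl fun i _ => Finset.sum_congr rfl fun j _ => ?_
  rw [op_apply _ w hm, Complex.real_smul, genField]
  ring

/-- The functional `v ↦ ∑ x_i v_j |x|⁻² m_{ij}`. -/
def angularCLM (x : Space n) (m : Fin n → Fin n → ℂ) : Space n →L[ℝ] ℂ :=
  ∑ i, ∑ j, (x i / ‖x‖ ^ 2) • (EuclideanSpace.proj (𝕜 := ℝ) j : Space n →L[ℝ] ℝ).smulRight (m i j)

theorem angularCLM_apply (x : Space n) (m : Fin n → Fin n → ℂ) (v : Space n) :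
    angularCLM x m v = ∑ i, ∑ j, ((x i * v j / ‖x‖ ^ 2 : ℝ) : ℂ) * m i j := by
  simp only [angularCLM, _root_.sum_apply, _root_.smul_apply,
    ContinuousLinearMap.smulRight_apply, Complex.real_smul, EuclideanSpace.coe_proj]
  refine Finset.sum_congr rfl fun i _ => Finset.sum_congr rfl fun j _ => ?_
  push_cast
  ring

theorem angularCLM_sub (x : Space n) (m m' : Fin n → Fin n → ℂ) :
    angularCLM x m - angularCLM x m' = angularCLM x (fun i j => m i j - m' i j) := by
  ext v
  simp only [_root_.sub_apply, angularCLM_apply, ← Finset.sum_sub_distrib, mul_sub]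

theorem norm_angularCLM_le {x : Space n} {r B : ℝ} (hr : 0 < r) (hx : r ≤ ‖x‖)
    {m : Fin n → Fin n → ℂ} (hm : ∀ i j, ‖m i j‖ ≤ B) :
    ‖angularCLM x m‖ ≤ n * n * (r⁻¹ * B) := by
  have hn : 0 < ‖x‖ := hr.trans_le hx
  have hterm : ∀ i j, ‖(x i / ‖x‖ ^ 2) • (EuclideanSpace.proj (𝕜 := ℝ) j :
      Space n →L[ℝ] ℝ).smulRight (m i j)‖ ≤ r⁻¹ * B := by
    intro i j
    have h1 : ‖x i‖ ≤ ‖x‖ := PiLp.norm_apply_le x i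
    have h2 : ‖(EuclideanSpace.proj (𝕜 := ℝ) j : Space n →L[ℝ] ℝ)‖ ≤ 1 :=
      ContinuousLinearMap.opNorm_le_bound _ zero_le_one fun y => by
        simpa using PiLp.norm_apply_le y j
    have hB : 0 ≤ B := (norm_nonneg _).trans (hm i j)
    rw [norm_smul, ContinuousLinearMap.norm_smulRight_apply, norm_div, norm_pow, norm_norm]
    have h3 : ‖x i‖ / ‖x‖ ^ 2 ≤ r⁻¹ := by
      rw [div_le_iff₀ (by positivity)]
      calc ‖x i‖ ≤ ‖x‖ := h1
        _ = r⁻¹ * (r * ‖x‖) := by field_simp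
        _ ≤ r⁻¹ * ‖x‖ ^ 2 := by rw [sq]; gcongr
    calc _ ≤ r⁻¹ * (1 * B) := by gcongr; exact hm i j
      _ = _ := by ring
  calc ‖angularCLM x m‖ ≤ ∑ i : Fin n, ∑ j : Fin n, r⁻¹ * B :=
        (norm_sum_le _ _).trans (Finset.sum_le_sum fun i _ =>
          (norm_sum_le _ _).trans (Finset.sum_le_sum fun j _ => hterm i j))
    _ = _ := by simp; ring

/-- The derivatives of the approximants are the approximants of the boundary values of `opL i j w`,
which satisfy the same hypothesis because `opL` commutes with `D - z`. They converge uniformly where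
`|y| > |x|/2`, so the limit may be differentiated. -/
theorem hasFDerivAt_boundaryValue {z : ℂ} {t : ℝ} (ht : z.re < t) {w : SmoothFn n}
    (hw : opDsub n z w ∈ conormal n t) {x : Space n} (hx : x ≠ 0) :
    HasFDerivAt (boundaryValue z w) (angularCLM x fun i j => boundaryValue z (opL i j w) x) x := by
  have hL : ∀ i j, opDsub n z (opL i j w) ∈ bounded n t := fun i j => by
    rw [opDsub_op]
    exact conormal_le_bounded t (op_mem_conormal hw _)
  obtain ⟨K₀, -, hK₀⟩ := exists_tendsto_boundaryValue ht (conormal_le_bounded t hw)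
  choose K hK0 hK using fun i j => exists_tendsto_boundaryValue ht (hL i j)
  set B := ∑ i, ∑ j, K i j
  have hB : ∀ i j, K i j ≤ B := fun i j =>
    (Finset.single_le_sum (f := fun j => K i j) (fun j _ => hK0 i j) (Finset.mem_univ j)).trans
      (Finset.single_le_sum (f := fun i => ∑ j, K i j)
        (fun i _ => Finset.sum_nonneg fun j _ => hK0 i j) (Finset.mem_univ i))
  have hn : 0 < ‖x‖ := norm_pos_iff.2 hx
  set s : Set (Space n) := {y | ‖x‖ / 2 < ‖y‖}
  have hs : IsOpen s := isOpen_lt continuous_const continuous_norm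
  have hs0 : ∀ y ∈ s, y ≠ 0 := fun y hy => norm_pos_iff.1 ((half_pos hn).trans hy)
  refine hasFDerivAt_of_tendstoUniformlyOn (l := Filter.atTop) (s := s) hs
    (f := fun k => rayFn z w (radius k))
    (f' := fun k y => angularCLM y fun i j => rayFn z (opL i j w) (radius k) y)
    (g' := fun y => angularCLM y fun i j => boundaryValue z (opL i j w) y) ?_ ?_
    (fun y hy => (hK₀ y (hs0 y hy)).1) (half_lt_self hn)
  · rw [Metric.tendstoUniformlyOn_iff]
    intro ε hε
    have hlim : Filter.Tendsto (fun k => (n : ℝ) * n * ((‖x‖ / 2)⁻¹ * (B * radius k ^ (t - z.re))))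
        Filter.atTop (nhds (n * n * ((‖x‖ / 2)⁻¹ * (B * 0)))) :=
      (((tendsto_radius_rpow (by linarith)).const_mul _).const_mul _).const_mul _
    rw [mul_zero, mul_zero, mul_zero] at hlim
    filter_upwards [hlim.eventually (gt_mem_nhds hε)] with k hk y hy
    rw [dist_comm, dist_eq_norm, angularCLM_sub]
    refine (norm_angularCLM_le (half_pos hn) (le_of_lt hy) fun i j => ?_).trans_lt hk
    refine ((hK i j y (hs0 y hy)).2 _ (radius_pos k) (radius_lt k)).trans ?_
    have := radius_pos k
    gcongr
    exact hB i j
  · intro k y hy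
    obtain ⟨T, hT, hTv⟩ := exists_hasFDerivAt_rayFn z w (radius_pos k) (radius_lt k) (hs0 y hy)
    have he : (angularCLM y fun i j => rayFn z (opL i j w) (radius k) y) = T :=
      ContinuousLinearMap.ext fun v => by rw [hTv, angularCLM_apply]
    rw [he]
    exact hT

/-- The derivative is a combination, with smooth coefficients, of boundary values of the functions
`opL i j w`; induction on the order of differentiability, for all `w` at once. -/
theorem contDiffOn_boundaryValue {z : ℂ} {t : ℝ} (ht : z.re < t) {w : SmoothFn n}
    (hw : opDsub n z w ∈ conormal n t) : ContDiffOn ℝ ∞ (boundaryValue z w) {0}ᶜ := by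
  rw [contDiffOn_infty]
  intro m
  induction m generalizing w with
  | zero =>
    refine contDiffOn_zero.2 fun x hx => ?_
    exact (hasFDerivAt_boundaryValue ht hw hx).continuousAt.continuousWithinAt
  | succ m ih =>
    push_cast
    rw [contDiffOn_succ_iff_fderiv_of_isOpen isOpen_compl_zero]
    refine ⟨fun x hx =>
      (hasFDerivAt_boundaryValue ht hw hx).differentiableAt.differentiableWithinAt, by simp, ?_⟩
    rw [contDiffOn_clm_apply]
    intro v
    have hc : ∀ i : Fin n, ContDiff ℝ m (fun x : Space n => x i) := fun i =>
      (EuclideanSpace.proj (𝕜 := ℝ) i : Space n →L[ℝ] ℝ).contDiff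
    have h1 : ContDiffOn ℝ m (fun x => ∑ i, ∑ j, ((x i * v j / ‖x‖ ^ 2 : ℝ) : ℂ) *
        boundaryValue z (opL i j w) x) ({0}ᶜ : Set (Space n)) := by
      refine ContDiffOn.sum fun i _ => ContDiffOn.sum fun j _ => ContDiffOn.mul ?_ (ih ?_)
      · exact Complex.ofRealCLM.contDiff.comp_contDiffOn
          (((hc i).mul contDiff_const).contDiffOn.div (contDiff_norm_sq ℝ).contDiffOn
            fun x hx => by
              have : ‖x‖ ≠ 0 := norm_ne_zero_iff.2 hx
              positivity)
      · rw [opDsub_op]; exact op_mem_conormal hw _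
    refine h1.congr fun x hx => ?_
    rw [(hasFDerivAt_boundaryValue ht hw hx).fderiv, angularCLM_apply]

theorem fderiv_boundaryValue_rotField {z : ℂ} {t : ℝ} (ht : z.re < t) {w : SmoothFn n}
    (hw : opDsub n z w ∈ conormal n t) {x : Space n} (hx : x ≠ 0) (i j : Fin n) :
    fderiv ℝ (boundaryValue z w) x (rotField i j x) = boundaryValue z (opL i j w) x := by
  have hL : ∀ i j, opDsub n z (opL i j w) ∈ bounded n t := fun i j => by
    rw [opDsub_op]
    exact conormal_le_bounded t (op_mem_conormal hw _)
  choose K hK0 hK using fun i j => exists_tendsto_boundaryValue ht (hL i j)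
  rw [(hasFDerivAt_boundaryValue ht hw hx).fderiv, angularCLM_apply]
  have hn : ‖x‖ ^ 2 ≠ 0 := by
    have : ‖x‖ ≠ 0 := norm_ne_zero_iff.2 hx
    positivity
  have h1 : ∀ k, ∑ a, ∑ b, ((x a * rotField i j x b / ‖x‖ ^ 2 : ℝ) : ℂ) *
      rayFn z (opL a b w) (radius k) x = rayFn z (opL i j w) (radius k) x := by
    intro k
    have hm := rayPoint_mem (radius_pos k) (radius_lt k) hx
    have h2 := normSq_smul_eq_sum x (rotField i j x)
    rw [inner_rotField_self, zero_smul, zero_add] at h2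
    have h3 : rotField i j (rayPoint (radius k) x) =
        ∑ a, ∑ b, (x a * rotField i j x b / ‖x‖ ^ 2) • rotField a b (rayPoint (radius k) x) := by
      refine smul_right_injective _ hn ?_
      simp only [rayPoint, map_smul, Finset.smul_sum, smul_smul]
      rw [mul_comm, ← smul_smul, h2]
      simp only [Finset.smul_sum, smul_smul]
      refine Finset.sum_congr rfl fun a _ => Finset.sum_congr rfl fun b _ => ?_
      congr 1
      field_simp
    simp only [rayFn, op_apply _ w hm, genField]
    rw [h3]
    simp only [map_sum, map_smul, Complex.real_smul, Finset.mul_sum]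
    exact Finset.sum_congr rfl fun a _ => Finset.sum_congr rfl fun b _ => by ring
  have h4 : Filter.Tendsto (fun k => ∑ a, ∑ b, ((x a * rotField i j x b / ‖x‖ ^ 2 : ℝ) : ℂ) *
      rayFn z (opL a b w) (radius k) x) Filter.atTop
      (nhds (∑ a, ∑ b, ((x a * rotField i j x b / ‖x‖ ^ 2 : ℝ) : ℂ) *
        boundaryValue z (opL a b w) x)) :=
    tendsto_finsetSum _ fun a _ => tendsto_finsetSum _ fun b _ => ((hK a b x hx).1).const_mul _
  simp only [h1] at h4
  exact tendsto_nhds_unique h4 (hK i j x hx).1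

/-! ### Homogeneous coefficients and the removal of the leading term. -/

/-- The smooth functions on `ℝⁿ ∖ 0` that are homogeneous of degree zero. -/
structure IsCoeff (c : Space n → ℂ) : Prop where
  smooth : ContDiffOn ℝ ∞ c {0}ᶜ
  homogeneous : ∀ r : ℝ, 0 < r → ∀ x, c (r • x) = c x

theorem isCoeff_boundaryValue {z : ℂ} {t : ℝ} (ht : z.re < t) {w : SmoothFn n}
    (hw : opDsub n z w ∈ conormal n t) : IsCoeff (boundaryValue z w) :=
  ⟨contDiffOn_boundaryValue ht hw, fun _ hr x => boundaryValue_smul z w hr x⟩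

theorem IsCoeff.fderiv_radial {c : Space n → ℂ} (hc : IsCoeff c) {x : Space n} (hx : x ≠ 0) :
    fderiv ℝ c x x = 0 := by
  have hd : HasFDerivAt c (fderiv ℝ c x) ((1 : ℝ) • x) := by
    rw [one_smul]
    exact ((hc.smooth.contDiffAt (isOpen_compl_zero.mem_nhds hx)).differentiableAt
      (by simp)).hasFDerivAt
  have h1 := hd.comp_hasDerivAt (1 : ℝ) ((hasDerivAt_id (1 : ℝ)).smul_const x)
  rw [one_smul] at h1
  have h2 : (c ∘ fun r : ℝ => id r • x) =ᶠ[nhds 1] fun _ => c x :=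
    Filter.eventuallyEq_of_mem (Ioi_mem_nhds zero_lt_one) fun r hr => hc.homogeneous r hr x
  exact (h1.congr_of_eventuallyEq h2.symm).unique (hasDerivAt_const _ _)

theorem IsCoeff.opD_ofSmooth {c : Space n → ℂ} (hc : IsCoeff c) :
    opD n (ofSmooth c hc.smooth) = 0 := by
  ext x hx
  have h0 := ne_zero_of_mem_collarHalf hx
  rw [op_ofSmooth, ofSmooth_apply _ hx]
  simp [genField, radialField, hc.fderiv_radial h0]

/-- The function `c(x) ρ^z log(ρ)^k`, for `c` homogeneous of degree zero. -/
def expTerm {c : Space n → ℂ} (hc : IsCoeff c) (z : ℂ) (k : ℕ) : SmoothFn n :=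
  pmul (ofSmooth c hc.smooth) (powLog n z k)

theorem opD_expTerm {c : Space n → ℂ} (hc : IsCoeff c) (z : ℂ) (k : ℕ) :
    opD n (expTerm hc z k) = z • expTerm hc z k + (k : ℂ) • expTerm hc z (k - 1) := by
  rw [expTerm, op_pmul, hc.opD_ofSmooth, opD_powLog, pmul_add, pmul_smul, pmul_smul]
  ext x hx
  simp [expTerm]

theorem expTerm_mem_conormal {c : Space n → ℂ} (hc : IsCoeff c) {z : ℂ} {t : ℝ} (ht : t < z.re)
    (k : ℕ) : expTerm hc z k ∈ conormal n t := by
  simpa [expTerm] using pmul_mem_conormal (ofSmooth_mem_conormal hc.smooth)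
    (powLog_mem_conormal ht k)

/-- The stable family consists of all conormal functions of weight `t` and all such differences. `D`
maps a difference to `z` times itself plus `opDsub n z w`, and `opL i j` maps it to the difference
that belongs to `opL i j w`. -/
theorem sub_boundaryValue_mem_conormal {z : ℂ} {t : ℝ} (ht : z.re < t) {w : SmoothFn n}
    (hw : opDsub n z w ∈ conormal n t) :
    w - expTerm (isCoeff_boundaryValue ht hw) z 0 ∈ conormal n t := by
  refine mem_conormal_of_stable (S := (conormal n t : Set (SmoothFn n)) ∪
    {v | ∃ (w : SmoothFn n) (hw : opDsub n z w ∈ conormal n t),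
      v = w - expTerm (isCoeff_boundaryValue ht hw) z 0}) ?_ ?_ (Or.inr ⟨w, hw, rfl⟩)
  · rintro _ (hv | ⟨w, hw, rfl⟩)
    · exact conormal_le_bounded t hv
    · obtain ⟨K, -, hK⟩ := exists_tendsto_boundaryValue ht (conormal_le_bounded t hw)
      refine ⟨K, fun x hx => ?_⟩
      have hp := bdf_pos hx
      have h1 := (hK x (ne_zero_of_mem_collarHalf hx)).2 (bdf x) hp (bdf_lt_half hx)
      rw [SmoothFn.sub_apply, apply_eq_rayFn z w hx, expTerm, pmul_apply, ofSmooth_apply _ hx,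
        powLog_apply _ _ hx, pow_zero, mul_one, mul_comm (boundaryValue z w x), ← mul_sub,
        norm_mul, norm_ofReal_cpow hp]
      calc bdf x ^ z.re * _ ≤ bdf x ^ z.re * (K * bdf x ^ (t - z.re)) := by gcongr
        _ = K * (bdf x ^ z.re * bdf x ^ (t - z.re)) := by ring
        _ = K * bdf x ^ t := by rw [← Real.rpow_add hp, add_sub_cancel]
  · rintro _ (hv | ⟨w, hw, rfl⟩) g
    · exact Submodule.subset_span (Or.inl (op_mem_conormal hv g))
    · match g with
      | none =>
        have h1 : opD n (w - expTerm (isCoeff_boundaryValue ht hw) z 0) =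
            opDsub n z w + z • (w - expTerm (isCoeff_boundaryValue ht hw) z 0) := by
          rw [map_sub, opD_expTerm, opDsub_apply]
          simp [smul_sub]
        change opD n _ ∈ _
        rw [h1]
        exact add_mem (Submodule.subset_span (Or.inl hw))
          (Submodule.smul_mem _ _ (Submodule.subset_span (Or.inr ⟨w, hw, rfl⟩)))
      | some (i, j) =>
        have hw' : opDsub n z (opL i j w) ∈ conormal n t := by
          rw [opDsub_op]; exact op_mem_conormal hw _
        refine Submodule.subset_span (Or.inr ⟨opL i j w, hw', ?_⟩)
        rw [map_sub, expTerm, op_pmul, opL_powLog, expTerm]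
        congr 1
        ext x hx
        rw [SmoothFn.add_apply, pmul_apply, pmul_apply, pmul_apply, op_ofSmooth,
          ofSmooth_apply _ hx, ofSmooth_apply _ hx]
        simp [genField, fderiv_boundaryValue_rotField ht hw (ne_zero_of_mem_collarHalf hx),
          ofSmooth_apply _ hx]

/-- A function that already decays faster than `ρ^{Re z}` has boundary value zero, so there is no
leading term to subtract. -/
theorem mem_conormal_of_opDsub_of_lt {z : ℂ} {s t : ℝ} (hs : z.re < s) (ht : z.re < t)
    {w : SmoothFn n} (hw : w ∈ conormal n s) (hg : opDsub n z w ∈ conormal n t) :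
    w ∈ conormal n t := by
  have h := sub_boundaryValue_mem_conormal ht hg
  obtain ⟨C, hC⟩ := conormal_le_bounded s hw
  obtain ⟨K, -, hK⟩ := exists_tendsto_boundaryValue ht (conormal_le_bounded t hg)
  have h0 : ∀ x : Space n, x ≠ 0 → boundaryValue z w x = 0 := by
    intro x hx
    refine tendsto_nhds_unique (hK x hx).1 (squeeze_zero_norm (fun k => ?_)
      (by simpa using (tendsto_radius_rpow (by linarith : 0 < s - z.re)).const_mul C))
    have hr := radius_pos k
    have h1 := hC _ (rayPoint_mem hr (radius_lt k) hx)
    rw [bdf_rayPoint (by linarith [radius_lt k]) hx] at h1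
    rw [norm_rayFn z w hr]
    calc radius k ^ (-z.re) * _ ≤ radius k ^ (-z.re) * (C * radius k ^ s) := by gcongr
      _ = C * (radius k ^ (-z.re) * radius k ^ s) := by ring
      _ = C * radius k ^ (s - z.re) := by rw [← Real.rpow_add hr, neg_add_eq_sub]
  have h1 : w - expTerm (isCoeff_boundaryValue ht hg) z 0 = w := by
    ext x hx
    rw [SmoothFn.sub_apply, expTerm, pmul_apply, ofSmooth_apply _ hx,
      h0 x (ne_zero_of_mem_collarHalf hx), zero_mul, sub_zero]
  rwa [h1] at h

/-! ### Expansions from indicial operators -/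

open Polynomial in
/-- The monic polynomial with a given list of roots. -/
def rootPoly (zs : List ℂ) : ℂ[X] := (zs.map fun z => X - C z).prod

/-- The value of a polynomial at `ρ ∂_ρ`. -/
abbrev polyD (n : ℕ) (Q : Polynomial ℂ) : Module.End ℂ (SmoothFn n) :=
  Polynomial.aeval (opD n) Q

theorem polyD_X_sub_C (z : ℂ) : polyD n (Polynomial.X - Polynomial.C z) = opDsub n z := by
  simp [polyD]

theorem polyD_mul_apply (P Q : Polynomial ℂ) (w : SmoothFn n) :
    polyD n (P * Q) w = polyD n P (polyD n Q w) := by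
  simp [polyD]

theorem polyD_rootPoly_cons (z : ℂ) (zs : List ℂ) (w : SmoothFn n) :
    polyD n (rootPoly (z :: zs)) w = polyD n (rootPoly zs) (opDsub n z w) := by
  rw [rootPoly, List.map_cons, List.prod_cons, mul_comm, polyD_mul_apply, polyD_X_sub_C]
  rfl

theorem polyD_mem_conormal {t : ℝ} {w : SmoothFn n} (hw : w ∈ conormal n t) (Q : Polynomial ℂ) :
    polyD n Q w ∈ conormal n t := by
  induction Q using Polynomial.induction_on' with
  | add P Q hP hQ => rw [polyD, map_add]; exact add_mem hP hQ
  | monomial k a =>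
    rw [polyD, Polynomial.aeval_monomial]
    change a • ((opD n) ^ k) w ∈ _
    refine Submodule.smul_mem _ _ ?_
    induction k with
    | zero => simpa using hw
    | succ k ih => rw [pow_succ']; exact op_mem_conormal ih none

theorem opDsub_expTerm {c : Space n → ℂ} (hc : IsCoeff c) (z₀ z : ℂ) (k : ℕ) :
    opDsub n z₀ (expTerm hc z k) = (z - z₀) • expTerm hc z k + (k : ℂ) • expTerm hc z (k - 1) := by
  rw [opDsub_apply, opD_expTerm, sub_smul]; abel

/-- Each factor `D - z` lowers the power of the logarithm by one, and the other factors never raise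
it. -/
theorem polyD_rootPoly_expTerm {c : Space n → ℂ} (hc : IsCoeff c) {z : ℂ} {k : ℕ} {zs : List ℂ}
    (hk : k < zs.count z) : polyD n (rootPoly zs) (expTerm hc z k) = 0 := by
  induction zs generalizing k with
  | nil => simp at hk
  | cons z₀ zs ih =>
    rw [polyD_rootPoly_cons, opDsub_expTerm, map_add, map_smul, map_smul]
    rcases eq_or_ne z₀ z with rfl | hne
    · rw [sub_self, zero_smul, zero_add]
      rcases k with _ | k
      · simp
      · rw [List.count_cons_self] at hk
        rw [ih (by simpa using hk), smul_zero]
    · rw [List.count_cons_of_ne hne] at hk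
      rw [ih hk, ih (lt_of_le_of_lt (Nat.sub_le _ _) hk)]
      simp

/-- The span of the terms `c ρ^z log(ρ)^k` with `s < Re z < t` and `k` less than the multiplicity
of `z` in the list `zs`. -/
def expSpan (n : ℕ) (zs : List ℂ) (s t : ℝ) : Submodule ℂ (SmoothFn n) :=
  Submodule.span ℂ {v | ∃ (c : Space n → ℂ) (hc : IsCoeff c) (z : ℂ) (k : ℕ),
    s < z.re ∧ z.re < t ∧ k < zs.count z ∧ v = expTerm hc z k}

theorem expTerm_mem_expSpan {zs : List ℂ} {s t : ℝ} {c : Space n → ℂ} (hc : IsCoeff c) {z : ℂ}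
    {k : ℕ} (hs : s < z.re) (ht : z.re < t) (hk : k < zs.count z) :
    expTerm hc z k ∈ expSpan n zs s t := Submodule.subset_span ⟨c, hc, z, k, hs, ht, hk, rfl⟩

theorem expSpan_le_conormal (zs : List ℂ) (s t : ℝ) : expSpan n zs s t ≤ conormal n s := by
  refine Submodule.span_le.2 ?_
  rintro _ ⟨c, hc, z, k, hs, -, -, rfl⟩
  exact expTerm_mem_conormal hc hs k

theorem polyD_expSpan {zs zs' : List ℂ} (h : ∀ z, zs.count z ≤ zs'.count z) {s t : ℝ}
    {v : SmoothFn n} (hv : v ∈ expSpan n zs s t) : polyD n (rootPoly zs') v = 0 := by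
  have : expSpan n zs s t ≤ LinearMap.ker (polyD n (rootPoly zs')) := by
    refine Submodule.span_le.2 ?_
    rintro _ ⟨c, hc, z, k, -, -, hk, rfl⟩
    exact polyD_rootPoly_expTerm hc (hk.trans_le (h z))
  exact this hv

/-- In the resonant case `z₀ = z` the solution has one more logarithm, which the longer root list
allows. Otherwise the system is triangular in the power of the logarithm, with diagonal entry `z -
z₀ ≠ 0`. -/
theorem exists_opDsub_eq_expTerm {zs : List ℂ} {s t : ℝ} {c : Space n → ℂ} (hc : IsCoeff c)
    (z₀ : ℂ) {z : ℂ} {k : ℕ} (hs : s < z.re) (ht : z.re < t) (hk : k < zs.count z) :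
    ∃ v ∈ expSpan n (z₀ :: zs) s t, opDsub n z₀ v = expTerm hc z k := by
  rcases eq_or_ne z₀ z with rfl | hne
  · refine ⟨((k : ℂ) + 1)⁻¹ • expTerm hc z₀ (k + 1), Submodule.smul_mem _ _
      (expTerm_mem_expSpan hc hs ht (by rw [List.count_cons_self]; omega)), ?_⟩
    have : (k : ℂ) + 1 ≠ 0 := by exact_mod_cast k.succ_ne_zero
    rw [map_smul, opDsub_expTerm, sub_self, zero_smul, zero_add, smul_smul]
    push_cast
    rw [inv_mul_cancel₀ this, one_smul]
  · have hz : z - z₀ ≠ 0 := sub_ne_zero.2 hne.symm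
    induction k with
    | zero =>
      refine ⟨(z - z₀)⁻¹ • expTerm hc z 0, Submodule.smul_mem _ _
        (expTerm_mem_expSpan hc hs ht (by rwa [List.count_cons_of_ne hne])), ?_⟩
      rw [map_smul, opDsub_expTerm, smul_add, smul_smul, inv_mul_cancel₀ hz]
      simp
    | succ k ih =>
      obtain ⟨v, hv, he⟩ := ih (by omega)
      refine ⟨(z - z₀)⁻¹ • (expTerm hc z (k + 1) - ((k + 1 : ℕ) : ℂ) • v),
        Submodule.smul_mem _ _ (sub_mem (expTerm_mem_expSpan hc hs ht
          (by rwa [List.count_cons_of_ne hne])) (Submodule.smul_mem _ _ hv)), ?_⟩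
      rw [map_smul, map_sub, map_smul, he, opDsub_expTerm, Nat.add_sub_cancel, add_sub_cancel_right,
        smul_smul, inv_mul_cancel₀ hz, one_smul]

theorem exists_opDsub_eq {zs : List ℂ} {s t : ℝ} (z₀ : ℂ) {g : SmoothFn n}
    (hg : g ∈ expSpan n zs s t) : ∃ v ∈ expSpan n (z₀ :: zs) s t, opDsub n z₀ v = g := by
  have : expSpan n zs s t ≤ (expSpan n (z₀ :: zs) s t).map (opDsub n z₀) := by
    refine Submodule.span_le.2 ?_
    rintro _ ⟨c, hc, z, k, hs, ht, hk, rfl⟩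
    exact exists_opDsub_eq_expTerm hc z₀ hs ht hk
  exact this hg

/-- The operator is inverted one root at a time: expand `(D - z) w`, solve `D - z` exactly on the
expansion, and treat the remaining `w - v`, for which `(D - z)(w - v)` has weight `t`. -/
theorem exists_expansion {zs : List ℂ} {s t : ℝ}
    (hzs : ∀ z ∈ zs, z.re ≠ s ∧ z.re ≠ t) {w : SmoothFn n} (hw : w ∈ conormal n s)
    (hQ : polyD n (rootPoly zs) w ∈ conormal n t) :
    ∃ v ∈ expSpan n zs s t, w - v ∈ conormal n t := by
  induction zs generalizing w with
  | nil => exact ⟨0, zero_mem _, by simpa [rootPoly] using hQ⟩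
  | cons z zs ih =>
    rw [polyD_rootPoly_cons] at hQ
    obtain ⟨g, hg, hgt⟩ := ih (fun z hz => hzs z (by simp [hz])) (opDsub_mem_conormal hw) hQ
    obtain ⟨v, hv, hvg⟩ := exists_opDsub_eq z hg
    have hws : w - v ∈ conormal n s := sub_mem hw (expSpan_le_conormal _ _ _ hv)
    have hwt : opDsub n z (w - v) ∈ conormal n t := by rwa [map_sub, hvg]
    obtain ⟨hzs', hzt⟩ := hzs z (by simp)
    -- Only a root with `s < Re z < t` yields a new term. For `Re z < s` its coefficient vanishes,
    -- and for `Re z > t` the term would be absorbed in the remainder.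
    rcases lt_or_gt_of_ne hzt with hlt | hgt
    · rcases lt_or_gt_of_ne hzs' with hls | hgs
      · exact ⟨v, hv, mem_conormal_of_opDsub_of_lt hls hlt hws hwt⟩
      · refine ⟨v + expTerm (isCoeff_boundaryValue hlt hwt) z 0,
          add_mem hv (expTerm_mem_expSpan _ hgs hlt (by simp)), ?_⟩
        rw [← sub_sub]
        exact sub_boundaryValue_mem_conormal hlt hwt
    · exact ⟨v, hv, mem_conormal_of_opDsub hgt hws hwt⟩

/-! ### Coefficients -/

theorem isCoeff_zero : IsCoeff (fun _ : Space n => (0 : ℂ)) :=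
  ⟨contDiffOn_const, fun _ _ _ => rfl⟩

theorem IsCoeff.add {c d : Space n → ℂ} (hc : IsCoeff c) (hd : IsCoeff d) :
    IsCoeff fun x => c x + d x :=
  ⟨hc.smooth.add hd.smooth, fun r hr x => by rw [hc.homogeneous r hr, hd.homogeneous r hr]⟩

theorem IsCoeff.const_mul {c : Space n → ℂ} (hc : IsCoeff c) (a : ℂ) :
    IsCoeff fun x => a * c x :=
  ⟨contDiffOn_const.mul hc.smooth, fun r hr x => by rw [hc.homogeneous r hr]⟩

/-- The smooth functions that are homogeneous of degree zero, as a type. -/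
abbrev Coeff (n : ℕ) : Type := {c : Space n → ℂ // IsCoeff c}

/-- A finite sum of terms `c_p ρ^z log(ρ)^k`, `p = (z, k)`. -/
def expSum (S : Finset (ℂ × ℕ)) (c : ℂ × ℕ → Coeff n) : SmoothFn n :=
  ∑ p ∈ S, expTerm (c p).2 p.1 p.2

theorem expTerm_apply {c : Space n → ℂ} (hc : IsCoeff c) (z : ℂ) (k : ℕ) {x : Space n}
    (hx : x ∈ collarHalf n) :
    expTerm hc z k x = c x * ((bdf x : ℂ) ^ z * (Real.log (bdf x) : ℂ) ^ k) := by
  rw [expTerm, pmul_apply, ofSmooth_apply _ hx, powLog_apply _ _ hx]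

theorem expSum_apply (S : Finset (ℂ × ℕ)) (c : ℂ × ℕ → Coeff n) {x : Space n}
    (hx : x ∈ collarHalf n) :
    expSum S c x = ∑ p ∈ S, (c p).1 x * ((bdf x : ℂ) ^ p.1 * (Real.log (bdf x) : ℂ) ^ p.2) := by
  rw [expSum, SmoothFn.sum_apply]
  exact Finset.sum_congr rfl fun p _ => expTerm_apply _ _ _ hx

theorem exists_expSum_eq {zs : List ℂ} {s t : ℝ} {S : Finset (ℂ × ℕ)}
    (hS : ∀ z k, s < z.re → z.re < t → k < zs.count z → (z, k) ∈ S)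
    {v : SmoothFn n} (hv : v ∈ expSpan n zs s t) : ∃ c : ℂ × ℕ → Coeff n, v = expSum S c := by
  classical
  induction hv using Submodule.span_induction with
  | mem v hv =>
    obtain ⟨c, hc, z, k, hs, ht, hk, rfl⟩ := hv
    refine ⟨fun p => if p = (z, k) then ⟨c, hc⟩ else ⟨_, isCoeff_zero⟩, ?_⟩
    ext x hx
    rw [expTerm_apply _ _ _ hx, expSum_apply _ _ hx, Finset.sum_eq_single (z, k)]
    · simp
    · intro p _ hp
      simp [hp]
    · exact fun h => absurd (hS z k hs ht hk) h
  | zero =>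
    refine ⟨fun _ => ⟨_, isCoeff_zero⟩, ?_⟩
    ext x hx
    simp [expSum_apply _ _ hx]
  | add u v _ _ hu hv =>
    obtain ⟨c, rfl⟩ := hu
    obtain ⟨d, rfl⟩ := hv
    refine ⟨fun p => ⟨_, (c p).2.add (d p).2⟩, ?_⟩
    ext x hx
    rw [SmoothFn.add_apply, expSum_apply _ _ hx, expSum_apply _ _ hx, expSum_apply _ _ hx,
      ← Finset.sum_add_distrib]
    exact Finset.sum_congr rfl fun p _ => by ring
  | smul a v _ hv =>
    obtain ⟨c, rfl⟩ := hv
    refine ⟨fun p => ⟨_, (c p).2.const_mul a⟩, ?_⟩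
    ext x hx
    rw [SmoothFn.smul_apply, expSum_apply _ _ hx, expSum_apply _ _ hx, Finset.mul_sum]
    exact Finset.sum_congr rfl fun p _ => by ring

/-! ### Full expansions from a sequence of indicial operators. -/

/-- The hypotheses under which a function on the collar has an expansion with index set `E`:
indicial operators with the roots `zs N` improve its weight to `τ + N`. -/
structure IndicialData (n : ℕ) (E : Set (ℂ × ℕ)) (τ : ℝ) (zs : ℕ → List ℂ) (w : SmoothFn n) :
    Prop where
  indexSet : IsIndexSet E
  count_mono : ∀ N M, N ≤ M → ∀ z, (zs N).count z ≤ (zs M).count z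
  mem_of_lt_count : ∀ N z k, k < (zs N).count z → (z, k) ∈ E
  lt_re : ∀ p ∈ E, τ < p.1.re
  re_ne : ∀ p ∈ E, ∀ N : ℕ, p.1.re ≠ τ + N
  conormal : w ∈ conormal n τ
  indicial : ∀ N : ℕ, polyD n (rootPoly (zs N)) w ∈ Backprojection.conormal n (τ + N)

/-- The part of an index set with `s < Re z < t`, as a finite set. -/
def IsIndexSet.slice {E : Set (ℂ × ℕ)} (hE : IsIndexSet E) (s t : ℝ) : Finset (ℂ × ℕ) :=
  ((hE.finite_lt t).subset (t := {p ∈ E | s < p.1.re ∧ p.1.re < t})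
    fun _ hp => ⟨hp.1, hp.2.2⟩).toFinset

theorem IsIndexSet.mem_slice {E : Set (ℂ × ℕ)} (hE : IsIndexSet E) {s t : ℝ} {p : ℂ × ℕ} :
    p ∈ hE.slice s t ↔ p ∈ E ∧ s < p.1.re ∧ p.1.re < t := by
  simp only [IsIndexSet.slice, Set.Finite.mem_toFinset, Set.mem_ofPred_eq]

namespace IndicialData

variable {E : Set (ℂ × ℕ)} {τ : ℝ} {zs : ℕ → List ℂ} {w : SmoothFn n}

/-- The property of the remainders after `N` steps. -/
def IsRemainder (n : ℕ) (τ : ℝ) (zs : ℕ → List ℂ) (N : ℕ) (v : SmoothFn n) : Prop :=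
  v ∈ Backprojection.conormal n (τ + N) ∧
    ∀ M ≥ N, polyD n (rootPoly (zs M)) v ∈ Backprojection.conormal n (τ + M)

theorem exists_step (h : IndicialData n E τ zs w) {N : ℕ} {v : SmoothFn n}
    (hv : IsRemainder n τ zs N v) :
    ∃ c : ℂ × ℕ → Coeff n, IsRemainder n τ zs (N + 1)
      (v - expSum (h.indexSet.slice (τ + N) (τ + (N + 1 : ℕ))) c) := by
  have hE : ∀ z ∈ zs (N + 1), (z, 0) ∈ E := fun z hz =>
    h.mem_of_lt_count (N + 1) z 0 (List.count_pos_iff.2 hz)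
  obtain ⟨u, hu, hvu⟩ := exists_expansion (s := τ + N) (t := τ + (N + 1 : ℕ))
    (fun z hz => ⟨h.re_ne _ (hE z hz) N, h.re_ne _ (hE z hz) (N + 1)⟩) hv.1
    (hv.2 (N + 1) N.le_succ)
  obtain ⟨c, rfl⟩ := exists_expSum_eq
    (S := h.indexSet.slice (τ + N) (τ + (N + 1 : ℕ))) (fun z k hs ht hk =>
      h.indexSet.mem_slice.2 ⟨h.mem_of_lt_count _ z k hk, hs, ht⟩) hu
  refine ⟨c, hvu, fun M hM => ?_⟩
  -- The later operators annihilate the subtracted terms, since multiplicities only grow; the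
  -- remainder therefore inherits all further improvements.
  rw [map_sub, polyD_expSpan (h.count_mono _ _ hM) hu, sub_zero]
  exact hv.2 M (by omega)

/-- The coefficients are chosen once, independently of the order `N`, as the definition of
polyhomogeneity demands. -/
theorem exists_coeffs (h : IndicialData n E τ zs w) :
    ∃ c : ℂ × ℕ → Coeff n, ∀ N : ℕ,
      w - expSum (h.indexSet.slice τ (τ + N)) c ∈ Backprojection.conormal n (τ + N) := by
  classical
  have h0 : IsRemainder n τ zs 0 w := ⟨by simpa using h.conormal, fun M _ => h.indicial M⟩
  choose d hd using fun (N : ℕ) (v : {v // IsRemainder n τ zs N v}) => h.exists_step v.2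
  let r : ∀ N : ℕ, {v // IsRemainder n τ zs N v} := fun N =>
    Nat.rec ⟨w, h0⟩ (fun N v => ⟨_, hd N v⟩) N
  have hr : ∀ N, (r (N + 1)).1 = (r N).1 -
      expSum (h.indexSet.slice (τ + N) (τ + (N + 1 : ℕ))) (d N (r N)) := fun N => rfl
  -- The term `p` is subtracted in the step `N` with `τ + N < Re p < τ + N + 1`, that is, `N = ⌊Re p
  -- - τ⌋`. Real parts on the thresholds are excluded by `re_ne`.
  let c : ℂ × ℕ → Coeff n := fun p => d ⌊p.1.re - τ⌋₊ (r ⌊p.1.re - τ⌋₊) p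
  refine ⟨c, fun N => ?_⟩
  suffices hs : w - expSum (h.indexSet.slice τ (τ + N)) c = (r N).1 by
    rw [hs]; exact (r N).2.1
  induction N with
  | zero =>
    have : h.indexSet.slice τ (τ + (0 : ℕ)) = ∅ := by
      ext p
      rw [h.indexSet.mem_slice]
      simp only [Nat.cast_zero, add_zero, Finset.notMem_empty, iff_false]
      rintro ⟨-, h1, h2⟩
      exact lt_asymm h1 h2
    rw [this]
    simp only [expSum, Finset.sum_empty, sub_zero]
    rfl
  | succ N ih =>
    have hun : h.indexSet.slice τ (τ + (N + 1 : ℕ)) = h.indexSet.slice τ (τ + N) ∪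
        h.indexSet.slice (τ + N) (τ + (N + 1 : ℕ)) := by
      ext p
      rw [Finset.mem_union, h.indexSet.mem_slice, h.indexSet.mem_slice, h.indexSet.mem_slice]
      have hN : (0 : ℝ) ≤ N := N.cast_nonneg
      constructor
      · rintro ⟨hp, h1, h2⟩
        rcases lt_or_gt_of_ne (h.re_ne p hp N) with h3 | h3
        · exact Or.inl ⟨hp, h1, h3⟩
        · exact Or.inr ⟨hp, h3, h2⟩
      · rintro (⟨hp, h1, h2⟩ | ⟨hp, h1, h2⟩)
        · exact ⟨hp, h1, by push_cast; linarith⟩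
        · exact ⟨hp, by linarith, h2⟩
    have hdis : Disjoint (h.indexSet.slice τ (τ + N))
        (h.indexSet.slice (τ + N) (τ + (N + 1 : ℕ))) := by
      rw [Finset.disjoint_left]
      intro p hp hp'
      exact lt_asymm (h.indexSet.mem_slice.1 hp).2.2 (h.indexSet.mem_slice.1 hp').2.1
    have hc : expSum (h.indexSet.slice (τ + N) (τ + (N + 1 : ℕ))) c =
        expSum (h.indexSet.slice (τ + N) (τ + (N + 1 : ℕ))) (d N (r N)) := by
      refine Finset.sum_congr rfl fun p hp => ?_
      have hp' := (h.indexSet.mem_slice.1 hp).2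
      have hf : ⌊p.1.re - τ⌋₊ = N := by
        rw [Nat.floor_eq_iff (by linarith [hp'.1, (N.cast_nonneg : (0 : ℝ) ≤ N)])]
        have := hp'.2
        push_cast at this
        constructor <;> linarith [hp'.1]
      have hcp : c p = d N (r N) p := congrArg (fun m => d m (r m) p) hf
      simp only [hcp]
    rw [hr, ← hc, ← ih, hun, expSum, Finset.sum_union hdis, ← sub_sub]
    rfl

theorem exists_expansion (h : IndicialData n E τ zs w) :
    ∃ c : ℂ × ℕ → Coeff n, ∀ t : ℝ, ∃ S : Finset (ℂ × ℕ),
      (∀ p, p ∈ S ↔ p ∈ E ∧ p.1.re ≤ t) ∧ w - expSum S c ∈ Backprojection.conormal n t := by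
  classical
  obtain ⟨c, hc⟩ := h.exists_coeffs
  refine ⟨c, fun t => ?_⟩
  obtain ⟨N, hN⟩ := exists_nat_gt (t - τ)
  have hN' : t < τ + N := by linarith
  refine ⟨(h.indexSet.slice τ (τ + N)).filter fun p => p.1.re ≤ t, fun p => ?_, ?_⟩
  · rw [Finset.mem_filter, h.indexSet.mem_slice]
    exact ⟨fun hp => ⟨hp.1.1, hp.2⟩, fun hp => ⟨⟨hp.1, h.lt_re p hp.1, by linarith [hp.2]⟩, hp.2⟩⟩
  -- The terms with `t < Re p < τ + N` are themselves conormal of weight `t` and are returned to the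
  -- remainder.
  · have hsplit : expSum (h.indexSet.slice τ (τ + N)) c =
        expSum ((h.indexSet.slice τ (τ + N)).filter fun p => p.1.re ≤ t) c +
        expSum ((h.indexSet.slice τ (τ + N)).filter fun p => ¬ p.1.re ≤ t) c :=
      (Finset.sum_filter_add_sum_filter_not _ _ _).symm
    have h1 : w - expSum ((h.indexSet.slice τ (τ + N)).filter fun p => p.1.re ≤ t) c =
        (w - expSum (h.indexSet.slice τ (τ + N)) c) +
        expSum ((h.indexSet.slice τ (τ + N)).filter fun p => ¬ p.1.re ≤ t) c := by
      rw [hsplit]; abel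
    rw [h1]
    refine add_mem (conormal_anti hN'.le (hc N)) (sum_mem fun p hp => ?_)
    exact expTerm_mem_conormal _ (not_le.1 (Finset.mem_filter.1 hp).2) _

end IndicialData

theorem IsCoeff.smoothOnSphere [n.AtLeastTwo] {c : Space n → ℂ} (hc : IsCoeff c) :
    SmoothOnSphere n fun θ => c θ := by
  intro θ
  have h1 : ContMDiffAt 𝓘(ℝ, Space n) 𝓘(ℝ, ℂ) ∞ c (θ : Space n) := by
    refine (hc.smooth.contDiffAt (isOpen_compl_zero.mem_nhds ?_)).contMDiffAt
    intro h
    simpa [Set.mem_singleton_iff.1 h] using mem_sphere_zero_iff_norm.1 θ.2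
  exact h1.comp θ (contMDiff_coe_sphere (n := n - 1) θ)

theorem IsCoeff.radialExt_eq {c : Space n → ℂ} (hc : IsCoeff c) {x : Space n} (hx : x ≠ 0) :
    radialExt (fun θ : Sphere n => c θ) x = c x := by
  rw [radialExt, dif_neg hx]
  exact hc.homogeneous _ (inv_pos.2 (norm_pos_iff.2 hx)) x

theorem isPolyhomogeneous_of_indicialData [n.AtLeastTwo] {E : Set (ℂ × ℕ)} {τ : ℝ}
    {zs : ℕ → List ℂ} {w : SmoothFn n} (h : IndicialData n E τ zs w) {u : Space n → ℂ}
    (hu : ∀ x ∈ collarHalf n, u x = w x)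
    (hconormal : ∃ t : ℝ, IsConormalOn (Metric.ball 0 1) t u) : IsPolyhomogeneous n E u := by
  obtain ⟨c, hc⟩ := h.exists_expansion
  refine ⟨h.indexSet, hconormal, fun p θ => (c p).1 θ, fun p _ => (c p).2.smoothOnSphere, 1 / 2,
    by norm_num, by norm_num, fun t => ?_⟩
  obtain ⟨S, hS, hw⟩ := hc t
  refine ⟨S, hS, isConormalOn_of_mem_conormal hw fun x hx => ?_⟩
  rw [SmoothFn.sub_apply, expSum_apply _ _ hx, hu x hx]
  congr 1
  refine Finset.sum_congr rfl fun p _ => ?_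
  rw [(c p).2.radialExt_eq (ne_zero_of_mem_collarHalf hx), mul_assoc]

/-! ### Indicial polynomials -/

/-- Multiplication by the boundary-defining function. -/
def mulRho (n : ℕ) : Module.End ℂ (SmoothFn n) where
  toFun w := pmul (rho n) w
  map_add' := pmul_add _
  map_smul' c w := pmul_smul c _ w

theorem mulRho_apply (w : SmoothFn n) {x : Space n} (hx : x ∈ collarHalf n) :
    mulRho n w x = bdf x * w x := by
  change rho n x * w x = _
  rw [rho_apply hx]

theorem rho_eq_powLog : rho n = powLog n 1 0 := by
  ext x hx
  rw [rho_apply hx, powLog_apply _ _ hx]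
  simp

theorem mulRho_mem_conormal {t : ℝ} {w : SmoothFn n} (hw : w ∈ conormal n t) :
    mulRho n w ∈ conormal n (t + 1) := by
  have := pmul_mem_conormal (powLog_zero_mem_conormal (n := n) 1) hw
  rw [← rho_eq_powLog, Complex.one_re, add_comm] at this
  exact this

theorem opD_mulRho (w : SmoothFn n) : opD n (mulRho n w) = mulRho n (opD n w + w) := by
  change op none (pmul (rho n) w) = pmul (rho n) (op none w + w)
  rw [op_pmul, rho_eq_powLog, opD_powLog, pmul_add]
  ext x hx
  simp [add_comm]

/-- Multiplication by `ρ` shifts indicial roots by one; this is why the roots occur in the families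
`j` and `z + j`. -/
theorem opDsub_mulRho (z : ℂ) (w : SmoothFn n) :
    opDsub n (z + 1) (mulRho n w) = mulRho n (opDsub n z w) := by
  rw [opDsub_apply, opD_mulRho, opDsub_apply, map_add, map_sub, map_smul, add_smul, one_smul]
  abel

open Polynomial in
/-- The indicial polynomial with the roots `j` and, `e`-fold, `z + j` for `j < N`. -/
def indPoly (z : ℂ) (e N : ℕ) : ℂ[X] :=
  ∏ j ∈ Finset.range N, (X - C (j : ℂ)) * (X - C (z + j)) ^ e

open Polynomial in
/-- The indicial polynomial with its roots shifted by one. -/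
def indPolyShift (z : ℂ) (e N : ℕ) : ℂ[X] :=
  ∏ j ∈ Finset.range N, (X - C ((j : ℂ) + 1)) * (X - C (z + j + 1)) ^ e

open Polynomial in
theorem indPoly_succ (z : ℂ) (e N : ℕ) :
    indPoly z e (N + 1) = X * (X - C z) ^ e * indPolyShift z e N := by
  rw [indPoly, Finset.prod_range_succ', mul_comm, indPolyShift]
  congr 1
  · simp
  · refine Finset.prod_congr rfl fun j _ => ?_
    push_cast
    rw [add_assoc]

open Polynomial in
theorem indPolyShift_dvd (z : ℂ) (e N : ℕ) : indPolyShift z e N ∣ indPolyShift z (e + 1) N :=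
  Finset.prod_dvd_prod_of_dvd _ _ fun _ _ => mul_dvd_mul_left _ (pow_dvd_pow _ e.le_succ)

open Polynomial in
theorem indPoly_dvd (z : ℂ) (e N : ℕ) : indPoly z e N ∣ indPoly z (e + 1) N :=
  Finset.prod_dvd_prod_of_dvd _ _ fun _ _ => mul_dvd_mul_left _ (pow_dvd_pow _ e.le_succ)

open Polynomial in
theorem indPoly_zero_dvd (z : ℂ) (e N : ℕ) : indPoly z 0 N ∣ indPoly z e N :=
  Finset.prod_dvd_prod_of_dvd _ _ fun _ _ => mul_dvd_mul_left _ (pow_dvd_pow _ e.zero_le)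

theorem polyD_pow_opDsub_mulRho (z : ℂ) (e : ℕ) (w : SmoothFn n) :
    (opDsub n (z + 1) ^ e) (mulRho n w) = mulRho n ((opDsub n z ^ e) w) := by
  induction e with
  | zero => simp
  | succ e ih =>
    rw [pow_succ', pow_succ', Module.End.mul_apply, Module.End.mul_apply, ih, opDsub_mulRho]

theorem polyD_indPolyShift_mulRho (z : ℂ) (e N : ℕ) (w : SmoothFn n) :
    polyD n (indPolyShift z e N) (mulRho n w) = mulRho n (polyD n (indPoly z e N) w) := by
  induction N generalizing w with
  | zero => simp [indPoly, indPolyShift]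
  | succ N ih =>
    rw [indPoly, indPolyShift, Finset.prod_range_succ, Finset.prod_range_succ, ← indPoly,
      ← indPolyShift, polyD_mul_apply, polyD_mul_apply, polyD_mul_apply, polyD_mul_apply]
    have h1 : ∀ (z : ℂ) (v : SmoothFn n),
        polyD n ((Polynomial.X - Polynomial.C z) ^ e) v = (opDsub n z ^ e) v := fun z v => by
      rw [polyD, map_pow, ← polyD, polyD_X_sub_C]
    rw [h1, h1, polyD_pow_opDsub_mulRho, polyD_X_sub_C, opDsub_mulRho, ih, polyD_X_sub_C]

theorem polyD_mem_of_dvd {t : ℝ} {P Q : Polynomial ℂ} (h : P ∣ Q) {w : SmoothFn n}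
    (hw : polyD n P w ∈ conormal n t) : polyD n Q w ∈ conormal n t := by
  obtain ⟨R, rfl⟩ := h
  rw [mul_comm, polyD_mul_apply]
  exact polyD_mem_conormal hw R

theorem commute_polyD_op (Q : Polynomial ℂ) (g : Gen n) : Commute (polyD n Q) (op g) := by
  have h : op g ∈ Subalgebra.centralizer ℂ {opD n} := by
    rw [Subalgebra.mem_centralizer_iff]
    rintro _ rfl
    exact (commute_opD_op g).eq
  induction Q using Polynomial.induction_on' with
  | add P Q hP hQ => rw [polyD, map_add]; exact hP.add_left hQ
  | monomial k a =>
    rw [polyD, Polynomial.aeval_monomial]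
    exact (Algebra.commute_algebraMap_left _ _).mul_left ((commute_opD_op g).pow_left k)

/-! ### Gain of weight under the indicial operators. -/

/-- The functions whose weight is improved to `τ + M` by the `M`-th indicial operator, for all
`M ≤ N`. -/
def indSpace (n : ℕ) (z : ℂ) (τ : ℝ) (e N : ℕ) : Submodule ℂ (SmoothFn n) :=
  ⨅ M : Set.Iic N, (conormal n (τ + (M : ℕ))).comap (polyD n (indPoly z e M))

theorem mem_indSpace {z : ℂ} {τ : ℝ} {e N : ℕ} {w : SmoothFn n} :
    w ∈ indSpace n z τ e N ↔ ∀ M ≤ N, polyD n (indPoly z e M) w ∈ conormal n (τ + M) := by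
  simp [indSpace, Submodule.mem_iInf]

section

variable {z : ℂ} {τ : ℝ} {e N : ℕ} {w : SmoothFn n}

theorem op_mem_indSpace (hw : w ∈ indSpace n z τ e N) (g : Gen n) :
    op g w ∈ indSpace n z τ e N := by
  refine mem_indSpace.2 fun M hM => ?_
  rw [← Module.End.mul_apply, (commute_polyD_op _ g).eq]
  exact op_mem_conormal (mem_indSpace.1 hw M hM) g

/-- The shifted factors of the polynomial of order `M + 1` commute past `ρ` into the polynomial of
order `M`, and `ρ` supplies the missing unit of weight. This is why the space imposes conditions for
all `M ≤ N`. -/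
theorem mulRho_mem_indSpace (hw : w ∈ indSpace n z τ e N) : mulRho n w ∈ indSpace n z τ e N := by
  refine mem_indSpace.2 fun M hM => ?_
  match M with
  | 0 =>
    have := mem_indSpace.1 hw 0 (Nat.zero_le _)
    simp only [indPoly, Finset.range_zero, Finset.prod_empty, polyD, map_one,
      Module.End.one_apply] at this ⊢
    exact conormal_anti (by linarith) (mulRho_mem_conormal this)
  | M + 1 =>
    rw [indPoly_succ, polyD_mul_apply, polyD_indPolyShift_mulRho]
    refine polyD_mem_conormal ?_ _
    have := mulRho_mem_conormal (mem_indSpace.1 hw M (by omega))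
    push_cast
    rwa [← add_assoc]

theorem indSpace_le_succ : indSpace n z τ e N ≤ indSpace n z τ (e + 1) N := fun _ hw =>
  mem_indSpace.2 fun M hM => polyD_mem_of_dvd (indPoly_dvd z e M) (mem_indSpace.1 hw M hM)

end

/-- The derivation `∂_ρ` on functions that are smooth up to the boundary. -/
def radialDeriv (φ : Space n → ℂ) (x : Space n) : ℂ :=
  fderiv ℝ φ x ((-(1 / (2 * ‖x‖ ^ 2))) • x)

theorem contDiffOn_radialDeriv {φ : Space n → ℂ} (hφ : ContDiffOn ℝ ∞ φ {0}ᶜ) :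
    ContDiffOn ℝ ∞ (radialDeriv φ) {0}ᶜ := by
  refine contDiffOn_fderiv_apply hφ (ContDiffOn.smul (ContDiffOn.neg (contDiffOn_const.div
    (contDiffOn_const.mul (contDiff_norm_sq ℝ).contDiffOn) ?_)) contDiffOn_id)
  intro x hx
  have : ‖x‖ ≠ 0 := norm_ne_zero_iff.2 hx
  positivity

theorem opD_ofSmooth {φ : Space n → ℂ} (hφ : ContDiffOn ℝ ∞ φ {0}ᶜ) :
    opD n (ofSmooth φ hφ) = mulRho n (ofSmooth (radialDeriv φ) (contDiffOn_radialDeriv hφ)) := by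
  ext x hx
  have : genField none x = bdf x • ((-(1 / (2 * ‖x‖ ^ 2))) • x) := by
    rw [genField, radialField, smul_smul]
    congr 1; ring
  rw [op_ofSmooth, ofSmooth_apply _ hx, mulRho_apply _ hx, ofSmooth_apply _ hx, this, map_smul,
    Complex.real_smul, radialDeriv]

/-- For a function smooth up to the boundary, `D φ = ρ ∂_ρ φ` with `∂_ρ φ` again smooth, so the
roots `0, 1, …` alone gain one power of `ρ` each. -/
theorem polyD_indPoly_zero_ofSmooth (z : ℂ) (N : ℕ) {φ : Space n → ℂ}
    (hφ : ContDiffOn ℝ ∞ φ {0}ᶜ) :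
    polyD n (indPoly z 0 N) (ofSmooth φ hφ) ∈ conormal n N := by
  induction N generalizing φ with
  | zero => simpa [indPoly] using ofSmooth_mem_conormal hφ
  | succ N ih =>
    rw [indPoly_succ, pow_zero, mul_one, mul_comm, polyD_mul_apply]
    have : polyD n Polynomial.X (ofSmooth φ hφ) = opD n (ofSmooth φ hφ) := by simp [polyD]
    rw [this, opD_ofSmooth, polyD_indPolyShift_mulRho]
    push_cast
    exact mulRho_mem_conormal (ih _)

theorem ofSmooth_mem_indSpace (z : ℂ) {τ : ℝ} (hτ : τ ≤ 0) (e N : ℕ) {φ : Space n → ℂ}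
    (hφ : ContDiffOn ℝ ∞ φ {0}ᶜ) : ofSmooth φ hφ ∈ indSpace n z τ e N :=
  mem_indSpace.2 fun M _ => polyD_mem_of_dvd (indPoly_zero_dvd z e M)
    (conormal_anti (by linarith) (polyD_indPoly_zero_ofSmooth z M hφ))

/-- The inductive step: if `ρ∂_ρ(ρ∂_ρ - z) w = a ρ∂_ρ w' + ρ u`, where `u` is as good as `w`, then
the weight of `w` is improved by the indicial operators. -/
theorem mem_indSpace_of_eq {z a : ℂ} {τ : ℝ} {e : ℕ} {w w' u : SmoothFn n}
    (hw : w ∈ conormal n τ) (hw' : ∀ N, w' ∈ indSpace n z τ e N)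
    (hu : ∀ N, w ∈ indSpace n z τ (e + 1) N → u ∈ indSpace n z τ (e + 1) N)
    (heq : opD n (opDsub n z w) = a • opD n w' + mulRho n u) (N : ℕ) :
    w ∈ indSpace n z τ (e + 1) N := by
  induction N with
  | zero =>
    refine mem_indSpace.2 fun M hM => ?_
    obtain rfl : M = 0 := by omega
    simpa [indPoly] using hw
  | succ N ih =>
    refine mem_indSpace.2 fun M hM => ?_
    rcases Nat.lt_or_ge N M with h | h
    · obtain rfl : M = N + 1 := by omega
      -- One factor `X` and one factor `X - z` are set aside to apply the equation; the rest acts on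
      -- its right-hand side.
      have e1 : indPoly z (e + 1) (N + 1) = (Polynomial.X - Polynomial.C z) ^ e *
          indPolyShift z (e + 1) N * (Polynomial.X * (Polynomial.X - Polynomial.C z)) := by
        rw [indPoly_succ]; ring
      have e2 : polyD n (Polynomial.X * (Polynomial.X - Polynomial.C z)) w =
          opD n (opDsub n z w) := by
        rw [polyD_mul_apply, polyD_X_sub_C]; simp [polyD]
      rw [e1, polyD_mul_apply, e2, heq, map_add, map_smul]
      refine add_mem (Submodule.smul_mem _ _ ?_) ?_
      -- The `D` in front of `w'` replaces the root `0` that was used up, so the root `0` is needed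
      -- only once although `e` grows.
      · have e3 : opD n w' = polyD n Polynomial.X w' := by simp [polyD]
        rw [e3, ← polyD_mul_apply]
        refine polyD_mem_of_dvd (P := indPoly z e (N + 1)) ?_
          (mem_indSpace.1 (hw' (N + 1)) (N + 1) le_rfl)
        rw [indPoly_succ]
        obtain ⟨P, hP⟩ := indPolyShift_dvd z e N
        exact ⟨P, by rw [hP]; ring⟩
      -- The shifted polynomial passes through `ρ` and becomes the polynomial of order `N` on `u`,
      -- covered by the induction hypothesis; `ρ` adds the last unit of weight.
      · rw [polyD_mul_apply, polyD_indPolyShift_mulRho]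
        refine polyD_mem_conormal ?_ _
        have := mulRho_mem_conormal (mem_indSpace.1 (hu N ih) N le_rfl)
        push_cast
        rwa [← add_assoc]
    · exact mem_indSpace.1 ih M h

/-! ### The roots of the indicial polynomials -/

/-- The roots `z + j`, `j < N`, each `e`-fold. -/
def rootBlock (z : ℂ) (e N : ℕ) : List ℂ :=
  (List.range N).flatMap fun j => List.replicate e (z + j)

theorem rootBlock_succ (z : ℂ) (e N : ℕ) :
    rootBlock z e (N + 1) = rootBlock z e N ++ List.replicate e (z + N) := by
  simp [rootBlock, List.range_succ]

open Classical in
theorem count_rootBlock (z : ℂ) (e N : ℕ) (y : ℂ) :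
    (rootBlock z e N).count y = if ∃ j < N, y = z + j then e else 0 := by
  induction N with
  | zero => simp [rootBlock]
  | succ N ih =>
    rw [rootBlock_succ, List.count_append, ih, List.count_replicate]
    by_cases h : y = z + N
    · subst h
      rw [if_neg, if_pos, if_pos]
      · simp
      · exact ⟨N, N.lt_succ_self, rfl⟩
      · simp
      · rintro ⟨j, hj, hje⟩
        have : N = j := by exact_mod_cast add_left_cancel hje
        omega
    · have h' : ¬ (z + N == y) = true := by simpa using fun h' => h h'.symm
      rw [if_neg h', add_zero]
      congr 1
      refine propext ⟨fun ⟨j, hj, hje⟩ => ⟨j, by omega, hje⟩, fun ⟨j, hj, hje⟩ => ⟨j, ?_, hje⟩⟩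
      rcases Nat.lt_succ_iff_lt_or_eq.1 hj with hj | rfl
      · exact hj
      · exact absurd hje h

/-- The roots of the indicial polynomial. -/
def indRoots (z : ℂ) (e N : ℕ) : List ℂ := rootBlock 0 1 N ++ rootBlock z e N

theorem rootPoly_append (l l' : List ℂ) : rootPoly (l ++ l') = rootPoly l * rootPoly l' := by
  simp [rootPoly]

theorem rootPoly_indRoots (z : ℂ) (e N : ℕ) : rootPoly (indRoots z e N) = indPoly z e N := by
  induction N with
  | zero => simp [indRoots, rootBlock, rootPoly, indPoly]
  | succ N ih =>
    rw [indPoly, Finset.prod_range_succ, ← indPoly, ← ih, indRoots, indRoots, rootBlock_succ,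
      rootBlock_succ]
    simp only [rootPoly_append]
    simp [rootPoly]
    ring

theorem count_indRoots_mono (z : ℂ) (e : ℕ) {N M : ℕ} (h : N ≤ M) (y : ℂ) :
    (indRoots z e N).count y ≤ (indRoots z e M).count y := by
  classical
  have key : ∀ (z : ℂ) (e : ℕ), (rootBlock z e N).count y ≤ (rootBlock z e M).count y := by
    intro z e
    rw [count_rootBlock, count_rootBlock]
    split_ifs with h1 h2
    · exact le_rfl
    · obtain ⟨j, hj, hje⟩ := h1
      exact absurd ⟨j, hj.trans_le h, hje⟩ h2
    · exact Nat.zero_le _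
    · exact le_rfl
  rw [indRoots, indRoots, List.count_append, List.count_append]
  exact add_le_add (key _ _) (key _ _)

/-- The third alternative is the coincidence of the two families of roots, where the multiplicity is
`e + 1`. It is the only source of an additional logarithm. -/
theorem lt_count_indRoots {z : ℂ} {e N : ℕ} {y : ℂ} {k : ℕ} (h : k < (indRoots z e N).count y) :
    (k = 0 ∧ ∃ j : ℕ, y = j) ∨ (k < e ∧ ∃ j : ℕ, y = z + j) ∨
      (k = e ∧ (∃ j : ℕ, y = j) ∧ ∃ j : ℕ, y = z + j) := by
  classical
  rw [indRoots, List.count_append, count_rootBlock, count_rootBlock] at h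
  simp only [zero_add] at h
  split_ifs at h with h1 h2 h2
  · obtain ⟨i, -, hi⟩ := h1
    obtain ⟨j, -, hj⟩ := h2
    rcases Nat.lt_or_ge k e with hk | hk
    · exact Or.inr (Or.inl ⟨hk, j, hj⟩)
    · exact Or.inr (Or.inr ⟨by omega, ⟨i, hi⟩, j, hj⟩)
  · obtain ⟨i, -, hi⟩ := h1
    exact Or.inl ⟨by omega, i, hi⟩
  · obtain ⟨j, -, hj⟩ := h2
    exact Or.inr (Or.inl ⟨by omega, j, hj⟩)
  · omega

/-! ### Integrals over the sphere -/

/-- The surface measure of the unit sphere. -/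
abbrev surfaceMeasure (n : ℕ) : MeasureTheory.Measure (Sphere n) :=
  (MeasureTheory.volume : MeasureTheory.Measure (Space n)).toSphere

/-- The integral `∫ a(θ) f(x · θ) dθ` over the unit sphere. -/
def sphereInt (a : Space n → ℂ) (f : ℝ → ℂ) (x : Space n) : ℂ :=
  ∫ θ : Sphere n, a θ * f (inner ℝ x (θ : Space n)) ∂(surfaceMeasure n)

theorem sphere_ne_zero (θ : Sphere n) : (θ : Space n) ≠ 0 := by
  intro h
  simpa [h] using mem_sphere_zero_iff_norm.1 θ.2

theorem continuous_of_contDiffOn {G : Type*} [NormedAddCommGroup G] [NormedSpace ℝ G]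
    {a : Space n → G} (ha : ContDiffOn ℝ ∞ a {0}ᶜ) :
    Continuous fun θ : Sphere n => a θ :=
  ha.continuousOn.comp_continuous continuous_subtype_val sphere_ne_zero

theorem integrable_sphere {G : Type*} [NormedAddCommGroup G] {g : Sphere n → G}
    (hg : Continuous g) : MeasureTheory.Integrable g (surfaceMeasure n) :=
  hg.integrable_of_hasCompactSupport (HasCompactSupport.of_compactSpace g)

theorem continuous_sphereInt_integrand {a : Space n → ℂ} (ha : ContDiffOn ℝ ∞ a {0}ᶜ) {f : ℝ → ℂ}
    {I : Set ℝ} (hf : ContinuousOn f I) {x : Space n}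
    (hx : ∀ θ : Sphere n, inner ℝ x (θ : Space n) ∈ I) :
    Continuous fun θ : Sphere n => a θ * f (inner ℝ x (θ : Space n)) :=
  (continuous_of_contDiffOn ha).mul
    (hf.comp_continuous (continuous_const.inner continuous_subtype_val) hx)

section Derivatives

variable {I : Set ℝ} {W : Set (Space n)}

theorem contDiffOn_deriv (hI : IsOpen I) {f : ℝ → ℂ} (hf : ContDiffOn ℝ ∞ f I) :
    ContDiffOn ℝ ∞ (deriv f) I :=
  ((contDiffOn_infty_iff_deriv_of_isOpen hI).1 hf).2

theorem contDiffOn_inner_mul {a : Space n → ℂ} (ha : ContDiffOn ℝ ∞ a {0}ᶜ) (v : Space n) :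
    ContDiffOn ℝ ∞ (fun θ => ((inner ℝ v θ : ℝ) : ℂ) * a θ) {0}ᶜ :=
  (Complex.ofRealCLM.contDiff.comp (contDiff_const.inner ℝ contDiff_id)).contDiffOn.mul ha

theorem hasFDerivAt_sphereInt (hI : IsOpen I) (hW : IsOpen W)
    (hWI : ∀ x ∈ W, ∀ θ : Sphere n, inner ℝ x (θ : Space n) ∈ I)
    {a : Space n → ℂ} (ha : ContDiffOn ℝ ∞ a {0}ᶜ) {f : ℝ → ℂ} (hf : ContDiffOn ℝ ∞ f I)
    {x : Space n} (hx : x ∈ W) :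
    ∃ T : Space n →L[ℝ] ℂ, HasFDerivAt (sphereInt a f) T x ∧
      ∀ v, T v = sphereInt (fun θ => ((inner ℝ v θ : ℝ) : ℂ) * a θ) (deriv f) x := by
  obtain ⟨ε, hε, hball⟩ := Metric.nhds_basis_closedBall.mem_iff.1 (hW.mem_nhds hx)
  have hd := contDiffOn_deriv hI hf
  obtain ⟨A, hA⟩ := (isCompact_univ (X := Sphere n)).exists_bound_of_continuousOn
    (continuous_of_contDiffOn ha).continuousOn
  have hK : IsCompact (Metric.closedBall x ε ×ˢ (Set.univ : Set (Sphere n))) :=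
    (isCompact_closedBall x ε).prod isCompact_univ
  obtain ⟨B, hB⟩ := hK.exists_bound_of_continuousOn
    (f := fun p => deriv f (inner ℝ p.1 (p.2 : Space n)))
    (hd.continuousOn.comp (by fun_prop) fun p hp => hWI _ (hball hp.1) _)
  set F' : Space n → Sphere n → Space n →L[ℝ] ℂ := fun y θ =>
    (innerSL ℝ (θ : Space n)).smulRight (a θ * deriv f (inner ℝ y (θ : Space n)))
  have hF' : ∀ y ∈ W, Continuous (F' y) := fun y hy => by
    have := continuous_sphereInt_integrand ha hd.continuousOn (hWI y hy)
    exact ((ContinuousLinearMap.smulRightL ℝ (Space n) ℂ).continuous₂).comp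
      (((innerSL ℝ).continuous.comp continuous_subtype_val).prodMk this)
  have h := hasFDerivAt_integral_of_dominated_of_fderiv_le (𝕜 := ℝ) (μ := surfaceMeasure n)
    (F := fun y θ => a θ * f (inner ℝ y (θ : Space n))) (F' := F') (x₀ := x)
    (bound := fun _ => |A| * |B|) (s := Metric.closedBall x ε)
    (Metric.closedBall_mem_nhds x hε)
    (Filter.eventually_of_mem (hW.mem_nhds hx) fun y hy =>
      (integrable_sphere (continuous_sphereInt_integrand ha hf.continuousOn
        (hWI y hy))).aestronglyMeasurable)
    (integrable_sphere (continuous_sphereInt_integrand ha hf.continuousOn (hWI x hx)))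
    (integrable_sphere (hF' x hx)).aestronglyMeasurable
    (Filter.Eventually.of_forall fun θ y hy => by
      rw [ContinuousLinearMap.norm_smulRight_apply, innerSL_apply_norm,
        mem_sphere_zero_iff_norm.1 θ.2, one_mul, norm_mul]
      exact mul_le_mul ((hA θ (Set.mem_univ _)).trans (le_abs_self A))
        ((hB (y, θ) ⟨hy, Set.mem_univ _⟩).trans (le_abs_self B)) (norm_nonneg _) (abs_nonneg _))
    (MeasureTheory.integrable_const _)
    (Filter.Eventually.of_forall fun θ y hy => by
      have h1 : HasDerivAt f (deriv f (inner ℝ y (θ : Space n))) (inner ℝ y (θ : Space n)) :=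
        ((hf.contDiffAt (hI.mem_nhds (hWI y (hball hy) θ))).differentiableAt
          (by simp)).hasDerivAt
      have h2 : HasFDerivAt (fun y : Space n => (inner ℝ y (θ : Space n) : ℝ))
          (innerSL ℝ (θ : Space n)) y := by
        have := (innerSL ℝ (θ : Space n)).hasFDerivAt (x := y)
        refine this.congr_of_eventuallyEq (Filter.Eventually.of_forall fun y => ?_)
        rw [innerSL_apply_apply, real_inner_comm]
      have h3 := (h1.hasFDerivAt.comp y h2).const_mul (a θ)
      refine h3.congr_fderiv (ContinuousLinearMap.ext fun v => ?_)
      simp [F']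
      ring)
  refine ⟨_, h, fun v => ?_⟩
  rw [ContinuousLinearMap.integral_apply (integrable_sphere (hF' x hx))]
  refine MeasureTheory.integral_congr_ae (Filter.Eventually.of_forall fun θ => ?_)
  simp only [F', ContinuousLinearMap.smulRight_apply, innerSL_apply_apply, Complex.real_smul]
  rw [real_inner_comm, mul_assoc]

theorem fderiv_sphereInt (hI : IsOpen I) (hW : IsOpen W)
    (hWI : ∀ x ∈ W, ∀ θ : Sphere n, inner ℝ x (θ : Space n) ∈ I)
    {a : Space n → ℂ} (ha : ContDiffOn ℝ ∞ a {0}ᶜ) {f : ℝ → ℂ} (hf : ContDiffOn ℝ ∞ f I)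
    {x : Space n} (hx : x ∈ W) (v : Space n) :
    fderiv ℝ (sphereInt a f) x v =
      sphereInt (fun θ => ((inner ℝ v θ : ℝ) : ℂ) * a θ) (deriv f) x := by
  obtain ⟨T, hT, hTv⟩ := hasFDerivAt_sphereInt hI hW hWI ha hf hx
  rw [hT.fderiv, hTv]

theorem contDiffOn_sphereInt (hI : IsOpen I) (hW : IsOpen W)
    (hWI : ∀ x ∈ W, ∀ θ : Sphere n, inner ℝ x (θ : Space n) ∈ I)
    {a : Space n → ℂ} (ha : ContDiffOn ℝ ∞ a {0}ᶜ) {f : ℝ → ℂ} (hf : ContDiffOn ℝ ∞ f I) :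
    ContDiffOn ℝ ∞ (sphereInt a f) W := by
  rw [contDiffOn_infty]
  intro m
  induction m generalizing a f with
  | zero =>
    refine contDiffOn_zero.2 fun x hx => ?_
    obtain ⟨T, hT, -⟩ := hasFDerivAt_sphereInt hI hW hWI ha hf hx
    exact hT.continuousAt.continuousWithinAt
  | succ m ih =>
    push_cast
    rw [contDiffOn_succ_iff_fderiv_of_isOpen hW]
    refine ⟨fun x hx => ?_, by simp, ?_⟩
    · obtain ⟨T, hT, -⟩ := hasFDerivAt_sphereInt hI hW hWI ha hf hx
      exact hT.differentiableAt.differentiableWithinAt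
    · rw [contDiffOn_clm_apply]
      exact fun v => (ih (contDiffOn_inner_mul ha v) (contDiffOn_deriv hI hf)).congr
        fun x hx => fderiv_sphereInt hI hW hWI ha hf hx v

end Derivatives

/-! ### Rotations -/

/-- The rotation in the plane of two distinct coordinates as a linear isometry. -/
def rotIsometry {i j : Fin n} (hij : i ≠ j) (t : ℝ) : Space n ≃ₗᵢ[ℝ] Space n :=
  LinearIsometry.toLinearIsometryEquiv
    { toFun := rot i j t
      map_add' := fun x y => by
        simp only [rot, map_add, PiLp.add_apply, add_smul, smul_add]; abel
      map_smul' := fun c x => by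
        simp only [rot, map_smul, PiLp.smul_apply, smul_eq_mul, smul_add, mul_smul,
          RingHom.id_apply, smul_comm c]
      norm_map' := norm_rot hij t } rfl

theorem isometry_mem_sphere (T : Space n ≃ₗᵢ[ℝ] Space n) (θ : Sphere n) :
    T (θ : Space n) ∈ Metric.sphere (0 : Space n) 1 := by
  rw [mem_sphere_zero_iff_norm, T.norm_map, mem_sphere_zero_iff_norm.1 θ.2]

/-- The action of a linear isometry on the unit sphere. -/
def sphereEquiv (T : Space n ≃ₗᵢ[ℝ] Space n) : Sphere n ≃ₜ Sphere n where
  toFun θ := ⟨T θ, isometry_mem_sphere T θ⟩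
  invFun θ := ⟨T.symm θ, isometry_mem_sphere T.symm θ⟩
  left_inv _ := Subtype.ext (T.symm_apply_apply _)
  right_inv _ := Subtype.ext (T.apply_symm_apply _)
  continuous_toFun := (T.continuous.comp continuous_subtype_val).subtype_mk _
  continuous_invFun := (T.symm.continuous.comp continuous_subtype_val).subtype_mk _

open Pointwise in
-- The surface measure of a set is a constant times the volume of the cone over it, and a linear
-- isometry preserves cones and volume.
theorem measurePreserving_sphereEquiv (T : Space n ≃ₗᵢ[ℝ] Space n) :
    MeasureTheory.MeasurePreserving (sphereEquiv T) (surfaceMeasure n) (surfaceMeasure n) := by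
  refine ⟨(sphereEquiv T).continuous.measurable, ?_⟩
  ext s hs
  rw [MeasureTheory.Measure.map_apply (sphereEquiv T).continuous.measurable hs,
    MeasureTheory.Measure.toSphere_apply' _ hs, MeasureTheory.Measure.toSphere_apply' _
      ((sphereEquiv T).continuous.measurable hs)]
  congr 1
  have h : Set.Ioo (0 : ℝ) 1 • ((↑) '' (sphereEquiv T ⁻¹' s) : Set (Space n)) =
      T ⁻¹' (Set.Ioo (0 : ℝ) 1 • ((↑) '' s : Set (Space n))) := by
    ext x
    simp only [Set.mem_smul, Set.mem_image, Set.mem_preimage]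
    constructor
    · rintro ⟨r, hr, _, ⟨θ, hθ, rfl⟩, rfl⟩
      exact ⟨r, hr, _, ⟨_, hθ, rfl⟩, (map_smul T r (θ : Space n)).symm⟩
    · rintro ⟨r, hr, _, ⟨θ, hθ, rfl⟩, hx⟩
      refine ⟨r, hr, _, ⟨(sphereEquiv T).symm θ, by simpa using hθ, rfl⟩, ?_⟩
      have : T.symm (r • (θ : Space n)) = x := by rw [hx, T.symm_apply_apply]
      rw [← this, map_smul]
      rfl
  rw [h]
  exact T.measurePreserving.measure_preimage_emb T.toHomeomorph.measurableEmbedding _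

theorem sphereInt_isometry (T : Space n ≃ₗᵢ[ℝ] Space n) (a : Space n → ℂ) (f : ℝ → ℂ)
    (x : Space n) : sphereInt a f (T x) = sphereInt (fun θ => a (T θ)) f x := by
  have h := (measurePreserving_sphereEquiv T).integral_comp
    (sphereEquiv T).measurableEmbedding
    (fun θ : Sphere n => a θ * f (inner ℝ (T x) (θ : Space n)))
  rw [sphereInt, ← h]
  refine MeasureTheory.integral_congr_ae (Filter.Eventually.of_forall fun θ => ?_)
  have : inner ℝ (T x) (T (θ : Space n)) = inner ℝ x (θ : Space n) := T.inner_map_map _ _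
  simp only [sphereEquiv, Homeomorph.homeomorph_mk_coe, Equiv.coe_fn_mk, this]

theorem contDiffOn_fderiv_rotField {a : Space n → ℂ} (ha : ContDiffOn ℝ ∞ a {0}ᶜ) (i j : Fin n) :
    ContDiffOn ℝ ∞ (fun θ => fderiv ℝ a θ (rotField i j θ)) {0}ᶜ :=
  contDiffOn_fderiv_apply ha (rotField i j).contDiff.contDiffOn

theorem continuous_rot (i j : Fin n) {X : Type*} [TopologicalSpace X] {r : X → ℝ}
    {y : X → Space n} (hr : Continuous r) (hy : Continuous y) :
    Continuous fun p => rot i j (r p) (y p) := by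
  have h : ∀ i : Fin n, Continuous fun p => y p i := fun i =>
    (EuclideanSpace.proj (𝕜 := ℝ) i : Space n →L[ℝ] ℝ).continuous.comp hy
  exact (hy.add (((Real.continuous_cos.comp hr).sub continuous_const).smul
    (((h i).smul continuous_const).add ((h j).smul continuous_const)))).add
    ((Real.continuous_sin.comp hr).smul ((rotField i j).continuous.comp hy))

theorem continuous_rotVel (i j : Fin n) {X : Type*} [TopologicalSpace X] {r : X → ℝ}
    {y : X → Space n} (hr : Continuous r) (hy : Continuous y) :
    Continuous fun p => rotVel i j (r p) (y p) := by
  have h : ∀ i : Fin n, Continuous fun p => y p i := fun i =>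
    (EuclideanSpace.proj (𝕜 := ℝ) i : Space n →L[ℝ] ℝ).continuous.comp hy
  exact ((Real.continuous_sin.comp hr).neg.smul
    (((h i).smul continuous_const).add ((h j).smul continuous_const))).add
    ((Real.continuous_cos.comp hr).smul ((rotField i j).continuous.comp hy))

/-- Rotating `x` amounts to rotating the argument of `a`, by invariance of the surface measure. The
derivative thus falls on the smooth `a` and never on the singular profile, so angular derivatives
cost no power of `ρ`. -/
theorem fderiv_sphereInt_rotField {I : Set ℝ} {W : Set (Space n)} (hI : IsOpen I) (hW : IsOpen W)
    (hWI : ∀ x ∈ W, ∀ θ : Sphere n, inner ℝ x (θ : Space n) ∈ I)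
    {a : Space n → ℂ} (ha : ContDiffOn ℝ ∞ a {0}ᶜ) {f : ℝ → ℂ} (hf : ContDiffOn ℝ ∞ f I)
    {x : Space n} (hx : x ∈ W) (i j : Fin n) :
    fderiv ℝ (sphereInt a f) x (rotField i j x) =
      sphereInt (fun θ => fderiv ℝ a θ (rotField i j θ)) f x := by
  rcases eq_or_ne i j with rfl | hij
  · simp [rotField_self, sphereInt]
  obtain ⟨T, hT, -⟩ := hasFDerivAt_sphereInt hI hW hWI ha hf hx
  have hT' : HasFDerivAt (sphereInt a f) T (rot i j 0 x) := by rwa [rot_zero]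
  have h1 := hT'.comp_hasDerivAt (0 : ℝ) (hasDerivAt_rot_zero i j x)
  rw [hT.fderiv]
  have hne : ∀ t (θ : Sphere n), rot i j t (θ : Space n) ∈ ({0}ᶜ : Set (Space n)) := by
    intro t θ h
    have := norm_rot hij t (θ : Space n)
    rw [Set.mem_singleton_iff.1 h, norm_zero, mem_sphere_zero_iff_norm.1 θ.2] at this
    exact zero_ne_one this
  have hda : ContinuousOn (fderiv ℝ a) {0}ᶜ :=
    ((contDiffOn_infty_iff_fderiv_of_isOpen isOpen_compl_zero).1 ha).2.continuousOn
  have hc : Continuous fun p : ℝ × Sphere n =>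
      fderiv ℝ a (rot i j p.1 (p.2 : Space n)) (rotVel i j p.1 (p.2 : Space n)) := by
    have e : Continuous fun p : ℝ × Sphere n => (p.2 : Space n) :=
      continuous_subtype_val.comp continuous_snd
    have h1 := continuous_rot i j (continuous_fst (X := ℝ) (Y := Sphere n)) e
    have h2 := continuous_rotVel i j (continuous_fst (X := ℝ) (Y := Sphere n)) e
    have h3 : Continuous fun p : ℝ × Sphere n => fderiv ℝ a (rot i j p.1 (p.2 : Space n)) :=
      hda.comp_continuous h1 fun p => hne p.1 p.2
    exact h3.clm_apply h2
  have hfc : Continuous fun θ : Sphere n => f (inner ℝ x (θ : Space n)) :=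
    hf.continuousOn.comp_continuous (continuous_const.inner continuous_subtype_val) (hWI x hx)
  have hac : ∀ t, Continuous fun θ : Sphere n => a (rot i j t θ) := fun t =>
    ha.continuousOn.comp_continuous (continuous_rot i j continuous_const
      continuous_subtype_val) (hne t)
  obtain ⟨A, hA⟩ := ((isCompact_closedBall (0 : ℝ) 1).prod
    (isCompact_univ (X := Sphere n))).exists_bound_of_continuousOn hc.continuousOn
  have hbound : ∀ (θ : Sphere n), ∀ t ∈ Metric.closedBall (0 : ℝ) 1,
      ‖fderiv ℝ a (rot i j t θ) (rotVel i j t θ) * f (inner ℝ x (θ : Space n))‖ ≤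
        |A| * ‖f (inner ℝ x (θ : Space n))‖ := fun θ t ht => by
    rw [norm_mul]
    exact mul_le_mul_of_nonneg_right
      ((hA (t, θ) ⟨ht, Set.mem_univ _⟩).trans (le_abs_self A)) (norm_nonneg _)
  have hderiv : ∀ (θ : Sphere n) (t : ℝ), HasDerivAt
      (fun t => a (rot i j t θ) * f (inner ℝ x (θ : Space n)))
      (fderiv ℝ a (rot i j t θ) (rotVel i j t θ) * f (inner ℝ x (θ : Space n))) t := fun θ t =>
    (((ha.contDiffAt (isOpen_compl_zero.mem_nhds (hne t θ))).differentiableAt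
      (by simp)).hasFDerivAt.comp_hasDerivAt t (hasDerivAt_rot i j t (θ : Space n))).mul_const _
  have h2 := (hasDerivAt_integral_of_dominated_loc_of_deriv_le (μ := surfaceMeasure n)
    (F := fun t (θ : Sphere n) => a (rot i j t θ) * f (inner ℝ x (θ : Space n)))
    (F' := fun t (θ : Sphere n) => fderiv ℝ a (rot i j t θ) (rotVel i j t θ) *
      f (inner ℝ x (θ : Space n))) (x₀ := (0 : ℝ)) (s := Metric.closedBall 0 1)
    (bound := fun θ => |A| * ‖f (inner ℝ x (θ : Space n))‖)
    (Metric.closedBall_mem_nhds _ one_pos)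
    (Filter.Eventually.of_forall fun t =>
      (integrable_sphere ((hac t).mul hfc)).aestronglyMeasurable)
    (integrable_sphere ((hac 0).mul hfc))
    (integrable_sphere ((hc.comp (continuous_const.prodMk continuous_id)).mul
      hfc)).aestronglyMeasurable
    (Filter.Eventually.of_forall hbound)
    (integrable_sphere (continuous_const.mul hfc.norm))
    (Filter.Eventually.of_forall fun θ t _ => hderiv θ t)).2
  have h3 : (sphereInt a f ∘ fun t => rot i j t x) = fun t =>
      ∫ θ : Sphere n, a (rot i j t θ) * f (inner ℝ x (θ : Space n)) ∂(surfaceMeasure n) := by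
    funext t
    exact sphereInt_isometry (rotIsometry hij t) a f x
  rw [h3] at h1
  rw [h1.unique h2, sphereInt]
  refine MeasureTheory.integral_congr_ae (Filter.Eventually.of_forall fun θ => ?_)
  simp only [rot_zero, rotVel_zero]

/-! ### Superpositions of plane waves on the collar -/

/-- The open interval `(-1, 1)`. -/
abbrev openI : Set ℝ := Set.Ioo (-1) 1

theorem abs_inner_le (x : Space n) (θ : Sphere n) : |inner ℝ x (θ : Space n)| ≤ ‖x‖ := by
  have := abs_real_inner_le_norm x (θ : Space n)
  rwa [mem_sphere_zero_iff_norm.1 θ.2, mul_one] at this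

theorem inner_mem_openI {x : Space n} (hx : x ∈ Metric.ball (0 : Space n) 1) (θ : Sphere n) :
    inner ℝ x (θ : Space n) ∈ openI :=
  abs_lt.1 ((abs_inner_le x θ).trans_lt (by simpa using hx))

theorem collarHalf_subset_ball : collarHalf n ⊆ Metric.ball 0 1 := by
  intro x hx
  have := bdf_pos hx
  rw [bdf] at this
  rw [mem_ball_zero_iff]
  nlinarith [norm_nonneg x]

section Linear

variable {a : Space n → ℂ} {f g : ℝ → ℂ} {x : Space n}

theorem sphereInt_add (ha : ContDiffOn ℝ ∞ a {0}ᶜ) (hf : ContinuousOn f openI)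
    (hg : ContinuousOn g openI) (hx : x ∈ Metric.ball (0 : Space n) 1) :
    sphereInt a (fun s => f s + g s) x = sphereInt a f x + sphereInt a g x := by
  rw [sphereInt, sphereInt, sphereInt, ← MeasureTheory.integral_add
    (integrable_sphere (continuous_sphereInt_integrand ha hf (inner_mem_openI hx)))
    (integrable_sphere (continuous_sphereInt_integrand ha hg (inner_mem_openI hx)))]
  simp only [mul_add]

theorem sphereInt_const_mul (c : ℂ) :
    sphereInt a (fun s => c * f s) x = c * sphereInt a f x := by
  rw [sphereInt, sphereInt, ← MeasureTheory.integral_const_mul]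
  simp only [mul_left_comm]

theorem sphereInt_congr (h : ∀ s ∈ openI, f s = g s) (hx : x ∈ Metric.ball (0 : Space n) 1) :
    sphereInt a f x = sphereInt a g x := by
  rw [sphereInt, sphereInt]
  simp only [h _ (inner_mem_openI hx _)]

end Linear

theorem contDiffOn_sphereInt_ball {a : Space n → ℂ} (ha : ContDiffOn ℝ ∞ a {0}ᶜ) {f : ℝ → ℂ}
    (hf : ContDiffOn ℝ ∞ f openI) : ContDiffOn ℝ ∞ (sphereInt a f) (Metric.ball 0 1) :=
  contDiffOn_sphereInt isOpen_Ioo Metric.isOpen_ball (fun _ hx => inner_mem_openI hx) ha hf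

/-- The function `x ↦ ∫ a(θ) f(x · θ) dθ` on the collar. -/
def ridge {a : Space n → ℂ} (ha : ContDiffOn ℝ ∞ a {0}ᶜ) {f : ℝ → ℂ}
    (hf : ContDiffOn ℝ ∞ f openI) : SmoothFn n :=
  ofFun (sphereInt a f) ((contDiffOn_sphereInt_ball ha hf).mono collarHalf_subset_ball)

section Ridge

variable {a : Space n → ℂ} (ha : ContDiffOn ℝ ∞ a {0}ᶜ) {f : ℝ → ℂ} (hf : ContDiffOn ℝ ∞ f openI)

theorem ridge_apply {x : Space n} (hx : x ∈ collarHalf n) : ridge ha hf x = sphereInt a f x :=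
  ofFun_apply _ hx

theorem fderiv_ridge {x : Space n} (hx : x ∈ collarHalf n) :
    fderiv ℝ (ridge ha hf) x = fderiv ℝ (sphereInt a f) x := fderiv_ofFun _ hx

theorem fderiv_sphereInt_ball {a : Space n → ℂ} (ha : ContDiffOn ℝ ∞ a {0}ᶜ) {f : ℝ → ℂ}
    (hf : ContDiffOn ℝ ∞ f openI) {x : Space n}
    (hx : x ∈ Metric.ball (0 : Space n) 1) (v : Space n) :
    fderiv ℝ (sphereInt a f) x v =
      sphereInt (fun θ => ((inner ℝ v θ : ℝ) : ℂ) * a θ) (deriv f) x :=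
  fderiv_sphereInt isOpen_Ioo Metric.isOpen_ball (fun _ hx => inner_mem_openI hx) ha hf hx v

theorem opL_ridge (i j : Fin n) :
    opL i j (ridge ha hf) = ridge (contDiffOn_fderiv_rotField ha i j) hf := by
  ext x hx
  rw [op_apply _ _ hx, fderiv_ridge ha hf hx, ridge_apply _ _ hx]
  exact fderiv_sphereInt_rotField isOpen_Ioo Metric.isOpen_ball
    (fun _ hx => inner_mem_openI hx) ha hf (collarHalf_subset_ball hx) i j

/-! ### The radial derivative and the spherical Laplacian on plane waves. -/

/-- The function `s f'(s)`. -/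
def euler (f : ℝ → ℂ) (s : ℝ) : ℂ := (s : ℂ) * deriv f s

theorem contDiffOn_euler {f : ℝ → ℂ} (hf : ContDiffOn ℝ ∞ f openI) :
    ContDiffOn ℝ ∞ (euler f) openI :=
  Complex.ofRealCLM.contDiff.contDiffOn.mul (contDiffOn_deriv isOpen_Ioo hf)

theorem fderiv_sphereInt_self {a : Space n → ℂ} (ha : ContDiffOn ℝ ∞ a {0}ᶜ) {f : ℝ → ℂ}
    (hf : ContDiffOn ℝ ∞ f openI) {x : Space n}
    (hx : x ∈ Metric.ball (0 : Space n) 1) :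
    fderiv ℝ (sphereInt a f) x x = sphereInt a (euler f) x := by
  rw [fderiv_sphereInt_ball ha hf hx, sphereInt, sphereInt]
  refine MeasureTheory.integral_congr_ae (Filter.Eventually.of_forall fun θ => ?_)
  simp only [euler]
  ring

/-- The coefficient of the radial field. -/
def radialCoeff (x : Space n) : ℂ := ((-(bdf x / (2 * ‖x‖ ^ 2)) : ℝ) : ℂ)

theorem contDiffOn_radialCoeff : ContDiffOn ℝ ∞ (radialCoeff : Space n → ℂ) {0}ᶜ := by
  refine Complex.ofRealCLM.contDiff.comp_contDiffOn (ContDiffOn.neg (ContDiffOn.div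
    contDiff_bdf.contDiffOn (contDiffOn_const.mul (contDiff_norm_sq ℝ).contDiffOn) ?_))
  intro x hx
  have : ‖x‖ ≠ 0 := norm_ne_zero_iff.2 hx
  positivity

theorem opD_ridge : opD n (ridge ha hf) =
    pmul (ofSmooth radialCoeff contDiffOn_radialCoeff) (ridge ha (contDiffOn_euler hf)) := by
  ext x hx
  rw [op_apply _ _ hx, fderiv_ridge ha hf hx, pmul_apply, ofSmooth_apply _ hx, ridge_apply _ _ hx,
    genField, radialField, map_smul, fderiv_sphereInt_self ha hf (collarHalf_subset_ball hx),
    Complex.real_smul, radialCoeff]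

theorem radialCoeff_eq {x : Space n} :
    radialCoeff x = ((-(bdf x / (2 * (1 - bdf x))) : ℝ) : ℂ) := by
  rw [radialCoeff, normSq_eq]

theorem opD_radialCoeff {x : Space n} (hx : x ∈ collarHalf n) :
    opD n (ofSmooth radialCoeff contDiffOn_radialCoeff) x =
      ((-(bdf x / (2 * (1 - bdf x) ^ 2)) : ℝ) : ℂ) := by
  have h1 : (1 : ℝ) - bdf x ≠ 0 := by linarith [bdf_lt_half hx]
  have hd : HasDerivAt (fun r : ℝ => -(r / (2 * (1 - r)))) (-(1 / (2 * (1 - bdf x) ^ 2)))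
      (bdf x) := by
    have := ((hasDerivAt_id (bdf x)).div (((hasDerivAt_id (bdf x)).const_sub 1).const_mul 2)
      (by simpa using h1)).neg
    refine this.congr_deriv ?_
    simp only [id]
    field_simp
    ring
  have h2 := hd.ofReal_comp.hasFDerivAt.comp x (hasFDerivAt_bdf x)
  have h3 : (radialCoeff : Space n → ℂ) =
      (fun r : ℝ => ((-(r / (2 * (1 - r))) : ℝ) : ℂ)) ∘ bdf := by
    funext y; exact radialCoeff_eq
  rw [op_ofSmooth, ofSmooth_apply _ hx, h3, h2.fderiv]
  have h4 := fderiv_bdf_genField_none (ne_zero_of_mem_collarHalf hx)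
  rw [(hasFDerivAt_bdf x).fderiv] at h4
  rw [ContinuousLinearMap.comp_apply, h4]
  simp only [ContinuousLinearMap.toSpanSingleton_apply, Complex.real_smul]
  push_cast
  ring

theorem euler_euler {f : ℝ → ℂ} (hf : ContDiffOn ℝ ∞ f openI) {s : ℝ} (hs : s ∈ openI) :
    euler (euler f) s = euler f s + (s : ℂ) ^ 2 * deriv (deriv f) s := by
  have h1 : HasDerivAt (deriv f) (deriv (deriv f) s) s :=
    (((contDiffOn_deriv isOpen_Ioo hf).contDiffAt (isOpen_Ioo.mem_nhds hs)).differentiableAt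
      (by simp)).hasDerivAt
  have h2 : HasDerivAt (euler f) (1 * deriv f s + (s : ℂ) * deriv (deriv f) s) s :=
    (Complex.ofRealCLM.hasDerivAt (x := s)).mul h1
  have h3 : euler (euler f) s = (s : ℂ) * deriv (euler f) s := rfl
  rw [h3, h2.deriv, euler]
  ring

theorem contDiffOn_sq_deriv_deriv {f : ℝ → ℂ} (hf : ContDiffOn ℝ ∞ f openI) :
    ContDiffOn ℝ ∞ (fun s : ℝ => (s : ℂ) ^ 2 * deriv (deriv f) s) openI :=
  (Complex.ofRealCLM.contDiff.contDiffOn.pow 2).mul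
    (contDiffOn_deriv isOpen_Ioo (contDiffOn_deriv isOpen_Ioo hf))

theorem opD_ridge_apply {x : Space n} (hx : x ∈ collarHalf n) :
    opD n (ridge ha hf) x = -((bdf x : ℂ) / (2 * (1 - bdf x))) * sphereInt a (euler f) x := by
  rw [opD_ridge, pmul_apply, ofSmooth_apply _ hx, ridge_apply _ _ hx, radialCoeff_eq]
  push_cast
  ring

theorem opD_opD_ridge_apply {x : Space n} (hx : x ∈ collarHalf n) :
    opD n (opD n (ridge ha hf)) x =
      -((bdf x : ℂ) / (2 * (1 - bdf x) ^ 2)) * sphereInt a (euler f) x +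
        ((bdf x : ℂ) / (2 * (1 - bdf x))) ^ 2 * (sphereInt a (euler f) x +
          sphereInt a (fun s : ℝ => (s : ℂ) ^ 2 * deriv (deriv f) s) x) := by
  have hb := collarHalf_subset_ball hx
  have h1 : sphereInt a (euler (euler f)) x = sphereInt a (euler f) x +
      sphereInt a (fun s : ℝ => (s : ℂ) ^ 2 * deriv (deriv f) s) x := by
    rw [← sphereInt_add ha (contDiffOn_euler hf).continuousOn
      (contDiffOn_sq_deriv_deriv hf).continuousOn hb]
    exact sphereInt_congr (fun s hs => euler_euler hf hs) hb
  rw [opD_ridge, op_pmul, SmoothFn.add_apply, pmul_apply, pmul_apply, opD_radialCoeff hx,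
    ridge_apply _ _ hx, opD_ridge_apply _ _ hx, h1, ofSmooth_apply _ hx, radialCoeff_eq]
  push_cast
  ring

/-- Here, in contrast to `opL_ridge`, the derivatives are kept on the plane wave, so that the
Laplacian can be compared with `f'` and `f''`. The first order term comes from differentiating the
rotation field along itself. -/
theorem opL_opL_ridge_apply (i j : Fin n) {x : Space n} (hx : x ∈ collarHalf n) :
    opL i j (opL i j (ridge ha hf)) x = ∫ θ : Sphere n, a θ *
      ((((inner ℝ (rotField i j x) (θ : Space n)) ^ 2 : ℝ) : ℂ) *
          deriv (deriv f) (inner ℝ x (θ : Space n)) +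
        ((inner ℝ (rotField i j (rotField i j x)) (θ : Space n) : ℝ) : ℂ) *
          deriv f (inner ℝ x (θ : Space n))) ∂(surfaceMeasure n) := by
  have hb := collarHalf_subset_ball hx
  have hn : collarHalf n ∈ nhds x := (isOpen_collar _).mem_nhds hx
  have hf' := contDiffOn_deriv isOpen_Ioo hf
  have h0 : opL i j (opL i j (ridge ha hf)) x =
      fderiv ℝ (fderiv ℝ (ridge ha hf)) x (rotField i j x) (rotField i j x) +
        fderiv ℝ (ridge ha hf) x (rotField i j (rotField i j x)) := by
    have := vder_vder_apply ((contDiffOn_genField (some (i, j))).mono collarHalf_subset)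
      ((contDiffOn_genField (some (i, j))).mono collarHalf_subset) (ridge ha hf) hx
    rw [opL, op, this]
    simp only [genField, (rotField i j).fderiv]
  have h1 : ∀ v, fderiv ℝ (fderiv ℝ (ridge ha hf)) x v v =
      sphereInt (fun θ => ((inner ℝ v θ : ℝ) : ℂ) * (((inner ℝ v θ : ℝ) : ℂ) * a θ))
        (deriv (deriv f)) x := by
    intro v
    have hd : DifferentiableAt ℝ (fderiv ℝ (ridge ha hf)) x :=
      ((ridge ha hf).contDiffOn_fderiv.contDiffAt hn).differentiableAt (by simp)
    have h2 : fderiv ℝ (fun y => fderiv ℝ (ridge ha hf) y v) x v =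
        fderiv ℝ (fderiv ℝ (ridge ha hf)) x v v := by
      rw [fderiv_clm_apply hd (differentiableAt_const v)]
      simp
    have h3 : (fun y => fderiv ℝ (ridge ha hf) y v) =ᶠ[nhds x]
        sphereInt (fun θ => ((inner ℝ v θ : ℝ) : ℂ) * a θ) (deriv f) :=
      Filter.eventuallyEq_of_mem hn fun y hy => by
        simp only [fderiv_ridge ha hf hy,
          fderiv_sphereInt_ball ha hf (collarHalf_subset_ball hy)]
    rw [← h2, h3.fderiv_eq, fderiv_sphereInt_ball (contDiffOn_inner_mul ha v) hf' hb]
  rw [h0, h1, fderiv_ridge ha hf hx, fderiv_sphereInt_ball ha hf hb, sphereInt, sphereInt,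
    ← MeasureTheory.integral_add
      (integrable_sphere (continuous_sphereInt_integrand (contDiffOn_inner_mul
        (contDiffOn_inner_mul ha _) _) (contDiffOn_deriv isOpen_Ioo hf').continuousOn
          (inner_mem_openI hb)))
      (integrable_sphere (continuous_sphereInt_integrand (contDiffOn_inner_mul ha _)
        hf'.continuousOn (inner_mem_openI hb)))]
  refine MeasureTheory.integral_congr_ae (Filter.Eventually.of_forall fun θ => ?_)
  simp only
  push_cast
  ring

/-- Lagrange's identity; the factor `2` appears because ordered pairs `(i, j)` are summed. -/
theorem sum_inner_rotField_sq (x y : Space n) :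
    ∑ i, ∑ j, inner ℝ (rotField i j x) y ^ 2 = 2 * (‖x‖ ^ 2 * ‖y‖ ^ 2 - inner ℝ x y ^ 2) := by
  have hx : ‖x‖ ^ 2 = ∑ i, x i ^ 2 := by rw [EuclideanSpace.norm_sq_eq]; simp
  have hy : ‖y‖ ^ 2 = ∑ i, y i ^ 2 := by rw [EuclideanSpace.norm_sq_eq]; simp
  have hi : (inner ℝ x y : ℝ) = ∑ j, x j * y j := by simp [PiLp.inner_apply, mul_comm]
  have e : ∀ i j : Fin n, inner ℝ (rotField i j x) y ^ 2 =
      x i ^ 2 * y j ^ 2 + y i ^ 2 * x j ^ 2 - 2 * ((x i * y i) * (x j * y j)) := fun i j => by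
    rw [inner_rotField]; ring
  simp only [e, Finset.sum_sub_distrib, Finset.sum_add_distrib, ← Finset.mul_sum,
    ← Finset.sum_mul]
  rw [hx, hy, hi]
  ring

/-- The squares of the rotation generators sum to `-2(n-1)` times the identity. This is where the
dimension enters the indicial root `(n-1)/2 + γ`. -/
theorem sum_inner_rotField_rotField (x y : Space n) :
    ∑ i, ∑ j, inner ℝ (rotField i j (rotField i j x)) y = -(2 * ((n : ℝ) - 1) * inner ℝ x y) := by
  have hi : (inner ℝ x y : ℝ) = ∑ j, x j * y j := by simp [PiLp.inner_apply, mul_comm]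
  have e : ∀ i j : Fin n, inner ℝ (rotField i j (rotField i j x)) y =
      (if i = j then 2 * (x i * y i) else 0) - x j * y j - x i * y i := fun i j => by
    rw [inner_rotField]
    simp only [rotField_apply, PiLp.sub_apply, PiLp.smul_apply, PiLp.single_apply, smul_eq_mul]
    by_cases h : i = j
    · subst h; simp; ring
    · simp [h, Ne.symm h]
  simp only [e, Finset.sum_sub_distrib, Finset.sum_ite_eq, Finset.mem_univ, if_true,
    ← Finset.mul_sum, Finset.sum_const, Finset.card_univ, Fintype.card_fin, nsmul_eq_mul, ← hi]
  have h : ∑ i, x i * ((n : ℝ) * y i) = n * inner ℝ x y := by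
    rw [hi, Finset.mul_sum]
    exact Finset.sum_congr rfl fun i _ => by ring
  rw [h]
  ring

/-- Twice the Laplacian of the unit sphere, acting in the angular variables. -/
def angLap (n : ℕ) (w : SmoothFn n) : SmoothFn n := ∑ i, ∑ j, opL i j (opL i j w)

theorem angLap_ridge_apply {x : Space n} (hx : x ∈ collarHalf n) :
    angLap n (ridge ha hf) x = 2 * ((1 - bdf x) * sphereInt a (deriv (deriv f)) x -
      sphereInt a (fun s : ℝ => (s : ℂ) ^ 2 * deriv (deriv f) s) x -
        ((n : ℂ) - 1) * sphereInt a (euler f) x) := by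
  have hb := collarHalf_subset_ball hx
  have hf1 := contDiffOn_deriv isOpen_Ioo hf
  have hf2 := contDiffOn_deriv isOpen_Ioo hf1
  have hf3 := contDiffOn_sq_deriv_deriv hf
  have hf4 := contDiffOn_euler hf
  have hcont : ∀ i j : Fin n, Continuous fun θ : Sphere n => a θ *
      ((((inner ℝ (rotField i j x) (θ : Space n)) ^ 2 : ℝ) : ℂ) *
          deriv (deriv f) (inner ℝ x (θ : Space n)) +
        ((inner ℝ (rotField i j (rotField i j x)) (θ : Space n) : ℝ) : ℂ) *
          deriv f (inner ℝ x (θ : Space n))) := fun i j => by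
    have h1 : Continuous fun θ : Sphere n => deriv f (inner ℝ x (θ : Space n)) :=
      hf1.continuousOn.comp_continuous (continuous_const.inner continuous_subtype_val)
        (inner_mem_openI hb)
    have h2 : Continuous fun θ : Sphere n => deriv (deriv f) (inner ℝ x (θ : Space n)) :=
      hf2.continuousOn.comp_continuous (continuous_const.inner continuous_subtype_val)
        (inner_mem_openI hb)
    have h3 : ∀ v : Space n, Continuous fun θ : Sphere n => (inner ℝ v (θ : Space n) : ℝ) :=
      fun v => continuous_const.inner continuous_subtype_val
    exact (continuous_of_contDiffOn ha).mul (((Complex.continuous_ofReal.comp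
      ((h3 _).pow 2)).mul h2).add ((Complex.continuous_ofReal.comp (h3 _)).mul h1))
  have h0 : angLap n (ridge ha hf) x = ∑ i, ∑ j, opL i j (opL i j (ridge ha hf)) x := by
    rw [angLap, SmoothFn.sum_apply]
    exact Finset.sum_congr rfl fun i _ => SmoothFn.sum_apply _ _ _
  simp only [h0, opL_opL_ridge_apply ha hf _ _ hx]
  have h1 : ∀ i : Fin n, ∑ j, ∫ θ : Sphere n, a θ *
      ((((inner ℝ (rotField i j x) (θ : Space n)) ^ 2 : ℝ) : ℂ) *
          deriv (deriv f) (inner ℝ x (θ : Space n)) +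
        ((inner ℝ (rotField i j (rotField i j x)) (θ : Space n) : ℝ) : ℂ) *
          deriv f (inner ℝ x (θ : Space n))) ∂(surfaceMeasure n) = ∫ θ : Sphere n, ∑ j, a θ *
      ((((inner ℝ (rotField i j x) (θ : Space n)) ^ 2 : ℝ) : ℂ) *
          deriv (deriv f) (inner ℝ x (θ : Space n)) +
        ((inner ℝ (rotField i j (rotField i j x)) (θ : Space n) : ℝ) : ℂ) *
          deriv f (inner ℝ x (θ : Space n))) ∂(surfaceMeasure n) := fun i =>
    (MeasureTheory.integral_finsetSum _ fun j _ => integrable_sphere (hcont i j)).symm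
  simp only [h1]
  rw [← MeasureTheory.integral_finsetSum _ fun i _ => integrable_sphere
    (continuous_finsetSum _ fun j _ => hcont i j)]
  have h2 : ∀ θ : Sphere n, ∑ i, ∑ j, a θ *
      ((((inner ℝ (rotField i j x) (θ : Space n)) ^ 2 : ℝ) : ℂ) *
          deriv (deriv f) (inner ℝ x (θ : Space n)) +
        ((inner ℝ (rotField i j (rotField i j x)) (θ : Space n) : ℝ) : ℂ) *
          deriv f (inner ℝ x (θ : Space n))) =
      a θ * ((2 * (1 - bdf x)) * deriv (deriv f) (inner ℝ x (θ : Space n)) +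
        ((-2) * (((inner ℝ x (θ : Space n) : ℝ) : ℂ) ^ 2 *
          deriv (deriv f) (inner ℝ x (θ : Space n))) +
        (-(2 * ((n : ℂ) - 1))) * euler f (inner ℝ x (θ : Space n)))) := by
    intro θ
    simp only [← Finset.mul_sum, Finset.sum_add_distrib, ← Finset.sum_mul, ← Complex.ofReal_sum]
    rw [sum_inner_rotField_sq, sum_inner_rotField_rotField, mem_sphere_zero_iff_norm.1 θ.2,
      normSq_eq, euler]
    push_cast
    ring
  simp only [h2]
  have h3 := sphereInt_add (f := fun s => (2 * (1 - (bdf x : ℂ))) * deriv (deriv f) s)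
    (g := fun s : ℝ => (-2) * ((s : ℂ) ^ 2 * deriv (deriv f) s) +
      (-(2 * ((n : ℂ) - 1))) * euler f s) ha
    (continuousOn_const.mul hf2.continuousOn) ((continuousOn_const.mul hf3.continuousOn).add
      (continuousOn_const.mul hf4.continuousOn)) hb
  have h4 := sphereInt_add (f := fun s : ℝ => (-2) * ((s : ℂ) ^ 2 * deriv (deriv f) s))
    (g := fun s : ℝ => (-(2 * ((n : ℂ) - 1))) * euler f s) ha
    (continuousOn_const.mul hf3.continuousOn) (continuousOn_const.mul hf4.continuousOn) hb
  rw [h4, sphereInt_const_mul, sphereInt_const_mul, sphereInt_const_mul] at h3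
  refine Eq.trans h3 ?_
  ring

end Ridge

/-- The differential equation for `∫ a(θ) f(x · θ) dθ` that results from a differential equation
for the profile `f`. -/
theorem opD_opDsub_ridge {a : Space n → ℂ} (ha : ContDiffOn ℝ ∞ a {0}ᶜ) {f h g : ℝ → ℂ}
    (hf : ContDiffOn ℝ ∞ f openI) (hh : ContDiffOn ℝ ∞ h openI) (hg : ContDiffOn ℝ ∞ g openI)
    {γ l : ℂ}
    (hode : ∀ s ∈ openI, (1 - (s : ℂ) ^ 2) * deriv (deriv f) s + 2 * (γ - 1) * (s * deriv f s) +
      2 * γ * f s + 2 * l * (s * deriv h s + h s) = g s) :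
    opD n (opDsub n (((n : ℂ) - 1) / 2 + γ) (ridge ha hf)) = l • opD n (ridge ha hh) +
      mulRho n ((1 / 4 : ℂ) • ((8 : ℂ) • opD n (opD n (ridge ha hf)) -
          (2 * n + 8 * γ - 4 : ℂ) • opD n (ridge ha hf) - (1 / 2 : ℂ) • angLap n (ridge ha hf) -
          (2 * γ) • ridge ha hf - (8 * l) • opD n (ridge ha hh) - (2 * l) • ridge ha hh +
          ridge ha hg +
        mulRho n ((-4 : ℂ) • opD n (opD n (ridge ha hf)) +
          (2 * (2 * γ - 1)) • opD n (ridge ha hf) + (2 * γ) • ridge ha hf +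
          (4 * l) • opD n (ridge ha hh) + (2 * l) • ridge ha hh - ridge ha hg))) := by
  ext x hx
  have hb := collarHalf_subset_ball hx
  have hf1 := contDiffOn_deriv isOpen_Ioo hf
  have hf2 := contDiffOn_deriv isOpen_Ioo hf1
  have hf3 := contDiffOn_sq_deriv_deriv hf
  have hf4 := contDiffOn_euler hf
  have hh4 := contDiffOn_euler hh
  -- The profile equation, integrated against `a`; it expresses `g` through the integrals that also
  -- occur in `D w`, `D² w` and the Laplacian.
  have hG : sphereInt a g x = sphereInt a (deriv (deriv f)) x +
      ((-1) * sphereInt a (fun s : ℝ => (s : ℂ) ^ 2 * deriv (deriv f) s) x +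
      ((2 * (γ - 1)) * sphereInt a (euler f) x + ((2 * γ) * sphereInt a f x +
      ((2 * l) * sphereInt a (euler h) x + (2 * l) * sphereInt a h x)))) := by
    have c5 : ContinuousOn (fun s => 2 * l * h s) openI := continuousOn_const.mul hh.continuousOn
    have c4 : ContinuousOn (fun s => 2 * l * euler h s) openI :=
      continuousOn_const.mul hh4.continuousOn
    have c3 : ContinuousOn (fun s => 2 * γ * f s) openI := continuousOn_const.mul hf.continuousOn
    have c2 : ContinuousOn (fun s => 2 * (γ - 1) * euler f s) openI :=
      continuousOn_const.mul hf4.continuousOn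
    have c1 : ContinuousOn (fun s : ℝ => -1 * ((s : ℂ) ^ 2 * deriv (deriv f) s)) openI :=
      continuousOn_const.mul hf3.continuousOn
    have d4 : ContinuousOn (fun s => 2 * l * euler h s + 2 * l * h s) openI := c4.add c5
    have d3 : ContinuousOn (fun s => 2 * γ * f s + (2 * l * euler h s + 2 * l * h s)) openI :=
      c3.add d4
    have d2 : ContinuousOn (fun s => 2 * (γ - 1) * euler f s +
        (2 * γ * f s + (2 * l * euler h s + 2 * l * h s))) openI := c2.add d3
    have d1 : ContinuousOn (fun s : ℝ => -1 * ((s : ℂ) ^ 2 * deriv (deriv f) s) +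
        (2 * (γ - 1) * euler f s + (2 * γ * f s + (2 * l * euler h s + 2 * l * h s)))) openI :=
      c1.add d2
    rw [← sphereInt_const_mul, ← sphereInt_const_mul, ← sphereInt_const_mul,
      ← sphereInt_const_mul, ← sphereInt_const_mul, ← sphereInt_add ha c4 c5 hb,
      ← sphereInt_add ha c3 d4 hb, ← sphereInt_add ha c2 d3 hb, ← sphereInt_add ha c1 d2 hb,
      ← sphereInt_add ha hf2.continuousOn d1 hb]
    refine sphereInt_congr (fun s hs => ?_) hb
    rw [← hode s hs, euler, euler]
    ring
  rw [opDsub_apply, map_sub, map_smul]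
  simp only [SmoothFn.add_apply, SmoothFn.sub_apply, SmoothFn.smul_apply, mulRho_apply _ hx,
    opD_opD_ridge_apply ha hf hx, opD_ridge_apply ha hf hx, opD_ridge_apply ha hh hx,
    angLap_ridge_apply ha hf hx, ridge_apply _ _ hx, hG]
  -- Both sides are now combinations of the same integrals, with rational coefficients in `ρ` whose
  -- only denominators are powers of `1 - ρ` up to constants; the identity is formal.
  have hr : (1 : ℂ) - (bdf x : ℂ) ≠ 0 := by
    have : (1 : ℝ) - bdf x ≠ 0 := by linarith [bdf_lt_half hx]
    exact_mod_cast this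
  field_simp
  ring

/-! ### The profiles `σ^γ log(σ)^k` -/

/-- The function `σ^γ log(σ)^k` with `σ = 1 - s²`. -/
def sigmaLog (γ : ℂ) (k : ℕ) (s : ℝ) : ℂ :=
  ((1 - s ^ 2 : ℝ) : ℂ) ^ γ * ((Real.log (1 - s ^ 2) : ℝ) : ℂ) ^ k

theorem sigma_pos {s : ℝ} (hs : s ∈ openI) : 0 < 1 - s ^ 2 := by
  nlinarith [hs.1, hs.2]

theorem contDiffOn_sigmaLog (γ : ℂ) (k : ℕ) : ContDiffOn ℝ ∞ (sigmaLog γ k) openI := by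
  refine ((contDiffOn_ofReal_cpow γ).mul (contDiffOn_ofReal_log.pow k)).comp
    (f := fun s : ℝ => 1 - s ^ 2) ?_ fun s hs => sigma_pos hs
  fun_prop

theorem sigma_mul_sigmaLog (γ : ℂ) (k : ℕ) {s : ℝ} (hs : s ∈ openI) :
    (1 - (s : ℂ) ^ 2) * sigmaLog (γ - 1) k s = sigmaLog γ k s := by
  have h0 : ((1 - s ^ 2 : ℝ) : ℂ) ≠ 0 := by exact_mod_cast (sigma_pos hs).ne'
  have h1 : (1 - (s : ℂ) ^ 2) = ((1 - s ^ 2 : ℝ) : ℂ) := by push_cast; ring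
  rw [h1, sigmaLog, sigmaLog, Complex.cpow_sub _ _ h0, Complex.cpow_one]
  field_simp

theorem hasDerivAt_sigmaLog (γ : ℂ) (k : ℕ) {s : ℝ} (hs : s ∈ openI) :
    HasDerivAt (sigmaLog γ k)
      (-2 * s * (γ * sigmaLog (γ - 1) k s + k * sigmaLog (γ - 1) (k - 1) s)) s := by
  have hp := sigma_pos hs
  have h0 : ((1 - s ^ 2 : ℝ) : ℂ) ≠ 0 := by exact_mod_cast hp.ne'
  have h1 : HasDerivAt (fun s : ℝ => 1 - s ^ 2) (-(2 * s)) s := by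
    simpa using (hasDerivAt_pow 2 s).const_sub 1
  have h2 := ((hasDerivAt_ofReal_cpow hp γ).mul
    (((Real.hasDerivAt_log hp.ne').ofReal_comp).pow k)).scomp s h1
  refine h2.congr_deriv ?_
  have h3 := Complex.cpow_sub γ 1 h0
  rw [Complex.cpow_one] at h3
  rw [sigmaLog, sigmaLog, h3]
  simp only [Complex.real_smul, Pi.pow_apply]
  push_cast
  push_cast at h0
  field_simp

/-- The right-hand side of the differential equation of `σ^γ log(σ)^k ψ`. -/
def odeError (ψ : ℝ → ℂ) (γ : ℂ) (k : ℕ) (s : ℝ) : ℂ :=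
  (-4 * s * (γ * sigmaLog γ k s + k * sigmaLog γ (k - 1) s) + 2 * (γ - 1) * s * sigmaLog γ k s +
    2 * k * s * sigmaLog γ (k - 1) s) * deriv ψ s +
    (1 - (s : ℂ) ^ 2) * sigmaLog γ k s * deriv (deriv ψ) s

theorem contDiffOn_mul_sigmaLog {ψ : ℝ → ℂ} (hψ : ContDiff ℝ ∞ ψ) (γ : ℂ) (k : ℕ) :
    ContDiffOn ℝ ∞ (fun s => ψ s * sigmaLog γ k s) openI :=
  hψ.contDiffOn.mul (contDiffOn_sigmaLog γ k)

theorem contDiff_deriv {ψ : ℝ → ℂ} (hψ : ContDiff ℝ ∞ ψ) : ContDiff ℝ ∞ (deriv ψ) :=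
  (contDiff_infty_iff_deriv.1 hψ).2

theorem hasDerivAt_mul_sigmaLog {ψ : ℝ → ℂ} (hψ : ContDiff ℝ ∞ ψ) (γ : ℂ) (k : ℕ) {s : ℝ}
    (hs : s ∈ openI) : HasDerivAt (fun s => ψ s * sigmaLog γ k s)
      (deriv ψ s * sigmaLog γ k s +
        ψ s * (-2 * s * (γ * sigmaLog (γ - 1) k s + k * sigmaLog (γ - 1) (k - 1) s))) s :=
  ((hψ.differentiable (by simp)) s).hasDerivAt.mul (hasDerivAt_sigmaLog γ k hs)

/-- For `ψ = 1` this is the derivative of `σ f' = -2s(γ f + k h)`, where `h` has one logarithm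
fewer; the error collects the terms with a derivative on `ψ`. -/
theorem profile_ode {ψ : ℝ → ℂ} (hψ : ContDiff ℝ ∞ ψ) (γ : ℂ) (k : ℕ) {s : ℝ} (hs : s ∈ openI) :
    (1 - (s : ℂ) ^ 2) * deriv (deriv fun s => ψ s * sigmaLog γ k s) s +
      2 * (γ - 1) * (s * deriv (fun s => ψ s * sigmaLog γ k s) s) +
      2 * γ * (ψ s * sigmaLog γ k s) + 2 * k * (s * deriv (fun s => ψ s * sigmaLog γ (k - 1) s) s +
        ψ s * sigmaLog γ (k - 1) s) = odeError ψ γ k s := by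
  have hψ' := contDiff_deriv hψ
  have e : deriv (fun s => ψ s * sigmaLog γ k s) =ᶠ[nhds s] fun s : ℝ =>
      deriv ψ s * sigmaLog γ k s +
        ψ s * (-2 * s * (γ * sigmaLog (γ - 1) k s + k * sigmaLog (γ - 1) (k - 1) s)) :=
    Filter.eventuallyEq_of_mem (isOpen_Ioo.mem_nhds hs) fun t ht =>
      (hasDerivAt_mul_sigmaLog hψ γ k ht).deriv
  have hid : HasDerivAt (fun s : ℝ => -2 * (s : ℂ)) (-2 * 1) s :=
    Complex.ofRealCLM.hasDerivAt.const_mul _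
  have h2 := (hasDerivAt_mul_sigmaLog hψ' γ k hs).add
    (((hψ.differentiable (by simp)) s).hasDerivAt.mul
      (hid.mul (((hasDerivAt_sigmaLog (γ - 1) k hs).const_mul γ).add
        ((hasDerivAt_sigmaLog (γ - 1) (k - 1) hs).const_mul (k : ℂ)))))
  have h3 : deriv (deriv fun s => ψ s * sigmaLog γ k s) s = _ := e.deriv_eq.trans h2.deriv
  rw [h3, (hasDerivAt_mul_sigmaLog hψ γ k hs).deriv,
    (hasDerivAt_mul_sigmaLog hψ γ (k - 1) hs).deriv, odeError]
  simp only [Pi.add_apply, Pi.mul_apply]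
  simp only [← sigma_mul_sigmaLog γ _ hs, ← sigma_mul_sigmaLog (γ - 1) _ hs]
  ring

/-- Every term contains `ψ'` or `ψ''`, which vanish near `±1` and beyond. The singular factors at
and outside the endpoints, whatever values they take there, are multiplied by zero. -/
theorem contDiff_odeError {ψ : ℝ → ℂ} (hψ : ContDiff ℝ ∞ ψ) {δ : ℝ} (hδ : 0 < δ)
    (h0 : ∀ s, 1 - δ < |s| → deriv ψ s = 0) (γ : ℂ) (k : ℕ) : ContDiff ℝ ∞ (odeError ψ γ k) := by
  have hψ' := contDiff_deriv hψ
  have hψ'' := contDiff_deriv hψ'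
  refine contDiff_iff_contDiffAt.2 fun s => ?_
  by_cases hs : s ∈ openI
  · refine ContDiffOn.contDiffAt ?_ (isOpen_Ioo.mem_nhds hs)
    have hs : ContDiffOn ℝ ∞ (fun s : ℝ => (s : ℂ)) openI := Complex.ofRealCLM.contDiff.contDiffOn
    have h1 := contDiffOn_sigmaLog γ k
    have h2 := contDiffOn_sigmaLog γ (k - 1)
    exact (((((contDiffOn_const.mul hs).mul ((contDiffOn_const.mul h1).add
      (contDiffOn_const.mul h2))).add ((contDiffOn_const.mul hs).mul h1)).add
      ((contDiffOn_const.mul hs).mul h2)).mul hψ'.contDiffOn).add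
        (((contDiffOn_const.sub (hs.pow 2)).mul h1).mul hψ''.contDiffOn)
  · have hs' : 1 - δ < |s| := by
      by_contra hc
      exact hs (abs_lt.1 (by linarith))
    have hU : IsOpen {s : ℝ | 1 - δ < |s|} := isOpen_lt continuous_const continuous_abs
    have hz : ∀ t ∈ {s : ℝ | 1 - δ < |s|}, deriv (deriv ψ) t = 0 := fun t ht => by
      have : deriv ψ =ᶠ[nhds t] fun _ => 0 :=
        Filter.eventuallyEq_of_mem (hU.mem_nhds ht) fun r hr => h0 r hr
      rw [this.deriv_eq, deriv_const]
    have : odeError ψ γ k =ᶠ[nhds s] fun _ => 0 :=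
      Filter.eventuallyEq_of_mem (hU.mem_nhds hs') fun t ht => by
        rw [odeError, h0 t ht, hz t ht]
        simp
    exact contDiffAt_const.congr_of_eventuallyEq this

/-! ### The weight of `∫ a(θ) f(x · θ) dθ` -/

theorem bdf_le_sigma {x : Space n} (θ : Sphere n) : bdf x ≤ 1 - (inner ℝ x (θ : Space n)) ^ 2 := by
  have := sq_le_sq' (abs_le.1 (abs_inner_le x θ)).1 (abs_le.1 (abs_inner_le x θ)).2
  rw [bdf]
  linarith

/-- The profile is `O(σ^t)`, and `σ(x · θ) ≥ ρ(x)` by Cauchy–Schwarz; since `t ≤ 0` this gives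
`O(ρ^t)` uniformly in `θ`. -/
theorem ridge_sigmaLog_mem_bounded {a : Space n → ℂ} (ha : ContDiffOn ℝ ∞ a {0}ᶜ) {ψ : ℝ → ℂ}
    (hψ : ContDiff ℝ ∞ ψ) {γ : ℂ} (k : ℕ) {t : ℝ} (ht : t ≤ 0) (htγ : t < γ.re) :
    ridge ha (contDiffOn_mul_sigmaLog hψ γ k) ∈ bounded n t := by
  obtain ⟨A, hA⟩ := (isCompact_univ (X := Sphere n)).exists_bound_of_continuousOn
    (continuous_of_contDiffOn ha).continuousOn
  obtain ⟨B, hB⟩ := (isCompact_Icc (a := (-1 : ℝ)) (b := 1)).exists_bound_of_continuousOn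
    hψ.continuous.continuousOn
  obtain ⟨C, hC0, hC⟩ := exists_rpow_mul_abs_log_pow_le htγ k
  refine ⟨|A| * (|B| * C) * (surfaceMeasure n).real Set.univ, fun x hx => ?_⟩
  have hb := collarHalf_subset_ball hx
  rw [ridge_apply _ _ hx, sphereInt]
  have key : ∀ θ : Sphere n, ‖a θ * (ψ (inner ℝ x (θ : Space n)) *
      sigmaLog γ k (inner ℝ x (θ : Space n)))‖ ≤ |A| * (|B| * C) * bdf x ^ t := fun θ => by
    have hs := inner_mem_openI hb θ
    have h1 := sigma_pos hs
    rw [norm_mul, norm_mul, sigmaLog, norm_cpow_mul_log_pow h1, mul_assoc, mul_assoc]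
    have h2 := hC _ h1 (by nlinarith)
    have h3 : (1 - (inner ℝ x (θ : Space n)) ^ 2) ^ t ≤ bdf x ^ t :=
      Real.rpow_le_rpow_of_nonpos (bdf_pos hx) (bdf_le_sigma θ) ht
    refine mul_le_mul ((hA θ (Set.mem_univ _)).trans (le_abs_self A)) ?_ (by positivity)
      (abs_nonneg _)
    refine mul_le_mul ((hB _ ⟨hs.1.le, hs.2.le⟩).trans (le_abs_self B)) ?_ (by positivity)
      (abs_nonneg _)
    exact h2.trans (mul_le_mul_of_nonneg_left h3 hC0)
  refine (MeasureTheory.norm_integral_le_of_norm_le_const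
    (Filter.Eventually.of_forall key)).trans (le_of_eq ?_)
  ring

/-- The function `-1 / (2|x|²)`. -/
def invCoeff (x : Space n) : ℂ := ((-(1 / (2 * ‖x‖ ^ 2)) : ℝ) : ℂ)

theorem contDiffOn_invCoeff : ContDiffOn ℝ ∞ (invCoeff : Space n → ℂ) {0}ᶜ := by
  refine Complex.ofRealCLM.contDiff.comp_contDiffOn (ContDiffOn.neg (ContDiffOn.div
    contDiffOn_const (contDiffOn_const.mul (contDiff_norm_sq ℝ).contDiffOn) ?_))
  intro x hx
  have : ‖x‖ ≠ 0 := norm_ne_zero_iff.2 hx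
  positivity

/-- The amplitude in `s (b h)' = b₁ σ^{γ-1} log(σ)^k + …` for `h = σ^γ log(σ)^k`. -/
def eulerAmp (b : ℝ → ℂ) (γ : ℂ) (s : ℝ) : ℂ :=
  (s : ℂ) * deriv b s * (1 - (s : ℂ) ^ 2) - 2 * (s : ℂ) ^ 2 * b s * γ

theorem contDiff_eulerAmp {b : ℝ → ℂ} (hb : ContDiff ℝ ∞ b) (γ : ℂ) :
    ContDiff ℝ ∞ (eulerAmp b γ) := by
  have h1 : ContDiff ℝ ∞ (fun s : ℝ => (s : ℂ)) := Complex.ofRealCLM.contDiff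
  exact ((h1.mul (contDiff_deriv hb)).mul (contDiff_const.sub (h1.pow 2))).sub
    (((contDiff_const.mul (h1.pow 2)).mul hb).mul contDiff_const)

/-- The amplitude of the term with `log(σ)^{k-1}` in `s (b σ^γ log(σ)^k)'`. -/
def eulerLogAmp (b : ℝ → ℂ) (k : ℕ) (s : ℝ) : ℂ := -2 * (s : ℂ) ^ 2 * b s * k

theorem contDiff_eulerLogAmp {b : ℝ → ℂ} (hb : ContDiff ℝ ∞ b) (k : ℕ) :
    ContDiff ℝ ∞ (eulerLogAmp b k) := by
  have h1 : ContDiff ℝ ∞ (fun s : ℝ => (s : ℂ)) := Complex.ofRealCLM.contDiff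
  exact ((contDiff_const.mul (h1.pow 2)).mul hb).mul contDiff_const

theorem euler_mul_sigmaLog {b : ℝ → ℂ} (hb : ContDiff ℝ ∞ b) (γ : ℂ) (k : ℕ) {s : ℝ}
    (hs : s ∈ openI) : euler (fun s => b s * sigmaLog γ k s) s =
      eulerAmp b γ s * sigmaLog (γ - 1) k s + eulerLogAmp b k s * sigmaLog (γ - 1) (k - 1) s := by
  rw [euler, (hasDerivAt_mul_sigmaLog hb γ k hs).deriv, eulerAmp, eulerLogAmp,
    ← sigma_mul_sigmaLog γ _ hs]
  ring

/-- Differentiation lowers the power of `σ` by one, but the radial field supplies a factor `ρ` in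
return. -/
theorem opD_ridge_sigmaLog {a : Space n → ℂ} (ha : ContDiffOn ℝ ∞ a {0}ᶜ) {b : ℝ → ℂ}
    (hb : ContDiff ℝ ∞ b) (γ : ℂ) (k : ℕ) :
    opD n (ridge ha (contDiffOn_mul_sigmaLog hb γ k)) =
      pmul (ofSmooth invCoeff contDiffOn_invCoeff) (pmul (powLog n 1 0)
        (ridge ha (contDiffOn_mul_sigmaLog (contDiff_eulerAmp hb γ) (γ - 1) k) +
          ridge ha (contDiffOn_mul_sigmaLog (contDiff_eulerLogAmp hb k) (γ - 1) (k - 1)))) := by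
  rw [← rho_eq_powLog]
  ext x hx
  have hx' := collarHalf_subset_ball hx
  rw [opD_ridge, pmul_apply, pmul_apply, pmul_apply, ofSmooth_apply _ hx, ofSmooth_apply _ hx,
    rho_apply hx, SmoothFn.add_apply, ridge_apply _ _ hx, ridge_apply _ _ hx, ridge_apply _ _ hx,
    sphereInt_congr (fun s hs => euler_mul_sigmaLog hb γ k hs) hx',
    sphereInt_add ha (contDiffOn_mul_sigmaLog (contDiff_eulerAmp hb γ) _ _).continuousOn
      (contDiffOn_mul_sigmaLog (contDiff_eulerLogAmp hb k) _ _).continuousOn hx', radialCoeff,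
    invCoeff]
  push_cast
  ring

theorem pmul_powLog_one (j : ℕ) (w : SmoothFn n) :
    pmul (powLog n j 0) (pmul (powLog n 1 0) w) = pmul (powLog n ((j + 1 : ℕ) : ℂ) 0) w := by
  ext x hx
  simp only [pmul_apply, powLog_apply _ _ hx, Complex.cpow_natCast, Complex.cpow_one]
  ring

/-- The stable family consists of the products of a smooth function, `ρ^j` and a superposition with
profile `b σ^{γ-j} log(σ)^k`. The weight `t - j` of the superposition is compensated by `ρ^j`. -/
theorem ridge_sigmaLog_mem_conormal {a : Space n → ℂ} (ha : ContDiffOn ℝ ∞ a {0}ᶜ) {b : ℝ → ℂ}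
    (hb : ContDiff ℝ ∞ b) {γ : ℂ} (k : ℕ) {t : ℝ} (ht : t ≤ 0) (htγ : t < γ.re) :
    ridge ha (contDiffOn_mul_sigmaLog hb γ k) ∈ conormal n t := by
  obtain ⟨S, hS⟩ : ∃ S : Set (SmoothFn n), S = {w | ∃ (φ : Space n → ℂ)
      (hφ : ContDiffOn ℝ ∞ φ {0}ᶜ) (j k : ℕ) (a : Space n → ℂ) (ha : ContDiffOn ℝ ∞ a {0}ᶜ)
      (b : ℝ → ℂ) (hb : ContDiff ℝ ∞ b), w = pmul (ofSmooth φ hφ) (pmul (powLog n j 0)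
        (ridge ha (contDiffOn_mul_sigmaLog hb (γ - j) k)))} := ⟨_, rfl⟩
  have hmem : ridge ha (contDiffOn_mul_sigmaLog hb γ k) ∈ S := by
    rw [hS]
    refine ⟨fun _ => 1, contDiffOn_const, 0, k, a, ha, b, hb, ?_⟩
    ext x hx
    rw [pmul_apply, pmul_apply, ofSmooth_apply _ hx, powLog_apply _ _ hx, ridge_apply _ _ hx,
      ridge_apply _ _ hx]
    simp
  refine mem_conormal_of_stable (S := S) ?_ ?_ hmem
  · rw [hS]
    rintro _ ⟨φ, hφ, j, k, a, ha, b, hb, rfl⟩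
    have h1 : ridge ha (contDiffOn_mul_sigmaLog hb (γ - j) k) ∈ bounded n (t - j) :=
      ridge_sigmaLog_mem_bounded ha hb k (by linarith [(Nat.cast_nonneg j : (0 : ℝ) ≤ j)])
        (by simpa using htγ)
    have h2 := pmul_mem_bounded (ofSmooth_mem_bounded hφ)
      (pmul_mem_bounded (powLog_zero_mem_bounded (n := n) (j : ℂ)) h1)
    simpa using h2
  · intro w hw g
    have hsub : ∀ {v}, v ∈ S → v ∈ Submodule.span ℂ S := fun h => Submodule.subset_span h
    rw [hS] at hw
    obtain ⟨φ, hφ, j, k, a, ha, b, hb, rfl⟩ := hw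
    have h1 : pmul (op g (ofSmooth φ hφ)) (pmul (powLog n j 0)
        (ridge ha (contDiffOn_mul_sigmaLog hb (γ - j) k))) ∈ Submodule.span ℂ S := by
      rw [op_ofSmooth]
      exact hsub (hS ▸ ⟨_, _, j, k, a, ha, b, hb, rfl⟩)
    rw [op_pmul, op_pmul]
    refine add_mem h1 ?_
    rw [pmul_add]
    match g with
    | none =>
      refine add_mem ?_ ?_
      · change pmul _ (pmul (opD n _) _) ∈ _
        rw [opD_powLog, Nat.cast_zero, zero_smul, add_zero, smul_pmul, pmul_smul]
        exact Submodule.smul_mem _ _ (hsub (hS ▸ ⟨_, _, j, k, a, ha, b, hb, rfl⟩))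
      · change pmul _ (pmul _ (opD n _)) ∈ _
        rw [opD_ridge_sigmaLog ha hb, ← pmul_assoc (powLog n j 0), pmul_comm (powLog n j 0),
          pmul_assoc, pmul_powLog_one, ← pmul_assoc, pmul_add, pmul_add]
        have e : pmul (ofSmooth φ hφ) (ofSmooth invCoeff contDiffOn_invCoeff) =
            ofSmooth (fun x => φ x * invCoeff x) (hφ.mul contDiffOn_invCoeff) := by
          ext x hx
          rw [pmul_apply, ofSmooth_apply _ hx, ofSmooth_apply _ hx, ofSmooth_apply _ hx]
        have e' : γ - j - 1 = γ - ((j + 1 : ℕ) : ℂ) := by push_cast; ring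
        rw [e]
        simp only [e']
        refine add_mem (hsub ?_) (hsub ?_)
        · rw [hS]
          exact ⟨_, _, j + 1, k, a, ha, _, contDiff_eulerAmp hb _, rfl⟩
        · rw [hS]
          exact ⟨_, _, j + 1, k - 1, a, ha, _, contDiff_eulerLogAmp hb _, rfl⟩
    | some p =>
      refine add_mem ?_ ?_
      · rw [opL_powLog]
        have : pmul (ofSmooth φ hφ) (pmul 0 (ridge ha
            (contDiffOn_mul_sigmaLog hb (γ - j) k))) = 0 := by
          ext x hx; simp
        rw [this]
        exact zero_mem _
      · change pmul _ (pmul _ (opL p.1 p.2 _)) ∈ _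
        rw [opL_ridge]
        exact hsub (hS ▸ ⟨_, _, j, k, _, _, b, hb, rfl⟩)

/-! ### Indicial operators that improve the weight of `∫ a(θ) f(x · θ) dθ` -/

section Indicial

variable {a : Space n → ℂ} (ha : ContDiffOn ℝ ∞ a {0}ᶜ)

/-- A profile smooth on the whole line gives a superposition smooth on all of `ℝⁿ`, for which the
roots `j` suffice and `e` is arbitrary. -/
theorem ridge_mem_indSpace_of_contDiff {f : ℝ → ℂ} (hf : ContDiff ℝ ∞ f) (z : ℂ) {τ : ℝ}
    (hτ : τ ≤ 0) (e N : ℕ) : ridge ha (hf.contDiffOn (s := openI)) ∈ indSpace n z τ e N := by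
  have h1 : ContDiffOn ℝ ∞ (sphereInt a f) {0}ᶜ :=
    (contDiffOn_sphereInt isOpen_univ isOpen_univ (fun _ _ _ => Set.mem_univ _) ha
      hf.contDiffOn).mono (Set.subset_univ _)
  exact ofSmooth_mem_indSpace z hτ e N h1

theorem angLap_mem_indSpace {z : ℂ} {τ : ℝ} {e N : ℕ} {w : SmoothFn n}
    (hw : w ∈ indSpace n z τ e N) : angLap n w ∈ indSpace n z τ e N :=
  sum_mem fun _ _ => sum_mem fun _ _ => op_mem_indSpace (op_mem_indSpace hw _) _

theorem ridge_mem_indSpace_of_ode {f h g : ℝ → ℂ} (hf : ContDiffOn ℝ ∞ f openI)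
    (hh : ContDiffOn ℝ ∞ h openI) (hg : ContDiff ℝ ∞ g) {γ l : ℂ} {τ : ℝ} {e : ℕ} (hτ : τ ≤ 0)
    (hode : ∀ s ∈ openI, (1 - (s : ℂ) ^ 2) * deriv (deriv f) s + 2 * (γ - 1) * (s * deriv f s) +
      2 * γ * f s + 2 * l * (s * deriv h s + h s) = g s)
    (hF : ridge ha hf ∈ conormal n τ)
    (hH : ∀ N, ridge ha hh ∈ indSpace n (((n : ℂ) - 1) / 2 + γ) τ e N) (N : ℕ) :
    ridge ha hf ∈ indSpace n (((n : ℂ) - 1) / 2 + γ) τ (e + 1) N := by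
  refine mem_indSpace_of_eq hF hH (fun N hN => ?_)
    (opD_opDsub_ridge ha hf hh (hg.contDiffOn (s := openI)) hode) N
  have hF' := op_mem_indSpace hN none
  have hF'' := op_mem_indSpace hF' none
  have hL := angLap_mem_indSpace hN
  have hH := indSpace_le_succ (hH N)
  have hH' := op_mem_indSpace hH none
  have hG := ridge_mem_indSpace_of_contDiff ha hg (((n : ℂ) - 1) / 2 + γ) hτ (e + 1) N
  refine Submodule.smul_mem _ _ (add_mem (add_mem (sub_mem (sub_mem (sub_mem (sub_mem (sub_mem
    (Submodule.smul_mem _ _ hF'') (Submodule.smul_mem _ _ hF')) (Submodule.smul_mem _ _ hL))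
    (Submodule.smul_mem _ _ hN)) (Submodule.smul_mem _ _ hH')) (Submodule.smul_mem _ _ hH)) hG)
    (mulRho_mem_indSpace ?_))
  exact sub_mem (add_mem (add_mem (add_mem (add_mem (Submodule.smul_mem _ _ hF'')
    (Submodule.smul_mem _ _ hF')) (Submodule.smul_mem _ _ hN)) (Submodule.smul_mem _ _ hH'))
    (Submodule.smul_mem _ _ hH)) hG

variable {ψ : ℝ → ℂ} (hψ : ContDiff ℝ ∞ ψ) {δ : ℝ} {γ : ℂ} {τ : ℝ}

theorem ridge_sigmaLog_succ_mem_indSpace (hδ : 0 < δ) (h0 : ∀ s, 1 - δ < |s| → deriv ψ s = 0)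
    (hτ : τ ≤ 0) (hτγ : τ < γ.re) {e k : ℕ}
    (hk : ∀ N, ridge ha (contDiffOn_mul_sigmaLog hψ γ k) ∈
      indSpace n (((n : ℂ) - 1) / 2 + γ) τ e N) (N : ℕ) :
    ridge ha (contDiffOn_mul_sigmaLog hψ γ (k + 1)) ∈
      indSpace n (((n : ℂ) - 1) / 2 + γ) τ (e + 1) N :=
  ridge_mem_indSpace_of_ode ha (contDiffOn_mul_sigmaLog hψ γ (k + 1))
    (contDiffOn_mul_sigmaLog hψ γ k) (contDiff_odeError hψ hδ h0 γ (k + 1)) hτ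
    (fun _ hs => profile_ode hψ γ (k + 1) hs)
    (ridge_sigmaLog_mem_conormal ha hψ (k + 1) hτ hτγ) hk N

theorem ridge_sigmaLog_mem_indSpace (hδ : 0 < δ) (h0 : ∀ s, 1 - δ < |s| → deriv ψ s = 0)
    (hτ : τ ≤ 0) (hτγ : τ < γ.re) (k N : ℕ) :
    ridge ha (contDiffOn_mul_sigmaLog hψ γ k) ∈
      indSpace n (((n : ℂ) - 1) / 2 + γ) τ (k + 1) N := by
  induction k generalizing N with
  | zero =>
    -- Without logarithms there is no coupling: `h = 0` and `l = 0`, starting from `e = 0`.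
    refine ridge_mem_indSpace_of_ode ha (contDiffOn_mul_sigmaLog hψ γ 0)
      (contDiff_const (c := (0 : ℂ))).contDiffOn (contDiff_odeError hψ hδ h0 γ 0) (l := 0) hτ
      (fun s hs => ?_) (ridge_sigmaLog_mem_conormal ha hψ 0 hτ hτγ)
      (ridge_mem_indSpace_of_contDiff ha contDiff_const _ hτ 0) N
    rw [← profile_ode hψ γ 0 hs]
    simp
  | succ k ih => exact ridge_sigmaLog_succ_mem_indSpace ha hψ hδ h0 hτ hτγ ih N

/-- For `γ ∈ ℕ₀` the function `σ^γ ψ` is smooth up to the boundary, and one factor of the indicial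
operator is superfluous. -/
theorem ridge_sigmaLog_natCast_mem_indSpace (hδ : 0 < δ)
    (h0 : ∀ s, 1 - δ < |s| → deriv ψ s = 0) (hτ : τ ≤ 0) {m : ℕ} (hγ : γ = m) (hτγ : τ < γ.re)
    (k N : ℕ) : ridge ha (contDiffOn_mul_sigmaLog hψ γ k) ∈
      indSpace n (((n : ℂ) - 1) / 2 + γ) τ k N := by
  induction k generalizing N with
  | zero =>
    have h1 : ContDiff ℝ ∞ fun s : ℝ => ψ s * (1 - (s : ℂ) ^ 2) ^ m :=
      hψ.mul ((contDiff_const.sub (Complex.ofRealCLM.contDiff.pow 2)).pow m)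
    have h2 : ridge ha (contDiffOn_mul_sigmaLog hψ γ 0) =
        ridge ha (h1.contDiffOn (s := openI)) := by
      ext x hx
      rw [ridge_apply _ _ hx, ridge_apply _ _ hx]
      refine sphereInt_congr (fun s _ => ?_) (collarHalf_subset_ball hx)
      rw [sigmaLog, hγ, Complex.cpow_natCast]
      push_cast
      ring
    rw [h2]
    exact ridge_mem_indSpace_of_contDiff ha h1 _ hτ 0 N
  | succ k ih => exact ridge_sigmaLog_succ_mem_indSpace ha hψ hδ h0 hτ hτγ ih N

end Indicial

/-! ### Conormality on the whole ball -/

theorem contDiffOn_iterDerivation {U : Set (Space n)} (hU : IsOpen U) {u : Space n → ℂ}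
    (hu : ContDiffOn ℝ ∞ u U) {Vs : List (Space n → Space n)} (hVs : ∀ V ∈ Vs, IsBField V) :
    ContDiffOn ℝ ∞ (iterDerivation Vs u) U := by
  induction Vs with
  | nil => exact hu
  | cons V Vs ih =>
    exact ((contDiffOn_infty_iff_fderiv_of_isOpen hU).1
      (ih fun W hW => hVs W (by simp [hW]))).2.clm_apply (hVs V (by simp)).smooth.contDiffOn

theorem isConormalOn_ball {u : Space n → ℂ} (hu : ContDiffOn ℝ ∞ u (Metric.ball 0 1)) {t : ℝ}
    (ht : t ≤ 0) (h : IsConormalOn (collar n (1 / 2)) t u) :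
    IsConormalOn (Metric.ball 0 1) t u := by
  refine ⟨hu, fun Vs hVs => ?_⟩
  obtain ⟨C, hC⟩ := h.2 Vs hVs
  -- Off the collar `|x|² ≤ 1/2`, so `|x| < 9/10`; there the derivatives are bounded by compactness,
  -- and `ρ^t ≥ 1` because `t ≤ 0`.
  obtain ⟨B, hB⟩ := (isCompact_closedBall (0 : Space n) (9 / 10)).exists_bound_of_continuousOn
    ((contDiffOn_iterDerivation Metric.isOpen_ball hu hVs).continuousOn.mono
      (Metric.closedBall_subset_ball (by norm_num)))
  refine ⟨max C |B|, fun x hx => ?_⟩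
  have hx1 : ‖x‖ < 1 := by simpa using hx
  have hpos : 0 < bdf x := by rw [bdf]; nlinarith [norm_nonneg x]
  by_cases hx' : bdf x < 1 / 2
  · exact (hC x ⟨hpos, hx'⟩).trans
      (mul_le_mul_of_nonneg_right (le_max_left _ _) (by positivity))
  · have h1 : x ∈ Metric.closedBall (0 : Space n) (9 / 10) := by
      rw [mem_closedBall_zero_iff]
      rw [bdf] at hx'
      nlinarith [norm_nonneg x]
    have h2 : 1 ≤ bdf x ^ t := Real.one_le_rpow_of_pos_of_le_one_of_nonpos hpos
      (by rw [bdf]; nlinarith [norm_nonneg x]) ht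
    calc ‖iterDerivation Vs u x‖ ≤ |B| * 1 := by linarith [hB x h1, le_abs_self B]
      _ ≤ max C |B| * bdf x ^ t := mul_le_mul (le_max_right _ _) h2 zero_le_one
        ((abs_nonneg B).trans (le_max_right _ _))

/-! ### Cutoffs and radial extensions -/

/-- Extending `χ` by `1` to negative arguments gives a smooth function on the line. The resulting
`ψ` is locally constant near and beyond both endpoints: `1` at the selected one and `0` at the
other. -/
theorem IsCutoff.exists_contDiff {χ : ℝ → ℂ} (hχ : IsCutoff χ) {κ : ℝ} (hκ : κ = 1 ∨ κ = -1) :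
    ∃ ψ : ℝ → ℂ, ContDiff ℝ ∞ ψ ∧ (∃ δ > 0, ∀ s, 1 - δ < |s| → deriv ψ s = 0) ∧
      ∀ s ∈ openI, ψ s = χ (1 + κ * s) := by
  obtain ⟨δ, hδ, h1⟩ := hχ.eq_one_near_zero
  obtain ⟨b, hb, hz⟩ := hχ.eq_zero
  have hneg : ∀ t < δ, (if t < 0 then 1 else χ t) = 1 := fun t ht => by
    split_ifs with h
    · rfl
    · exact h1 t (not_lt.1 h) ht.le
  have hs : ContDiff ℝ ∞ fun t : ℝ => if t < 0 then 1 else χ t := by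
    refine contDiff_iff_contDiffAt.2 fun t => ?_
    rcases lt_or_ge 0 t with ht | ht
    · refine (hχ.smooth.contDiffAt (Ici_mem_nhds ht)).congr_of_eventuallyEq
        (Filter.eventuallyEq_of_mem (Ioi_mem_nhds ht) fun r hr => ?_)
      simp [not_lt.2 (Set.mem_Ioi.1 hr).le]
    · exact (contDiffAt_const (c := (1 : ℂ))).congr_of_eventuallyEq
        (Filter.eventuallyEq_of_mem (Iio_mem_nhds (ht.trans_lt hδ)) fun r hr => hneg r hr)
  refine ⟨fun s => if 1 + κ * s < 0 then 1 else χ (1 + κ * s),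
    hs.comp (contDiff_const.add (contDiff_const.mul contDiff_id)), ⟨min δ 1, by positivity,
      fun s hs => ?_⟩, fun s hs => ?_⟩
  · have hcont : Continuous fun s : ℝ => 1 + κ * s := by fun_prop
    have hcase : 1 + κ * s < δ ∨ 1 < 1 + κ * s := by
      have h2 := min_le_left δ 1
      have h3 := min_le_right δ 1
      rcases hκ with rfl | rfl <;> rcases lt_abs.1 hs with h | h
      · right; linarith
      · left; linarith
      · left; linarith
      · right; linarith
    rcases hcase with h | h
    · have : (fun s => if 1 + κ * s < 0 then 1 else χ (1 + κ * s)) =ᶠ[nhds s] fun _ => 1 :=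
        Filter.eventuallyEq_of_mem ((isOpen_lt hcont continuous_const).mem_nhds h)
          fun r hr => hneg _ hr
      rw [this.deriv_eq, deriv_const]
    · have : (fun s => if 1 + κ * s < 0 then 1 else χ (1 + κ * s)) =ᶠ[nhds s] fun _ => 0 :=
        Filter.eventuallyEq_of_mem ((isOpen_lt continuous_const hcont).mem_nhds h) fun r hr => by
          have hr : 1 < 1 + κ * r := hr
          rw [if_neg (by linarith), hz _ (by linarith)]
      rw [this.deriv_eq, deriv_const]
  · refine if_neg ?_
    rcases hκ with rfl | rfl <;> linarith [hs.1, hs.2]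

theorem SmoothOnSphere.contDiffOn_radialExt [n.AtLeastTwo] {a : Sphere n → ℂ}
    (ha : SmoothOnSphere n a) : ContDiffOn ℝ ∞ (radialExt a) {0}ᶜ := by
  obtain ⟨U, hU⟩ : ∃ U : TopologicalSpace.Opens (Space n), U = ⟨{0}ᶜ, isOpen_compl_zero⟩ :=
    ⟨_, rfl⟩
  have hU' : ∀ x, x ∈ U ↔ x ≠ 0 := fun x => by rw [hU]; rfl
  have hmem : ∀ x : U, (x : Space n) ≠ 0 := fun x => (hU' x).1 x.2
  have hν : ContDiffOn ℝ ∞ (fun x : Space n => ‖x‖⁻¹ • x) {0}ᶜ := fun x hx =>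
    (((contDiffAt_norm ℝ hx).inv (norm_ne_zero_iff.2 hx)).smul contDiffAt_id).contDiffWithinAt
  have hν' : ContMDiff 𝓘(ℝ, Space n) 𝓘(ℝ, Space n) ∞
      fun x : U => ‖(x : Space n)‖⁻¹ • (x : Space n) :=
    fun x => contMDiffAt_subtype_iff.2
      (hν.contDiffAt (isOpen_compl_zero.mem_nhds (hmem x))).contMDiffAt
  have hs : ∀ x : U,
      ‖(x : Space n)‖⁻¹ • (x : Space n) ∈ Metric.sphere (0 : Space n) 1 := fun x => by
    rw [mem_sphere_zero_iff_norm, norm_smul, norm_inv, norm_norm,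
      inv_mul_cancel₀ (norm_ne_zero_iff.mpr (hmem x))]
  have h := ContMDiff.comp ha (hν'.codRestrict_sphere (n := n - 1) hs)
  intro x hx
  have hxU : x ∈ U := (hU' x).2 hx
  have h1 : ContMDiffAt 𝓘(ℝ, Space n) 𝓘(ℝ, ℂ) ∞ (fun y : U => radialExt a y) ⟨x, hxU⟩ := by
    refine (h ⟨x, hxU⟩).congr_of_eventuallyEq (Filter.Eventually.of_forall fun y => ?_)
    simp only [radialExt, dif_neg (hmem y)]
    rfl
  exact (contMDiffAt_subtype_iff.1 h1).contDiffAt.contDiffWithinAt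

theorem radialExt_sphere (a : Sphere n → ℂ) (θ : Sphere n) : radialExt a θ = a θ := by
  rw [radialExt, dif_neg (sphere_ne_zero θ)]
  congr 1
  ext1
  simp only [mem_sphere_zero_iff_norm.1 θ.2, inv_one, one_smul]

theorem backprojection_phgComponent (a : Sphere n → ℂ) (γ : ℂ) (ℓ : ℕ) {χ ψ : ℝ → ℂ} {κ : ℝ}
    (hψ : ∀ s ∈ openI, ψ s = χ (1 + κ * s)) {x : Space n} (hx : x ∈ Metric.ball (0 : Space n) 1) :
    backprojection n (phgComponent a γ ℓ χ κ) x =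
      sphereInt (radialExt a) (fun s => ψ s * sigmaLog γ ℓ s) x := by
  rw [backprojection, sphereInt]
  refine MeasureTheory.integral_congr_ae (Filter.Eventually.of_forall fun θ => ?_)
  simp only [phgComponent, radialExt_sphere, hψ _ (inner_mem_openI hx θ), sigmaLog]
  ring

/-! ### Index sets -/

theorem IsIndexSet.countable {E : Set (ℂ × ℕ)} (hE : IsIndexSet E) : E.Countable := by
  refine (Set.countable_iUnion fun N : ℕ => (hE.finite_lt N).countable).mono fun p hp => ?_
  obtain ⟨N, hN⟩ := exists_nat_gt p.1.re
  exact Set.mem_iUnion.2 ⟨N, hp, hN⟩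

/-- An index set is countable, so a generic starting weight `τ` makes all thresholds `τ + N` avoid
its real parts. Finiteness of `E` below `B` allows `τ` to lie below the whole set. -/
theorem IsIndexSet.exists_weight {E : Set (ℂ × ℕ)} (hE : IsIndexSet E) (B : ℝ) :
    ∃ τ < B, (∀ p ∈ E, τ < p.1.re) ∧ ∀ p ∈ E, ∀ N : ℕ, p.1.re ≠ τ + N := by
  obtain ⟨M, hM⟩ := ((hE.finite_lt B).image fun p => p.1.re).bddBelow
  have hc : (⋃ N : ℕ, (fun p : ℂ × ℕ => p.1.re - N) '' E).Countable :=
    Set.countable_iUnion fun N => hE.countable.image _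
  obtain ⟨τ, hτ, hτ'⟩ := (hc.dense_compl ℝ).exists_lt (min B M)
  refine ⟨τ, hτ'.trans_le (min_le_left _ _), fun p hp => ?_, fun p hp N h => ?_⟩
  · by_cases h : p.1.re < B
    · exact (hτ'.trans_le (min_le_right _ _)).trans_le (hM ⟨p, ⟨hp, h⟩, rfl⟩)
    · exact (hτ'.trans_le (min_le_left _ _)).trans_le (not_lt.1 h)
  · exact hτ (Set.mem_iUnion.2 ⟨N, p, hp, by simp [h]⟩)

theorem isIndexSet_generated {I : Set (ℂ × ℕ)} (hI : I.Finite) : IsIndexSet (generated I) :=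
  (isLeast_generated hI).1.1

theorem isIndexSet_indexSetF (n : ℕ) (γ : ℂ) (ℓ : ℕ) : IsIndexSet (indexSetF n γ ℓ) := by
  rw [indexSetF]
  split_ifs <;> exact isIndexSet_generated (by simp)

/-- The number of factors `ρ∂_ρ - (n-1)/2 - γ` of the indicial operators. -/
def indOrder (γ : ℂ) (ℓ : ℕ) : ℕ := open Classical in if ∃ m : ℕ, γ = m then ℓ else ℓ + 1

theorem mem_generated {I : Set (ℂ × ℕ)} {z : ℂ} {k : ℕ} (q : ℂ × ℕ) (hq : q ∈ I) (m : ℕ)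
    (hz : z = q.1 + m) (hk : k ≤ q.2) : (z, k) ∈ generated I := ⟨q, hq, ⟨m, hz⟩, hk⟩

theorem mem_indexSetF_of_lt_count (γ : ℂ) (ℓ N : ℕ) {y : ℂ} {k : ℕ}
    (h : k < (indRoots (((n : ℂ) - 1) / 2 + γ) (indOrder γ ℓ) N).count y) :
    (y, k) ∈ indexSetF n γ ℓ := by
  rw [indexSetF]
  have hh := lt_count_indRoots h
  split_ifs with h1 h2 h3
  · obtain ⟨hn, m, hm⟩ := h1
    rw [indOrder, if_pos ⟨m, hm⟩, h2] at hh
    rcases hh with ⟨rfl, j, hj⟩ | ⟨hk, -⟩ | ⟨rfl, ⟨j, hj⟩, -⟩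
    · exact mem_generated (0, 0) (by simp) j (by simp [hj]) le_rfl
    · omega
    · exact mem_generated (0, 0) (by simp) j (by simp [hj]) le_rfl
  · obtain ⟨hn, m, hm⟩ := h1
    rw [indOrder, if_pos ⟨m, hm⟩] at hh
    rcases hh with ⟨rfl, j, hj⟩ | ⟨hk, j, hj⟩ | ⟨rfl, ⟨j, hj⟩, i, hi⟩
    · exact mem_generated (0, 0) (by simp) j (by simp [hj]) le_rfl
    · exact mem_generated (_, ℓ - 1) (by simp) j hj (by simp only; omega)
    -- For even `n` and `γ ∈ ℕ₀` the number `z` is a half-integer, so the two families of roots are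
    -- disjoint.
    · exfalso
      obtain ⟨r, hr⟩ := hn
      rw [hj, hm, hr] at hi
      have h4 : ((2 * j + 1 : ℕ) : ℂ) = ((r + r + 2 * m + 2 * i : ℕ) : ℂ) := by
        push_cast at hi ⊢
        linear_combination 2 * hi
      have h5 : 2 * j + 1 = r + r + 2 * m + 2 * i := by exact_mod_cast h4
      omega
  · have hγ : ¬∃ m : ℕ, γ = m := by
      rintro ⟨m, hm⟩
      rcases h3 with ⟨hn, -⟩ | ⟨-, k, hk, hk'⟩
      · exact h1 ⟨hn, m, hm⟩
      · have h4 : ((m + k : ℕ) : ℂ) = ((0 : ℕ) : ℂ) := by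
          push_cast
          linear_combination hk' - hm
        have h5 : m + k = 0 := by exact_mod_cast h4
        omega
    rw [indOrder, if_neg hγ] at hh
    rcases hh with ⟨rfl, j, hj⟩ | ⟨hk, j, hj⟩ | ⟨rfl, ⟨j, hj⟩, i, hi⟩
    · exact mem_generated (0, 0) (by simp) j (by simp [hj]) le_rfl
    · exact mem_generated (_, ℓ) (by simp) j hj (by simp only; omega)
    · have h4 : ((n : ℝ) - 1) / 2 + γ.re = j - i := by
        have : ((n : ℂ) - 1) / 2 + γ = ((j - i : ℝ) : ℂ) := by
          push_cast
          linear_combination hj - hi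
        have h5 := congrArg Complex.re this
        have h6 : (((n : ℂ) - 1) / 2).re = ((n : ℝ) - 1) / 2 := by
          have : ((n : ℂ) - 1) / 2 = ((((n : ℝ) - 1) / 2 : ℝ) : ℂ) := by push_cast; rfl
          rw [this, Complex.ofReal_re]
        rwa [Complex.add_re, h6, Complex.ofReal_re] at h5
      -- The common roots are the integers `y ≥ max(0, z)`; the offset from that generator is `i` if
      -- `z ≥ 0` and `j` otherwise.
      rcases le_total 0 (((n : ℝ) - 1) / 2 + γ.re) with h5 | h5
      · refine mem_generated _ (Or.inr (Or.inr rfl)) i ?_ le_rfl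
        rw [max_eq_right h5, h4, hj]
        push_cast
        ring
      · refine mem_generated _ (Or.inr (Or.inr rfl)) j ?_ le_rfl
        rw [max_eq_left h5, hj]
        simp
  · rcases hh with ⟨rfl, j, hj⟩ | ⟨hk, j, hj⟩ | ⟨hk, ⟨j, hj⟩, i, hi⟩
    · exact mem_generated (0, 0) (by simp) j (by simp [hj]) le_rfl
    · refine mem_generated (_, ℓ) (by simp) j hj ?_
      rw [indOrder] at hk
      split_ifs at hk <;> simp only <;> omega
    · by_cases hγ : ∃ m : ℕ, γ = m
      · rw [indOrder, if_pos hγ] at hk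
        -- For `γ ∈ ℕ₀` the order is `e = ℓ`, so even at a common root the logarithm has power at
        -- most `ℓ`: the cancelled factor and the coincidence balance.
        exact mem_generated (_, ℓ) (by simp) i hi hk.le
      -- A common root makes `z` an integer. Then `γ ∈ 1/2 + ℤ` for even `n`, and `γ ∈ ℤ` for odd
      -- `n`; with `γ ∉ ℕ₀` both belong to the preceding branch.
      · exfalso
        have h4 : γ = (j : ℂ) - i - ((n : ℂ) - 1) / 2 := by linear_combination hj - hi
        rcases Nat.even_or_odd' n with ⟨r, hr | hr⟩
        · refine h3 (Or.inl ⟨⟨r, by omega⟩, (j : ℤ) - i - r, ?_⟩)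
          rw [h4, hr]
          push_cast
          ring
        · have h5 : γ = (((j : ℤ) - i - r : ℤ) : ℂ) := by
            rw [h4, hr]
            push_cast
            ring
          rcases le_or_gt 0 ((j : ℤ) - i - r) with h6 | h6
          · obtain ⟨m, hm⟩ := Int.eq_ofNat_of_zero_le h6
            exact hγ ⟨m, by rw [h5, hm]; simp⟩
          · obtain ⟨m, hm⟩ := Int.eq_ofNat_of_zero_le (a := -((j : ℤ) - i - r)) (by omega)
            refine h3 (Or.inr ⟨⟨r, hr⟩, m, by omega, ?_⟩)
            rw [h5, ← neg_neg ((j : ℤ) - i - r), hm]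
            simp

end Backprojection

end


/-! ### The theorem, assembled. -/

theorem theorem2p2 (n : ℕ) [n.AtLeastTwo]
    (a : Backprojection.Sphere n → ℂ) (ha : Backprojection.SmoothOnSphere n a) (ha0 : a ≠ 0)
    (γ : ℂ) (ℓ : ℕ)
    (χ : ℝ → ℂ) (hχ : Backprojection.IsCutoff χ)
    (κ : ℝ) (hκ : κ = 1 ∨ κ = -1) :
    Backprojection.IsPolyhomogeneous n (Backprojection.indexSetF n γ ℓ)
      (Backprojection.backprojection n (Backprojection.phgComponent a γ ℓ χ κ)) := by
  open Backprojection in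
  obtain ⟨ψ, hψ, ⟨δ, hδ, h0⟩, hψχ⟩ := hχ.exists_contDiff hκ
  have hE := isIndexSet_indexSetF n γ ℓ
  -- The bound `τ ≤ 0` allows the comparison of `σ` with `ρ`, and `τ < Re γ` leaves room for the
  -- logarithms.
  obtain ⟨τ, hτ, hlt, hne⟩ := hE.exists_weight (min 0 γ.re)
  have hτ0 : τ ≤ 0 := (hτ.trans_le (min_le_left _ _)).le
  have hτγ : τ < γ.re := hτ.trans_le (min_le_right _ _)
  have hext := ha.contDiffOn_radialExt
  have hf := contDiffOn_mul_sigmaLog hψ γ ℓ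
  have hw := ridge_sigmaLog_mem_conormal hext hψ ℓ hτ0 hτγ
  have hball : ∀ x ∈ Metric.ball (0 : Space n) 1, backprojection n (phgComponent a γ ℓ χ κ) x =
      sphereInt (radialExt a) (fun s => ψ s * sigmaLog γ ℓ s) x := fun x hx =>
    backprojection_phgComponent a γ ℓ hψχ hx
  have hcollar : ∀ x ∈ collarHalf n, backprojection n (phgComponent a γ ℓ χ κ) x =
      ridge hext hf x := fun x hx => by
    rw [ridge_apply _ _ hx, hball x (collarHalf_subset_ball hx)]
  have hind : ∀ N, ridge hext hf ∈
      indSpace n (((n : ℂ) - 1) / 2 + γ) τ (indOrder γ ℓ) N := fun N => by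
    rw [indOrder]
    split_ifs with h
    · obtain ⟨m, hm⟩ := h
      exact ridge_sigmaLog_natCast_mem_indSpace hext hψ hδ h0 hτ0 hm hτγ ℓ N
    · exact ridge_sigmaLog_mem_indSpace hext hψ hδ h0 hτ0 hτγ ℓ N
  refine isPolyhomogeneous_of_indicialData (τ := τ)
    (zs := indRoots (((n : ℂ) - 1) / 2 + γ) (indOrder γ ℓ)) (w := ridge hext hf)
    ⟨hE, fun N M h z => count_indRoots_mono _ _ h z,
      fun N z k h => mem_indexSetF_of_lt_count γ ℓ N h, hlt, hne, hw, fun N => ?_⟩ hcollar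
    ⟨τ, isConormalOn_ball ((contDiffOn_sphereInt_ball hext hf).congr hball) hτ0
      (isConormalOn_of_mem_conormal hw hcollar)⟩
  rw [rootPoly_indRoots]
  exact mem_indSpace.1 (hind N) N le_rfl
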